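/- Let $(C,o)$ be a reduced complex-analytic curve germ, i.e. its local algebra $\mathcal O$ is a reduced quotient $\mathbb C\{x_1,\dots,x_N\}/I$ of dimension one. Let $\overline{\mathcal O}\cong\prod_{i=1}^r\mathbb C\{t_i\}$ be the integral closure of $\mathcal O$ in its total ring of fractions, the index $i$ running over the branches of $(C,o)$. *Weights.* For $\ell\in\mathbb N^r$ put $|\ell|=\sum_i\ell_i$ and $\mathcal F(\ell)=\{f\in\mathcal O:\operatorname{ord}_{t_i}f\ge\ell_i\text{ for all }i\}$, and define the weight $w_0(\ell)=2\dim_{\mathbb C}\mathcal O/\mathcal F(\ell)-|\ell|\in\mathbb Z$. Let $m=(m_1,\dots,m_r)$ be the vector of multiplicities of the branches: $m_i$ is the least order $\operatorname{ord}_{t_i}f$ of a non-unit $f\in\mathcal O$. *Minimal spectral cycles.* Decompose $\mathbb R_{\ge0}^r$ into unit cubes with vertex set $\mathbb N^r$. For $n\in\mathbb Z$ let $S_n$ be the full subcomplex spanned by the vertices $\ell$ with $w_0(\ell)\le n$, and for $d\in\mathbb N$ let $X_{-d}$ be the full subcomplex spanned by the vertices with $|\ell|\ge d$. If $|m|\ge3$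 and $n=(2-|m|)j+k$ with $j,k\in\mathbb N$, the group of minimal spectral $k$-cycles of weight $n$ is $$M_{k,n}=H_k\bigl(S_n\cap X_{-j|m|},\;S_n\cap X_{-j|m|-1};\mathbb Z\bigr).$$ One says that $(C,o)$ has a minimal spectral $k$-cycle of weight $n$ if $|m|\ge 3$, $n$ is of this form, and $M_{k,n}\neq0$. (For $k=1$, $n=0$ this forces $|m|=3$, $j=1$.) *Dominance.* A germ $(C',o')$ with local algebra $\mathcal O'$ birationally dominates $(C,o)$ if the natural embedding $\mathcal O\hookrightarrow\overline{\mathcal O}$ factors as $\mathcal O\hookrightarrow\mathcal O'\hookrightarrow\overline{\mathcal O}$ through injective $\mathbb C$-algebra homomorphisms. The germ $A_n$ ($n\ge0$) has local algebra $\mathbb C\{x,y\}/(x^{n+1}+y^2)$, and the germ $D_n$ ($n\ge4$) has local algebra $\mathbb C\{x,y\}/(x^2y+y^{n-1})$. **Proposition.** Suppose that $(C,o)$ is not isomorphic to $A_n$ for any $n\ge0$. Then $(C,o)$ birationally dominates $D_n$ for some $n\ge4$ if and only if $\min_{\ell\in\mathbb N^r}w_0(\ell)=-1$ and $(C,o)$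 has a minimal spectral $1$-cycle of weight $0$. -/

import Mathlib

noncomputable section

namespace CurveGerm

universe u v

/-! ## Convergent power series and local algebras of curve germs -/

/-- A power series converges if it is absolutely summable on some polydisc of positive radius. -/
def IsConvergent {σ : Type*} (f : MvPowerSeries σ ℂ) : Prop :=
  ∃ ρ : ℝ, 0 < ρ ∧ Summable fun α : σ →₀ ℕ => ‖MvPowerSeries.coeff α f‖ * ρ ^ α.degree

theorem summable_of_le {σ : Type*} {f : MvPowerSeries σ ℂ} {ρ ρ' : ℝ} (h0 : 0 ≤ ρ') (h : ρ' ≤ ρ)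
    (hf : Summable fun α : σ →₀ ℕ => ‖MvPowerSeries.coeff α f‖ * ρ ^ α.degree) :
    Summable fun α : σ →₀ ℕ => ‖MvPowerSeries.coeff α f‖ * ρ' ^ α.degree := by
  refine Summable.of_nonneg_of_le (fun α => by positivity) (fun α => ?_) hf
  gcongr

theorem IsConvergent.add {σ : Type*} {f g : MvPowerSeries σ ℂ} (hf : IsConvergent f)
    (hg : IsConvergent g) : IsConvergent (f + g) := by
  obtain ⟨ρ, hρ, hf⟩ := hf
  obtain ⟨ρ', hρ', hg⟩ := hg
  have hm : 0 < min ρ ρ' := lt_min hρ hρ'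
  refine ⟨min ρ ρ', hm, ?_⟩
  refine Summable.of_nonneg_of_le (fun α => by positivity) (fun α => ?_)
    ((summable_of_le hm.le (min_le_left _ _) hf).add (summable_of_le hm.le (min_le_right _ _) hg))
  rw [← add_mul, map_add]
  gcongr
  exact norm_add_le _ _

theorem summable_antidiagonal {σ : Type*} [DecidableEq σ] {F G : (σ →₀ ℕ) → ℝ} (hF : Summable F)
    (hG : Summable G) (p1 : 0 ≤ F) (p2 : 0 ≤ G) :
    Summable fun α : σ →₀ ℕ => ∑ p ∈ Finset.HasAntidiagonal.antidiagonal α, F p.1 * G p.2 :=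
  summable_sum_mul_antidiagonal_of_summable_mul (hF.mul_of_nonneg hG p1 p2)

theorem norm_coeff_mul_le {σ : Type*} [DecidableEq σ] (f g : MvPowerSeries σ ℂ) (τ : ℝ)
    (hτ : 0 ≤ τ) (α : σ →₀ ℕ) :
    ‖MvPowerSeries.coeff α (f * g)‖ * τ ^ α.degree ≤
      ∑ p ∈ Finset.HasAntidiagonal.antidiagonal α,
        (‖MvPowerSeries.coeff p.1 f‖ * τ ^ p.1.degree) *
          (‖MvPowerSeries.coeff p.2 g‖ * τ ^ p.2.degree) := by
  rw [MvPowerSeries.coeff_mul]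
  refine (mul_le_mul_of_nonneg_right (norm_sum_le _ _) (pow_nonneg hτ _)).trans_eq ?_
  rw [Finset.sum_mul]
  refine Finset.sum_congr rfl fun p hp => ?_
  rw [← Finset.HasAntidiagonal.mem_antidiagonal.mp hp, map_add, pow_add, norm_mul]
  ring

theorem IsConvergent.mul {σ : Type*} {f g : MvPowerSeries σ ℂ} (hf : IsConvergent f)
    (hg : IsConvergent g) : IsConvergent (f * g) := by
  classical
  obtain ⟨ρ, hρ, hf⟩ := hf
  obtain ⟨ρ', hρ', hg⟩ := hg
  have hm : 0 < min ρ ρ' := lt_min hρ hρ'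
  have h1 := summable_of_le hm.le (min_le_left _ _) hf
  have h2 := summable_of_le hm.le (min_le_right _ _) hg
  have h0 : ∀ (h : MvPowerSeries σ ℂ) (α : σ →₀ ℕ),
      0 ≤ ‖MvPowerSeries.coeff α h‖ * min ρ ρ' ^ α.degree :=
    fun h α => mul_nonneg (norm_nonneg _) (pow_nonneg hm.le _)
  have h3 := summable_antidiagonal h1 h2 (h0 f) (h0 g)
  exact ⟨min ρ ρ', hm, Summable.of_nonneg_of_le (h0 _)
    (fun α => norm_coeff_mul_le f g _ hm.le α) h3⟩

theorem isConvergent_of_support {σ : Type*} {f : MvPowerSeries σ ℂ} (α₀ : σ →₀ ℕ)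
    (hf : ∀ α, α ≠ α₀ → MvPowerSeries.coeff α f = 0) : IsConvergent f := by
  refine ⟨1, one_pos, summable_of_ne_finset_zero (s := {α₀}) fun α hα => ?_⟩
  simp [hf α (by simpa using hα)]

/-- The ring `ℂ{x_s : s ∈ σ}` of convergent power series. -/
def ConvergentPowerSeries (σ : Type*) : Subalgebra ℂ (MvPowerSeries σ ℂ) where
  carrier := {f | IsConvergent f}
  mul_mem' := IsConvergent.mul
  add_mem' := IsConvergent.add
  algebraMap_mem' c := isConvergent_of_support 0 fun α hα => by
    classical
    rw [MvPowerSeries.algebraMap_apply, MvPowerSeries.coeff_C, if_neg hα]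

/-- The coordinate function `x_s`, as a convergent power series. -/
def coord {σ : Type*} (s : σ) : ConvergentPowerSeries σ :=
  ⟨MvPowerSeries.X s, isConvergent_of_support (Finsupp.single s 1) fun α hα => by
    classical
    rw [MvPowerSeries.coeff_X, if_neg hα]⟩

/-- `O` is the local algebra of a reduced complex-analytic curve germ: an analytic algebra
`ℂ{x_1, …, x_N} / I` which is reduced and of dimension one. (As such an algebra is local, every
irreducible component is then one-dimensional.) -/
structure IsReducedCurveGerm (O : Type u) [CommRing O] [Algebra ℂ O] : Prop where
  exists_presentation :
    ∃ (N : ℕ) (π : ConvergentPowerSeries (Fin N) →ₐ[ℂ] O), Function.Surjective π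
  isReduced : IsReduced O
  krullDim_eq_one : ringKrullDim O = 1

/-- The local algebra of the simple plane curve germ `A_n`, with equation `x ^ (n + 1) + y ^ 2`
(for `n = 0` this is the smooth germ). -/
abbrev GermA (n : ℕ) : Type :=
  ConvergentPowerSeries (Fin 2) ⧸
    Ideal.span {(coord 0 ^ (n + 1) + coord 1 ^ 2 : ConvergentPowerSeries (Fin 2))}

/-- The local algebra of the simple plane curve germ `D_n`, with equation
`x ^ 2 * y + y ^ (n - 1)`; it is only used for `n ≥ 4`. -/
abbrev GermD (n : ℕ) : Type :=
  ConvergentPowerSeries (Fin 2) ⧸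
    Ideal.span {(coord 0 ^ 2 * coord 1 + coord 1 ^ (n - 1) : ConvergentPowerSeries (Fin 2))}

/-! ## Normalization and birational dominance -/

/-- The ring of the normalization: the integral closure of `O` in its total ring of fractions. -/
abbrev Normalization (O : Type u) [CommRing O] : Type u :=
  ↥(integralClosure O (FractionRing O))

/-- The germ with local algebra `O'` birationally dominates the germ with local algebra `O`:
the natural embedding of `O` in its normalization factors as `O ↪ O' ↪ Normalization O`. -/
def BirationallyDominates (O' : Type v) [CommRing O'] [Algebra ℂ O']
    (O : Type u) [CommRing O] [Algebra ℂ O] : Prop :=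
  ∃ (φ : O →ₐ[ℂ] O') (ψ : O' →ₐ[ℂ] Normalization O),
    Function.Injective φ ∧ Function.Injective ψ ∧
      ∀ f : O, ψ (φ f) = algebraMap O (Normalization O) f

/-! ## The lattice of a germ, its filtrations and the weight function -/

section Lattice

variable (O : Type u) [CommRing O]

/-- The branches of the germ, that is, the points of its normalization. -/
abbrev Branch : Type u := MaximalSpectrum (Normalization O)

/-- The sum `|ℓ|` of the coordinates of a lattice point (the index set is meant to be finite). -/
def size {ι : Type*} (l : ι → ℕ) : ℕ := ∑ᶠ i, l i

/-- The ideal of those elements of the normalization that vanish to order at least `l i` at the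
point `i` for every `i`; vanishing to order at least `k` at a point of the (smooth) normalization
means membership in the `k`-th power of the maximal ideal of that point. If the normalization is
written as `∏ ℂ{t_i}`, this is the ideal `(t_1 ^ l_1, …, t_r ^ l_r)`. -/
def normalizationFiltration (l : Branch O → ℕ) : Ideal (Normalization O) :=
  ⨅ i : Branch O, i.asIdeal ^ l i

/-- The lattice filtration of `O` itself. -/
def latticeFiltration (l : Branch O → ℕ) : Ideal O :=
  (normalizationFiltration O l).comap (algebraMap O (Normalization O))

/-- The multiplicity of the branch `i`: the least order of vanishing along that branch of a
function germ vanishing at the base point (equivalently, the largest `k` such that all of these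
vanish to order at least `k`). -/
def multiplicity (i : Branch O) : ℕ :=
  sSup {k : ℕ | ∀ f : O, ¬ IsUnit f → algebraMap O (Normalization O) f ∈ i.asIdeal ^ k}

variable [Algebra ℂ O]

/-- The Hilbert function of the lattice filtration. -/
def hilbert (l : Branch O → ℕ) : ℕ := Module.finrank ℂ (O ⧸ latticeFiltration O l)

/-- The weight function `w_0(l) = 2 h(l) - |l|`. -/
def weight (l : Branch O → ℕ) : ℤ := 2 * (hilbert O l : ℤ) - (size l : ℤ)

end Lattice

/-! ## Homology of pairs of full cubical subcomplexes of the positive orthant -/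

section Cubical

variable {ι : Type u}

open Classical in
/-- The vertex `l + ∑_{i ∈ I} e^i`. -/
def shift (l : ι → ℕ) (I : Finset ι) : ι → ℕ := fun i => if i ∈ I then l i + 1 else l i

/-- The cubes of the orthant: the pair `(l, I)` stands for the cube of dimension `|I|` with
vertices `l + ∑_{i ∈ J} e^i`, for `J ⊆ I`. -/
abbrev Cube (ι : Type u) : Type u := (ι → ℕ) × Finset ι

/-- The cubes of dimension `k` in the full subcomplex spanned by a set `V` of vertices. -/
def fullCubes (V : Set (ι → ℕ)) (k : ℕ) : Set (Cube ι) :=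
  {c | c.2.card = k ∧ ∀ J ⊆ c.2, shift c.1 J ∈ V}

/-- The cubical `k`-chains with integer coefficients of the full subcomplex spanned by `V`. -/
def chains (V : Set (ι → ℕ)) (k : ℕ) : Submodule ℤ (Cube ι →₀ ℤ) :=
  Finsupp.supported ℤ ℤ (fullCubes V k)

open Classical in
/-- The boundary of a cube: the alternating sum of its opposite pairs of facets, with respect to
the orientation coming from a (fixed, arbitrary) linear order of the coordinate directions. -/
def cubeBoundary (c : Cube ι) : Cube ι →₀ ℤ :=
  ∑ i ∈ c.2, (-1 : ℤ) ^ (c.2.filter fun j => WellOrderingRel j i).card •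
    (Finsupp.single (shift c.1 {i}, c.2.erase i) 1 - Finsupp.single (c.1, c.2.erase i) 1)

/-- The boundary operator on cubical chains. -/
def boundary : (Cube ι →₀ ℤ) →ₗ[ℤ] (Cube ι →₀ ℤ) :=
  Finsupp.lift (Cube ι →₀ ℤ) ℤ (Cube ι) cubeBoundary

/-- Relative `k`-cycles: `k`-chains in `V` with boundary in `W` (no condition if `k = 0`, where
the boundary is zero). -/
def relCycles (V W : Set (ι → ℕ)) (k : ℕ) : Submodule ℤ (Cube ι →₀ ℤ) :=
  chains V k ⊓ (chains W (k - 1)).comap boundary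

/-- Relative `k`-boundaries: boundaries of `(k + 1)`-chains in `V`, modulo `k`-chains in `W`. -/
def relBoundaries (V W : Set (ι → ℕ)) (k : ℕ) : Submodule ℤ (Cube ι →₀ ℤ) :=
  (chains V (k + 1)).map boundary ⊔ chains W k

/-- The relative homology group `H_k(X_V, X_W; ℤ)` of the full cubical subcomplexes spanned by
sets of vertices `W ⊆ V`. -/
abbrev RelHomology (V W : Set (ι → ℕ)) (k : ℕ) : Type u :=
  ↥(relCycles V W k) ⧸ (relBoundaries V W k).comap (relCycles V W k).subtype

end Cubical

/-! ## The spectral sequence and minimal spectral cycles -/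

section Spectral

variable (O : Type u) [CommRing O] [Algebra ℂ O]

/-- The vertices of the intersection of the weight-at-most-`n` space `S_n` with the piece of the
level filtration spanned by the vertices `l` with `|l| ≥ d`. -/
def levelVertices (n : ℤ) (d : ℕ) : Set (Branch O → ℕ) :=
  {l | weight O l ≤ n ∧ d ≤ size l}

/-- The summand `(E^1_{-d, k + d})_{-2n}` of the first page of the spectral sequence of the level
filtration, namely `H_k(S_n ∩ X_{-d}, S_n ∩ X_{-d-1}; ℤ)`. -/
abbrev E1 (d k : ℕ) (n : ℤ) : Type u :=
  RelHomology (levelVertices O n d) (levelVertices O n (d + 1)) k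

/-- The germ has a minimal spectral `k`-cycle of weight `n`: its total multiplicity `|m|` is at
least `3`, and `n = (2 - |m|) j + k` for some natural number `j` (unique, as `|m| ≠ 2`) for which
the group `M_{k,n} = (E^1_{-j|m|, k + j|m|})_{-2n}` is nonzero. -/
def HasMinimalSpectralCycle (k : ℕ) (n : ℤ) : Prop :=
  3 ≤ size (multiplicity O) ∧
    ∃ j : ℕ, n = (2 - (size (multiplicity O) : ℤ)) * j + k ∧
      Nontrivial (E1 O (j * size (multiplicity O)) k n)

end Spectral

end CurveGerm

end

/-! Everything is computed on a parametrization: an embedding `θ` of `O` in a finite product of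
copies of `ℂ{t}` whose image contains `t ^ N` times the whole product
(`IsReducedCurveGerm.exists_model`). Weierstrass division makes `O` finite over `ℂ{z}`. The quotient
by each minimal prime embeds in `ℂ{t}` through a Puiseux root of least ramification, and the
branches are glued by functions vanishing on all branches but one. The product is then the
normalization (`IsModel.exists_normalization_equiv`), so multiplicities, the Hilbert function `h`
and dominance are all read off from orders in `t`.

The cycle. Weight `0` with `k = 1` means `(|m| - 2) j = 1`, so `|m| = 3` and `j = 1`. A vertex of
size `3` and weight at most `0` has `h ≤ 1`, which forces it to be `m`. Thus `S_0 ∩ X_{-3}` has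
exactly one vertex, `m`, outside `S_0 ∩ X_{-4}`. All neighbours `m + e^i` have weight `0`, and the
square at `m` in directions `i ≠ j` is present iff `h(m + e^i + e^j) ≤ 2`, that is, iff the leading
coefficients of nonunits along `i` and along `j` vanish simultaneously (`SameLeading`). The homology
group is therefore the reduced `H_0` of a graph on the branches whose adjacency is an equivalence
relation; it is nonzero iff two branches are inequivalent
(`IsBranchModel.hasMinimalSpectralCycle_iff`).

From the cycle to dominance. Since `|m| = 3` and there are two inequivalent branches, the branches
have multiplicities `1, 1, 1` or `1, 2`, and some smooth branch is inequivalent to all others.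
Choose `y` vanishing on it and of least possible order on the others, and `x` a parameter on it. On
the remaining branches, `x` minus a suitable series in `y` is, up to a unit series in `y`, `± y ^ k`
or a square root of `y ^ (2 p + 1)`. This is the equation of some `D_n`
(`IsBranchModel.exists_dominates_germD`).

From dominance to the cycle. A germ between `D_n` and its normalization inherits the parametrization
of `D_n`, hence functions `x`, `y` with known orders. For odd `n` the second branch has multiplicity
`2`, because a germ with two branches of multiplicity one is some `A_n` (`exists_equiv_germA`). So
`|m| = 3`, and `y` witnesses inequivalence. Independent powers of `x` and `y` bound `h` from below
in two ways whose sum is `2 h(l) ≥ |l| - 1`, with equality at `m`. -/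

noncomputable section

namespace CurveGerm

open MvPowerSeries Finset
open scoped NNReal ENNReal

/-! ## Weighted norms of power series -/

section Norm

variable {σ τ : Type*}

/-- The monomial `x ^ α` evaluated at a polyradius. -/
def polyWeight (r : σ → ℝ≥0) (α : σ →₀ ℕ) : ℝ≥0 := α.prod fun s n => r s ^ n

/-- The weighted `ℓ¹`-norm of a power series, with respect to a polyradius. -/
def wnorm (r : σ → ℝ≥0) (f : MvPowerSeries σ ℂ) : ℝ≥0∞ :=
  ∑' α, ‖coeff α f‖ₑ * polyWeight r α

theorem polyWeight_add (r : σ → ℝ≥0) (α β : σ →₀ ℕ) :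
    polyWeight r (α + β) = polyWeight r α * polyWeight r β := by
  classical
  exact Finsupp.prod_add_index' (by simp) (by intros; rw [pow_add])

@[simp]
theorem polyWeight_single (r : σ → ℝ≥0) (s : σ) (n : ℕ) :
    polyWeight r (Finsupp.single s n) = r s ^ n :=
  Finsupp.prod_single_index (pow_zero _)

@[simp]
theorem polyWeight_zero (r : σ → ℝ≥0) : polyWeight r 0 = 1 := Finsupp.prod_zero_index

theorem polyWeight_const (ρ : ℝ≥0) (α : σ →₀ ℕ) :
    polyWeight (fun _ => ρ) α = ρ ^ α.degree := by
  rw [polyWeight, Finsupp.prod, Finset.prod_pow_eq_pow_sum]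
  rfl

theorem polyWeight_pos {r : σ → ℝ≥0} (hr : ∀ s, 0 < r s) (α : σ →₀ ℕ) : 0 < polyWeight r α :=
  Finset.prod_pos fun s _ => pow_pos (hr s) _

theorem polyWeight_mono {r r' : σ → ℝ≥0} (h : r ≤ r') (α : σ →₀ ℕ) :
    polyWeight r α ≤ polyWeight r' α :=
  Finset.prod_le_prod' fun s _ => pow_le_pow_left' (h s) _

theorem wnorm_mono {r r' : σ → ℝ≥0} (h : r ≤ r') (f : MvPowerSeries σ ℂ) :
    wnorm r f ≤ wnorm r' f :=
  ENNReal.tsum_le_tsum fun α => by gcongr; exact polyWeight_mono h α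

theorem enorm_coeff_mul_le_wnorm (r : σ → ℝ≥0) (f : MvPowerSeries σ ℂ) (α : σ →₀ ℕ) :
    ‖coeff α f‖ₑ * polyWeight r α ≤ wnorm r f :=
  ENNReal.le_tsum (f := fun α => ‖coeff α f‖ₑ * (polyWeight r α : ℝ≥0∞)) α

theorem tsum_antidiagonal_mul (F G : (σ →₀ ℕ) → ℝ≥0∞) [DecidableEq σ] :
    ∑' α : σ →₀ ℕ, ∑ p ∈ antidiagonal α, F p.1 * G p.2 = (∑' α, F α) * ∑' α, G α := by
  rw [← ENNReal.tsum_mul_right]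
  simp_rw [← ENNReal.tsum_mul_left]
  rw [← ENNReal.tsum_prod (f := fun a b => F a * G b),
    ← Finset.HasAntidiagonal.sigmaAntidiagonalEquivProd.tsum_eq (fun p : (σ →₀ ℕ) × (σ →₀ ℕ) => F p.1 * G p.2),
    ENNReal.tsum_sigma' (fun c : Σ n : σ →₀ ℕ, antidiagonal n =>
      F (Finset.HasAntidiagonal.sigmaAntidiagonalEquivProd c).1 * G (Finset.HasAntidiagonal.sigmaAntidiagonalEquivProd c).2)]
  refine tsum_congr fun α => ?_
  rw [tsum_fintype, ← Finset.sum_coe_sort]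
  rfl

theorem wnorm_mul_le (r : σ → ℝ≥0) (f g : MvPowerSeries σ ℂ) :
    wnorm r (f * g) ≤ wnorm r f * wnorm r g := by
  classical
  rw [wnorm, wnorm, wnorm, ← tsum_antidiagonal_mul]
  refine ENNReal.tsum_le_tsum fun α => ?_
  rw [coeff_mul]
  refine (mul_le_mul_left (enorm_sum_le _ _) _).trans_eq ?_
  rw [Finset.sum_mul]
  refine Finset.sum_congr rfl fun p hp => ?_
  rw [← mem_antidiagonal.mp hp, polyWeight_add, enorm_mul]
  push_cast
  ring

theorem wnorm_one_le (r : σ → ℝ≥0) : wnorm r 1 ≤ 1 := by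
  classical
  rw [wnorm, tsum_eq_single 0]
  · simp
  · intro α hα
    simp [coeff_one, hα]

theorem wnorm_pow_le (r : σ → ℝ≥0) (f : MvPowerSeries σ ℂ) (n : ℕ) :
    wnorm r (f ^ n) ≤ wnorm r f ^ n := by
  induction n with
  | zero => simpa using wnorm_one_le r
  | succ n ih =>
    rw [pow_succ, pow_succ]
    exact (wnorm_mul_le r _ _).trans (mul_le_mul_left ih _)

theorem wnorm_prod_le {κ : Type*} (r : σ → ℝ≥0) (f : κ → MvPowerSeries σ ℂ) (t : Finset κ) :
    wnorm r (∏ i ∈ t, f i) ≤ ∏ i ∈ t, wnorm r (f i) := by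
  classical
  induction t using Finset.induction_on with
  | empty => simpa using wnorm_one_le r
  | insert a t ha ih =>
    rw [Finset.prod_insert ha, Finset.prod_insert ha]
    exact (wnorm_mul_le r _ _).trans (mul_le_mul_right ih _)

/-- With norms valued in `[0, ∞]`, sums may be rearranged freely, and convergence becomes finiteness
of one norm. -/
theorem isConvergent_iff_wnorm {f : MvPowerSeries σ ℂ} :
    IsConvergent f ↔ ∃ ρ : ℝ≥0, 0 < ρ ∧ wnorm (fun _ => ρ) f ≠ ⊤ := by
  have key : ∀ ρ : ℝ≥0, (Summable fun α : σ →₀ ℕ => ‖coeff α f‖ * (ρ : ℝ) ^ α.degree) ↔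
      wnorm (fun _ => ρ) f ≠ ⊤ := by
    intro ρ
    have h2 : wnorm (fun _ => ρ) f =
        ∑' α : σ →₀ ℕ, ((‖coeff α f‖₊ * ρ ^ α.degree : ℝ≥0) : ℝ≥0∞) := by
      refine tsum_congr fun α => ?_
      rw [polyWeight_const]
      push_cast
      rfl
    rw [h2, ENNReal.tsum_coe_ne_top_iff_summable, ← NNReal.summable_coe]
    simp
  constructor
  · rintro ⟨ρ, hρ, h⟩
    exact ⟨⟨ρ, hρ.le⟩, hρ, (key ⟨ρ, hρ.le⟩).1 h⟩
  · rintro ⟨ρ, hρ, h⟩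
    exact ⟨ρ, hρ, (key ρ).2 h⟩

theorem isConvergent_of_wnorm [Finite σ] {r : σ → ℝ≥0} (hr : ∀ s, 0 < r s)
    {f : MvPowerSeries σ ℂ} (hf : wnorm r f ≠ ⊤) : IsConvergent f := by
  rw [isConvergent_iff_wnorm]
  rcases isEmpty_or_nonempty σ with h | h
  · exact ⟨1, one_pos, by rwa [Subsingleton.elim (fun _ : σ => (1 : ℝ≥0)) r]⟩
  · obtain ⟨s, hs⟩ := Finite.exists_min r
    exact ⟨r s, hr s, ne_top_of_le_ne_top hf (wnorm_mono hs f)⟩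

theorem enorm_tsum_coeff_le {F : ℕ → ℂ} : ‖∑' n, F n‖ₑ ≤ ∑' n, ‖F n‖ₑ :=
  enorm_tsum_le_tsum_enorm

end Norm

/-! ## Weierstrass division -/

section Weierstrass

variable {σ : Type*}

/-- Division by `x_s ^ k`, discarding the terms that are not divisible. -/
def shiftDown (s : σ) (k : ℕ) (f : MvPowerSeries σ ℂ) : MvPowerSeries σ ℂ :=
  fun α => coeff (α + Finsupp.single s k) f

@[simp]
theorem coeff_shiftDown (s : σ) (k : ℕ) (f : MvPowerSeries σ ℂ) (α : σ →₀ ℕ) :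
    coeff α (shiftDown s k f) = coeff (α + Finsupp.single s k) f := rfl

/-- The terms of degree less than `k` in `x_s`. -/
def lowPart (s : σ) (k : ℕ) (f : MvPowerSeries σ ℂ) : MvPowerSeries σ ℂ :=
  fun α => if α s < k then coeff α f else 0

@[simp]
theorem coeff_lowPart (s : σ) (k : ℕ) (f : MvPowerSeries σ ℂ) (α : σ →₀ ℕ) :
    coeff α (lowPart s k f) = if α s < k then coeff α f else 0 := rfl

theorem coeff_X_pow_mul_eq [DecidableEq σ] (s : σ) (k : ℕ) (g : MvPowerSeries σ ℂ)
    (α : σ →₀ ℕ) :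
    coeff α (X s ^ k * g) = if k ≤ α s then coeff (α - Finsupp.single s k) g else 0 := by
  rw [X_pow_eq, coeff_monomial_mul]
  simp [Finsupp.single_le_iff]

theorem eq_lowPart_add (s : σ) (k : ℕ) (f : MvPowerSeries σ ℂ) :
    f = lowPart s k f + X s ^ k * shiftDown s k f := by
  classical
  ext α
  rw [map_add, coeff_lowPart, coeff_X_pow_mul_eq, coeff_shiftDown]
  split_ifs with h1 h2 h2
  · omega
  · simp
  · rw [tsub_add_cancel_of_le (by simpa using h2), zero_add]
  · omega

theorem wnorm_shiftDown_le (r : σ → ℝ≥0) (s : σ) (k : ℕ) (f : MvPowerSeries σ ℂ) :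
    (r s : ℝ≥0∞) ^ k * wnorm r (shiftDown s k f) ≤ wnorm r f := by
  rw [wnorm, ← ENNReal.tsum_mul_left]
  refine le_trans (le_of_eq ?_) (ENNReal.tsum_comp_le_tsum_of_injective
    (f := fun α : σ →₀ ℕ => α + Finsupp.single s k) (add_left_injective _)
    (fun α => ‖coeff α f‖ₑ * (polyWeight r α : ℝ≥0∞)))
  refine tsum_congr fun α => ?_
  rw [coeff_shiftDown, polyWeight_add, polyWeight_single]
  push_cast
  ring

theorem wnorm_lowPart_le (r : σ → ℝ≥0) (s : σ) (k : ℕ) (f : MvPowerSeries σ ℂ) :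
    wnorm r (lowPart s k f) ≤ wnorm r f := by
  refine ENNReal.tsum_le_tsum fun α => ?_
  rw [coeff_lowPart]
  split_ifs <;> simp

theorem exists_common_radius {f g : MvPowerSeries σ ℂ} (hf : IsConvergent f)
    (hg : IsConvergent g) : ∃ ρ : ℝ≥0, 0 < ρ ∧ wnorm (fun _ => ρ) f ≠ ⊤ ∧
      wnorm (fun _ => ρ) g ≠ ⊤ := by
  obtain ⟨ρ, hρ, h⟩ := isConvergent_iff_wnorm.1 hf
  obtain ⟨ρ', hρ', h'⟩ := isConvergent_iff_wnorm.1 hg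
  exact ⟨min ρ ρ', lt_min hρ hρ',
    ne_top_of_le_ne_top h (wnorm_mono (fun _ => min_le_left _ _) f),
    ne_top_of_le_ne_top h' (wnorm_mono (fun _ => min_le_right _ _) g)⟩

/-- The radius is `ε ρ` in the direction `s` and `ε ^ (k + 1) ρ` in the others. A monomial of `p`
either contains another variable or is a power of `x_s` of exponent above `k`; both gain a factor `ε
^ (k + 1)`, whereas `r s ^ k` only loses `ε ^ k`. The spare factor `ε` absorbs the norm of `p`. -/
theorem exists_small_polyradius [DecidableEq σ] (s : σ) (k : ℕ) {p : MvPowerSeries σ ℂ} {ρ : ℝ≥0}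
    (hρ : 0 < ρ) (hp : wnorm (fun _ => ρ) p ≠ ⊤)
    (hp0 : ∀ j ≤ k, coeff (Finsupp.single s j) p = 0) :
    ∃ r : σ → ℝ≥0, (∀ i, 0 < r i) ∧ (∀ i, r i ≤ ρ) ∧
      wnorm r p ≤ 2⁻¹ * (r s : ℝ≥0∞) ^ k := by
  lift wnorm (fun _ => ρ) p to ℝ≥0 using hp with N hN
  set ε : ℝ≥0 := min 1 (ρ ^ k / (2 * (N + 1))) with hε
  have hε0 : 0 < ε := lt_min one_pos (by positivity)
  have hε1 : ε ≤ 1 := min_le_left _ _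
  have hεN : ε * N ≤ 2⁻¹ * ρ ^ k := by
    have h1 : ε ≤ ρ ^ k / (2 * (N + 1)) := min_le_right _ _
    calc ε * N ≤ ρ ^ k / (2 * (N + 1)) * (N + 1) := by gcongr; exact le_self_add
      _ = 2⁻¹ * ρ ^ k := by field_simp
  let r : σ → ℝ≥0 := fun i => if i = s then ε * ρ else ε ^ (k + 1) * ρ
  have hrle : ∀ i, r i ≤ ρ := by
    intro i
    dsimp only [r]
    split_ifs
    · exact mul_le_of_le_one_left' hε1
    · exact mul_le_of_le_one_left' (pow_le_one' hε1 _)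
  have hw : ∀ α, coeff α p ≠ 0 →
      polyWeight r α ≤ ε ^ (k + 1) * polyWeight (fun _ => ρ) α := by
    intro α hα
    by_cases h : ∃ i, i ≠ s ∧ α i ≠ 0
    · obtain ⟨i, his, hi⟩ := h
      have hsplit : α = (α - Finsupp.single i 1) + Finsupp.single i 1 :=
        (tsub_add_cancel_of_le (by
          rw [Finsupp.single_le_iff]; omega)).symm
      rw [hsplit, polyWeight_add, polyWeight_add, polyWeight_single, polyWeight_single, pow_one,
        pow_one]
      have : r i = ε ^ (k + 1) * ρ := if_neg his
      rw [this]
      calc _ ≤ polyWeight (fun _ => ρ) (α - Finsupp.single i 1) * (ε ^ (k + 1) * ρ) := by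
            gcongr; exact polyWeight_mono hrle _
        _ = _ := by ring
    · push Not at h
      have hα' : α = Finsupp.single s (α s) := by
        ext i
        by_cases hi : i = s
        · subst hi; simp
        · rw [h i hi, Finsupp.single_eq_of_ne hi]
      have hk : k + 1 ≤ α s := by
        by_contra hlt
        exact hα (by rw [hα']; exact hp0 _ (by omega))
      rw [hα', polyWeight_single, polyWeight_single]
      have : r s = ε * ρ := if_pos rfl
      rw [this, mul_pow]
      gcongr ?_ * _
      exact pow_le_pow_right_of_le_one' hε1 hk
  refine ⟨r, fun i => ?_, hrle, ?_⟩
  · dsimp only [r]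
    split_ifs <;> positivity
  have h1 : wnorm r p ≤ (ε ^ (k + 1) : ℝ≥0) * N := by
    rw [hN, wnorm, wnorm, ← ENNReal.tsum_mul_left]
    refine ENNReal.tsum_le_tsum fun α => ?_
    by_cases hα : coeff α p = 0
    · simp [hα]
    · rw [mul_left_comm]
      gcongr
      exact_mod_cast hw α hα
  refine h1.trans ?_
  have : r s = ε * ρ := if_pos rfl
  rw [this]
  have h2 : ε ^ (k + 1) * N ≤ 2⁻¹ * (ε * ρ) ^ k := by
    calc ε ^ (k + 1) * N = ε ^ k * (ε * N) := by ring
      _ ≤ ε ^ k * (2⁻¹ * ρ ^ k) := by gcongr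
      _ = _ := by ring
  have h3 : ((ε ^ (k + 1) * N : ℝ≥0) : ℝ≥0∞) ≤ ((2⁻¹ * (ε * ρ) ^ k : ℝ≥0) : ℝ≥0∞) := by
    exact_mod_cast h2
  push_cast at h3 ⊢
  simpa using h3

/-- Weierstrass division with a monic normalisation. -/
theorem weierstrass_division_aux [Finite σ] (s : σ) (k : ℕ) {f g : MvPowerSeries σ ℂ}
    (hf : IsConvergent f) (hg : IsConvergent g)
    (hlow : ∀ j < k, coeff (Finsupp.single s j) f = 0)
    (htop : coeff (Finsupp.single s k) f = 1) :
    ∃ h : MvPowerSeries σ ℂ, IsConvergent (lowPart s k h) ∧ IsConvergent (shiftDown s k h) ∧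
      g = lowPart s k h + f * shiftDown s k h := by
  classical
  set p : MvPowerSeries σ ℂ := X s ^ k - f with hpdef
  have hp0 : ∀ j ≤ k, coeff (Finsupp.single s j) p = 0 := by
    intro j hj
    rw [hpdef, map_sub, coeff_X_pow]
    rcases hj.lt_or_eq with h | rfl
    · rw [hlow j h, if_neg, sub_zero]
      intro h'
      exact h.ne (Finsupp.single_injective s h')
    · simp [htop]
  have hpc : IsConvergent p := by
    have h1 : IsConvergent (X s ^ k : MvPowerSeries σ ℂ) :=
      isConvergent_of_support (Finsupp.single s k) fun α hα => by rw [coeff_X_pow, if_neg hα]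
    exact (ConvergentPowerSeries σ).sub_mem (x := X s ^ k) (y := f) h1 hf
  obtain ⟨ρ, hρ, hpρ, hgρ⟩ := exists_common_radius hpc hg
  obtain ⟨r, hr0, hrρ, hrp⟩ := exists_small_polyradius s k hρ hpρ hp0
  have hgr : wnorm r g ≠ ⊤ := ne_top_of_le_ne_top hgρ (wnorm_mono hrρ g)
  -- Division by `f = x_s ^ k - p` amounts to solving `h = g + U h`: the low part of `h` is the
  -- remainder and its shifted part is the quotient. For the chosen radii `U` contracts the norm by
  -- `1/2`.
  let U : MvPowerSeries σ ℂ → MvPowerSeries σ ℂ := fun u => p * shiftDown s k u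
  have hU : ∀ u, wnorm r (U u) ≤ 2⁻¹ * wnorm r u := by
    intro u
    calc wnorm r (U u) ≤ wnorm r p * wnorm r (shiftDown s k u) := wnorm_mul_le _ _ _
      _ ≤ 2⁻¹ * (r s : ℝ≥0∞) ^ k * wnorm r (shiftDown s k u) := by gcongr
      _ ≤ 2⁻¹ * wnorm r u := by
        rw [mul_assoc]
        gcongr
        exact wnorm_shiftDown_le r s k u
  have hUn : ∀ n, wnorm r (U^[n] g) ≤ 2⁻¹ ^ n * wnorm r g := by
    intro n
    induction n with
    | zero => simp
    | succ n ih =>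
      rw [Function.iterate_succ_apply', pow_succ']
      refine (hU _).trans ?_
      rw [mul_assoc]
      gcongr
  have hsumN : ∑' n, wnorm r (U^[n] g) ≠ ⊤ := by
    refine ne_top_of_le_ne_top ?_ (ENNReal.tsum_le_tsum hUn)
    rw [ENNReal.tsum_mul_right, ENNReal.tsum_geometric]
    refine ENNReal.mul_ne_top ?_ hgr
    simp
  have hsum : ∀ α, Summable fun n => coeff α (U^[n] g) := by
    intro α
    have hw := polyWeight_pos hr0 α
    have h1 : ∑' n, ‖coeff α (U^[n] g)‖ₑ ≠ ⊤ := by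
      have h2 : (∑' n, ‖coeff α (U^[n] g)‖ₑ) * polyWeight r α ≠ ⊤ := by
        rw [← ENNReal.tsum_mul_right]
        exact ne_top_of_le_ne_top hsumN
          (ENNReal.tsum_le_tsum fun n => enorm_coeff_mul_le_wnorm r _ α)
      intro h3
      rw [h3, ENNReal.top_mul (by exact_mod_cast hw.ne')] at h2
      exact h2 rfl
    have h4 : Summable fun n => ‖coeff α (U^[n] g)‖₊ :=
      ENNReal.tsum_coe_ne_top_iff_summable.1 h1
    exact Summable.of_nnnorm h4
  -- The Neumann series of `g`, summed coefficientwise.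
  let h : MvPowerSeries σ ℂ := fun α => ∑' n, coeff α (U^[n] g)
  have hcoeff : ∀ α, coeff α h = ∑' n, coeff α (U^[n] g) := fun α => rfl
  have hh : wnorm r h ≠ ⊤ := by
    refine ne_top_of_le_ne_top hsumN ?_
    unfold wnorm
    rw [ENNReal.tsum_comm]
    refine ENNReal.tsum_le_tsum fun α => ?_
    rw [ENNReal.tsum_mul_right, hcoeff]
    gcongr
    exact enorm_tsum_coeff_le
  have hUh : h = g + U h := by
    ext α
    rw [map_add, hcoeff, (hsum α).tsum_eq_zero_add]
    congr 1
    dsimp only [U]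
    simp_rw [Function.iterate_succ_apply', coeff_mul, coeff_shiftDown, hcoeff]
    simp_rw [← tsum_mul_left]
    rw [Summable.tsum_finsetSum]
    intro i _
    exact (hsum _).mul_left _
  refine ⟨h, isConvergent_of_wnorm hr0 (ne_top_of_le_ne_top hh (wnorm_lowPart_le r s k h)),
    isConvergent_of_wnorm hr0 ?_, ?_⟩
  · intro htop'
    have := wnorm_shiftDown_le r s k h
    rw [htop', ENNReal.mul_top (by simpa using fun h0 => absurd h0 (hr0 s).ne'), top_le_iff] at this
    exact hh this
  · have h1 := eq_lowPart_add s k h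
    have h2 : g = h - U h := by rw [eq_sub_iff_add_eq, ← hUh]
    calc g = h - U h := h2
      _ = lowPart s k h + X s ^ k * shiftDown s k h - p * shiftDown s k h := by rw [← h1]
      _ = _ := by rw [hpdef]; ring

end Weierstrass

/-! ## The ring of convergent power series -/

section Ring

variable {σ τ : Type*}

/-- The coefficient of a convergent power series. -/
abbrev cf (α : σ →₀ ℕ) (f : ConvergentPowerSeries σ) : ℂ :=
  MvPowerSeries.coeff α (f : MvPowerSeries σ ℂ)

theorem ext_cf {f g : ConvergentPowerSeries σ} (h : ∀ α, cf α f = cf α g) : f = g :=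
  Subtype.ext (MvPowerSeries.ext h)

/-- The value of a convergent power series at the origin. -/
def constCoeff : ConvergentPowerSeries σ →ₐ[ℂ] ℂ where
  __ := (MvPowerSeries.constantCoeff (σ := σ) (R := ℂ)).comp
    (ConvergentPowerSeries σ).subtype
  commutes' c := by
    change MvPowerSeries.constantCoeff (algebraMap ℂ (MvPowerSeries σ ℂ) c) = c
    rw [MvPowerSeries.algebraMap_apply]
    simp

theorem constCoeff_eq_cf (f : ConvergentPowerSeries σ) : constCoeff f = cf 0 f := rfl

@[simp]
theorem constCoeff_coord (s : σ) : constCoeff (coord s) = 0 :=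
  MvPowerSeries.constantCoeff_X s

@[simp]
theorem coe_coord (s : σ) : ((coord s : ConvergentPowerSeries σ) : MvPowerSeries σ ℂ) = X s := rfl

theorem wnorm_small {ρ₀ : ℝ≥0} {f : MvPowerSeries σ ℂ} (h0 : constantCoeff f = 0)
    {ε : ℝ≥0} (hε : ε ≤ 1) :
    wnorm (fun _ => ε * ρ₀) f ≤ ε * wnorm (fun _ => ρ₀) f := by
  rw [wnorm, wnorm, ← ENNReal.tsum_mul_left]
  refine ENNReal.tsum_le_tsum fun α => ?_
  by_cases hα : α = 0
  · subst hα
    simp [h0]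
  · rw [polyWeight_const, polyWeight_const, mul_pow, mul_left_comm]
    gcongr
    have : 1 ≤ α.degree := Nat.one_le_iff_ne_zero.2 fun h => hα ((Finsupp.degree_eq_zero_iff _).1 h)
    rw [← ENNReal.coe_mul]
    gcongr
    calc ε ^ α.degree ≤ ε ^ 1 := pow_le_pow_right_of_le_one' hε this
      _ = ε := pow_one _

theorem exists_radius_wnorm_le [Finite τ] {a : τ → ConvergentPowerSeries σ}
    (ha : ∀ j, constCoeff (a j) = 0) {ρ' : ℝ≥0} (hρ' : 0 < ρ') :
    ∃ ρ : ℝ≥0, 0 < ρ ∧ ∀ j, wnorm (fun _ => ρ) (a j : MvPowerSeries σ ℂ) ≤ ρ' := by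
  have key : ∀ j, ∃ ρ : ℝ≥0, 0 < ρ ∧ wnorm (fun _ => ρ) (a j : MvPowerSeries σ ℂ) ≤ ρ' := by
    intro j
    obtain ⟨ρ₀, hρ₀, h⟩ := isConvergent_iff_wnorm.1 (a j).2
    lift wnorm (fun _ => ρ₀) (a j : MvPowerSeries σ ℂ) to ℝ≥0 using h with N hN
    refine ⟨min 1 (ρ' / (N + 1)) * ρ₀, by positivity, ?_⟩
    refine (wnorm_small (ha j) (min_le_left _ _)).trans ?_
    rw [← hN, ← ENNReal.coe_mul]
    gcongr
    calc min 1 (ρ' / (N + 1)) * N ≤ ρ' / (N + 1) * (N + 1) := by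
          gcongr
          · exact min_le_right _ _
          · exact le_self_add
      _ = ρ' := by field_simp
  choose ρ hρ h using key
  rcases isEmpty_or_nonempty τ with hτ | hτ
  · exact ⟨1, one_pos, fun j => hτ.elim j⟩
  · obtain ⟨j₀, hj₀⟩ := Finite.exists_min ρ
    exact ⟨ρ j₀, hρ j₀, fun j => (wnorm_mono (fun _ => hj₀ j) _).trans (h j)⟩

/-! ### Substitution and renaming of variables. -/

theorem hasSubst [Finite τ] {a : τ → ConvergentPowerSeries σ} (ha : ∀ j, constCoeff (a j) = 0) :
    HasSubst fun j => (a j : MvPowerSeries σ ℂ) :=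
  hasSubst_of_constantCoeff_zero ha

/-- On a polydisc where every `a j` has norm at most `ρ'`, the monomials in the `a j` are dominated
by those at radius `ρ'`, so the norm of the composite is at most that of `f`. Small norms are
available because the `a j` have no constant term. -/
theorem isConvergent_subst [Finite τ] {a : τ → ConvergentPowerSeries σ}
    (ha : ∀ j, constCoeff (a j) = 0) (f : ConvergentPowerSeries τ) :
    IsConvergent (subst (fun j => (a j : MvPowerSeries σ ℂ)) (f : MvPowerSeries τ ℂ)) := by
  obtain ⟨ρ', hρ', hf⟩ := isConvergent_iff_wnorm.1 f.2
  obtain ⟨ρ, hρ, hρa⟩ := exists_radius_wnorm_le ha hρ'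
  refine isConvergent_iff_wnorm.2 ⟨ρ, hρ, ne_top_of_le_ne_top hf ?_⟩
  have h1 : ∀ e, ‖coeff e (subst (fun j => (a j : MvPowerSeries σ ℂ)) (f : MvPowerSeries τ ℂ))‖ₑ ≤
      ∑' d : τ →₀ ℕ, ‖coeff d (f : MvPowerSeries τ ℂ)‖ₑ *
        ‖coeff e (d.prod fun s n => (a s : MvPowerSeries σ ℂ) ^ n)‖ₑ := by
    intro e
    rw [coeff_subst (hasSubst ha),
      ← tsum_eq_finsum (L := .unconditional _) (coeff_subst_finite (hasSubst ha) (f : MvPowerSeries τ ℂ) e)]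
    refine enorm_tsum_le_tsum_enorm.trans (ENNReal.tsum_le_tsum fun d => ?_)
    rw [smul_eq_mul, enorm_mul]
  calc wnorm (fun _ => ρ) (subst (fun j => (a j : MvPowerSeries σ ℂ)) (f : MvPowerSeries τ ℂ))
      ≤ ∑' e, (∑' d : τ →₀ ℕ, ‖coeff d (f : MvPowerSeries τ ℂ)‖ₑ *
        ‖coeff e (d.prod fun s n => (a s : MvPowerSeries σ ℂ) ^ n)‖ₑ) *
          polyWeight (fun _ => ρ) e := by
        refine ENNReal.tsum_le_tsum fun e => ?_
        gcongr
        exact h1 e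
    _ = ∑' d : τ →₀ ℕ, ‖coeff d (f : MvPowerSeries τ ℂ)‖ₑ *
        wnorm (fun _ => ρ) (d.prod fun s n => (a s : MvPowerSeries σ ℂ) ^ n) := by
        simp_rw [← ENNReal.tsum_mul_right]
        rw [ENNReal.tsum_comm]
        refine tsum_congr fun d => ?_
        rw [wnorm, ← ENNReal.tsum_mul_left]
        simp_rw [mul_assoc]
    _ ≤ wnorm (fun _ => ρ') (f : MvPowerSeries τ ℂ) := by
        refine ENNReal.tsum_le_tsum fun d => ?_
        gcongr
        refine (wnorm_prod_le _ _ _).trans ?_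
        rw [polyWeight, Finsupp.prod]
        push_cast
        refine Finset.prod_le_prod' fun s _ => ?_
        refine (wnorm_pow_le _ _ _).trans ?_
        gcongr
        exact hρa s

/-- Substitution of convergent power series without constant term. -/
def substHom [Finite τ] (a : τ → ConvergentPowerSeries σ) (ha : ∀ j, constCoeff (a j) = 0) :
    ConvergentPowerSeries τ →ₐ[ℂ] ConvergentPowerSeries σ :=
  ((substAlgHom (hasSubst ha)).comp (ConvergentPowerSeries τ).val).codRestrict _ fun f => by
    change IsConvergent (substAlgHom (hasSubst ha) (f : MvPowerSeries τ ℂ))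
    rw [coe_substAlgHom]
    exact isConvergent_subst ha f

theorem coe_substHom [Finite τ] (a : τ → ConvergentPowerSeries σ)
    (ha : ∀ j, constCoeff (a j) = 0) (f : ConvergentPowerSeries τ) :
    (substHom a ha f : MvPowerSeries σ ℂ) =
      subst (fun j => (a j : MvPowerSeries σ ℂ)) (f : MvPowerSeries τ ℂ) := by
  change substAlgHom (hasSubst ha) (f : MvPowerSeries τ ℂ) = _
  rw [coe_substAlgHom]

@[simp]
theorem substHom_coord [Finite τ] (a : τ → ConvergentPowerSeries σ)
    (ha : ∀ j, constCoeff (a j) = 0) (j : τ) : substHom a ha (coord j) = a j :=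
  Subtype.ext (by rw [coe_substHom, coe_coord, subst_X (hasSubst ha)])

/-- Renaming the variables along an injective map. -/
def renameHom [Finite τ] (e : τ → σ) : ConvergentPowerSeries τ →ₐ[ℂ] ConvergentPowerSeries σ :=
  substHom (fun j => coord (e j)) fun _ => constCoeff_coord _

@[simp]
theorem renameHom_coord [Finite τ] (e : τ → σ) (j : τ) :
    renameHom e (coord j) = coord (e j) := substHom_coord _ _ _

theorem coe_renameHom [Finite τ] (e : τ ↪ σ) (f : ConvergentPowerSeries τ) :
    (renameHom e f : MvPowerSeries σ ℂ) = rename e (f : MvPowerSeries τ ℂ) := by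
  rw [renameHom, coe_substHom, rename_eq_subst]
  rfl

theorem cf_renameHom_embDomain [Finite τ] (e : τ ↪ σ) (f : ConvergentPowerSeries τ)
    (β : τ →₀ ℕ) : cf (Finsupp.embDomain e β) (renameHom e f) = cf β f := by
  rw [cf, coe_renameHom, coeff_embDomain_rename]

theorem cf_renameHom_eq_zero [Finite τ] (e : τ ↪ σ) (f : ConvergentPowerSeries τ)
    {α : σ →₀ ℕ} {s : σ} (hs : s ∉ Set.range e) (hα : α s ≠ 0) : cf α (renameHom e f) = 0 := by
  rw [cf, coe_renameHom]
  refine coeff_rename_eq_zero _ _ ?_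
  rintro ⟨β, rfl⟩
  rw [Finsupp.mapDomain_of_notMem_range _ _ hs] at hα
  exact hα rfl

/-- Every convergent power series is its constant term plus a combination of the coordinates. -/
theorem eq_const_add_sum [Fintype σ] (f : ConvergentPowerSeries σ) :
    ∃ g : σ → ConvergentPowerSeries σ,
      f = algebraMap ℂ _ (constCoeff f) + ∑ s, coord s * g s := by
  classical
  have hp : ∀ α : σ →₀ ℕ, α ≠ 0 → ∃ s, α s ≠ 0 := fun α h => by
    by_contra! hc
    exact h (Finsupp.ext hc)
  -- Each nonconstant monomial is assigned to one variable dividing it, so that it contributes to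
  -- exactly one `g s`.
  let P : (σ →₀ ℕ) → Option σ := fun α => if h : α = 0 then none else some (hp α h).choose
  have hP : ∀ α s, P α = some s → α s ≠ 0 := by
    intro α s h
    by_cases h0 : α = 0
    · simp [P, h0] at h
    · simp only [P, h0, dif_neg, not_false_eq_true, Option.some.injEq] at h
      rw [← h]
      exact (hp α h0).choose_spec
  let g : σ → MvPowerSeries σ ℂ := fun s α =>
    if P (α + Finsupp.single s 1) = some s then cf (α + Finsupp.single s 1) f else 0
  have hg : ∀ s, IsConvergent (g s) := by
    intro s
    obtain ⟨ρ, hρ, hf⟩ := isConvergent_iff_wnorm.1 f.2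
    refine isConvergent_iff_wnorm.2 ⟨ρ, hρ, ?_⟩
    have h1 : wnorm (fun _ => ρ) (g s) ≤
        wnorm (fun _ => ρ) (shiftDown s 1 (f : MvPowerSeries σ ℂ)) := by
      refine ENNReal.tsum_le_tsum fun α => ?_
      gcongr
      change ‖(if _ then _ else _ : ℂ)‖ₑ ≤ _
      split_ifs
      · exact le_rfl
      · simp
    refine ne_top_of_le_ne_top ?_ h1
    intro h2
    have h3 := wnorm_shiftDown_le (fun _ => ρ) s 1 (f : MvPowerSeries σ ℂ)
    rw [h2, ENNReal.mul_top (by simpa using hρ.ne'), top_le_iff] at h3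
    exact hf h3
  refine ⟨fun s => ⟨g s, hg s⟩, ext_cf fun α => ?_⟩
  have h1 : ∀ s, cf α (coord s * (⟨g s, hg s⟩ : ConvergentPowerSeries σ)) =
      if P α = some s then cf α f else 0 := by
    intro s
    change coeff α (X s * g s) = _
    have h2 := coeff_X_pow_mul_eq s 1 (g s) α
    rw [pow_one] at h2
    rw [h2]
    by_cases h3 : 1 ≤ α s
    · rw [if_pos h3]
      change (if P (α - Finsupp.single s 1 + Finsupp.single s 1) = some s then
        cf (α - Finsupp.single s 1 + Finsupp.single s 1) f else 0) = _
      rw [tsub_add_cancel_of_le (by simpa using h3)]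
    · rw [if_neg h3, if_neg]
      intro h4
      exact h3 (Nat.one_le_iff_ne_zero.2 (hP α s h4))
  have h2 : cf α (algebraMap ℂ _ (constCoeff f) + ∑ s, coord s *
      (⟨g s, hg s⟩ : ConvergentPowerSeries σ)) =
      coeff α (algebraMap ℂ (MvPowerSeries σ ℂ) (constCoeff f)) +
        ∑ s, cf α (coord s * (⟨g s, hg s⟩ : ConvergentPowerSeries σ)) := by
    simp only [cf]
    push_cast
    rw [map_add, map_sum]
  rw [h2]
  simp_rw [h1]
  rw [MvPowerSeries.algebraMap_apply, coeff_C]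
  by_cases h0 : α = 0
  · subst h0
    simp [P, constCoeff_eq_cf]
  · simp [P, h0]

/-- Weierstrass division of `1` by `f` in degree `k = 0` leaves no remainder, so its quotient is an
inverse. Division needs a variable, so the constant case is separate. -/
theorem isUnit_iff [Finite σ] (f : ConvergentPowerSeries σ) : IsUnit f ↔ constCoeff f ≠ 0 := by
  classical
  refine ⟨fun h => (h.map constCoeff).ne_zero, fun h => ?_⟩
  rcases isEmpty_or_nonempty σ with hσ | ⟨⟨s⟩⟩
  · have := Fintype.ofFinite σ
    obtain ⟨g, hg⟩ := eq_const_add_sum f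
    rw [Finset.univ_eq_empty, Finset.sum_empty, add_zero] at hg
    rw [hg]
    exact (IsUnit.mk0 _ h).map _
  · obtain ⟨u, -, hu, h1⟩ := weierstrass_division_aux s 0
      (f := (((constCoeff f)⁻¹ • f : ConvergentPowerSeries σ) : MvPowerSeries σ ℂ)) (g := 1)
      ((constCoeff f)⁻¹ • f).2 (1 : ConvergentPowerSeries σ).2 (by simp) (by
        change (constCoeff f)⁻¹ • coeff (Finsupp.single s 0) (f : MvPowerSeries σ ℂ) = 1
        rw [Finsupp.single_zero, smul_eq_mul]
        exact inv_mul_cancel₀ h)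
    have h2 : lowPart s 0 u = 0 := by ext α; simp
    rw [h2, zero_add] at h1
    have h3 : ((constCoeff f)⁻¹ • f) * (⟨_, hu⟩ : ConvergentPowerSeries σ) = 1 :=
      Subtype.ext h1.symm
    rw [smul_mul_assoc, ← mul_smul_comm] at h3
    exact IsUnit.of_mul_eq_one _ h3

instance : Nontrivial (ConvergentPowerSeries σ) :=
  ⟨0, 1, fun h => by simpa using congrArg constCoeff h⟩

instance : IsDomain (ConvergentPowerSeries σ) :=
  have : IsDomain (MvPowerSeries σ ℂ) := NoZeroDivisors.to_isDomain _
  Function.Injective.isDomain (ConvergentPowerSeries σ).val.toRingHom Subtype.val_injective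

instance [Finite σ] : IsLocalRing (ConvergentPowerSeries σ) :=
  IsLocalRing.of_nonunits_add fun a b ha hb => by
    rw [mem_nonunits_iff, isUnit_iff, not_not] at *
    rw [map_add, ha, hb, add_zero]

/-- Homomorphisms of convergent power series rings are automatically local. -/
theorem constCoeff_map [Finite τ] [Finite σ]
    (φ : ConvergentPowerSeries τ →ₐ[ℂ] ConvergentPowerSeries σ) (f : ConvergentPowerSeries τ) :
    constCoeff (φ f) = constCoeff f := by
  by_contra h
  -- If the constant terms differed, this difference would be a unit sent to a series with zero
  -- constant term.
  have h1 : IsUnit (f - algebraMap ℂ _ (constCoeff (φ f))) := by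
    rw [isUnit_iff, map_sub, AlgHom.commutes]
    intro h2
    exact h (sub_eq_zero.1 h2).symm
  have h2 := h1.map φ
  rw [isUnit_iff, map_sub, AlgHom.commutes, map_sub, AlgHom.commutes] at h2
  exact h2 (sub_self _)

/-- No continuity is assumed. Writing `f = c + ∑ x_s g_s` expresses `φ f - ψ f` through the
differences at the `g_s`, multiplied by series without constant term. Inductively its order exceeds
every integer. -/
theorem hom_ext [Finite τ] [Finite σ]
    {φ ψ : ConvergentPowerSeries τ →ₐ[ℂ] ConvergentPowerSeries σ}
    (h : ∀ j, φ (coord j) = ψ (coord j)) : φ = ψ := by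
  have := Fintype.ofFinite τ
  have key : ∀ (n : ℕ) (f : ConvergentPowerSeries τ),
      (n : ℕ∞) ≤ ((φ f - ψ f : ConvergentPowerSeries σ) : MvPowerSeries σ ℂ).order := by
    intro n
    induction n with
    | zero => intro f; simp
    | succ n ih =>
      intro f
      obtain ⟨g, hg⟩ := eq_const_add_sum f
      have h1 : φ f - ψ f = ∑ s, φ (coord s) * (φ (g s) - ψ (g s)) := by
        conv_lhs => rw [hg]
        simp only [map_add, map_sum, map_mul, AlgHom.commutes, h, mul_sub, Finset.sum_sub_distrib]
        ring
      rw [h1]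
      refine MvPowerSeries.le_order fun d hd => ?_
      push_cast
      rw [map_sum]
      refine Finset.sum_eq_zero fun s _ => ?_
      refine coeff_of_lt_order (lt_of_lt_of_le hd (le_trans ?_ le_order_mul))
      rw [add_comm]
      push_cast
      gcongr
      · rw [one_le_order_iff_constCoeff_eq_zero]
        have := constCoeff_map φ (coord s)
        rwa [constCoeff_coord] at this
      · exact_mod_cast ih (g s)
  refine AlgHom.ext fun f => ?_
  rw [← sub_eq_zero]
  refine ext_cf fun α => coeff_of_lt_order (lt_of_lt_of_le ?_ (key (α.degree + 1) f))
  exact_mod_cast Nat.lt_succ_self _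

/-- Weierstrass division for convergent power series. -/
theorem weierstrass_division [Finite σ] [Finite τ] (e : τ ↪ σ) (s : σ)
    (he : ∀ i, i ∈ Set.range e ↔ i ≠ s) (k : ℕ) (f g : ConvergentPowerSeries σ)
    (hlow : ∀ j < k, cf (Finsupp.single s j) f = 0) (htop : cf (Finsupp.single s k) f ≠ 0) :
    ∃ (c : ℕ → ConvergentPowerSeries τ) (q : ConvergentPowerSeries σ),
      g = ∑ i ∈ range k, coord s ^ i * renameHom e (c i) + f * q := by
  classical
  set a := cf (Finsupp.single s k) f with ha
  obtain ⟨u, hu1, hu2, hu⟩ := weierstrass_division_aux s k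
      (f := ((a⁻¹ • f : ConvergentPowerSeries σ) : MvPowerSeries σ ℂ)) (g := g)
      (a⁻¹ • f).2 g.2 (fun j hj => by
        change a⁻¹ • coeff (Finsupp.single s j) (f : MvPowerSeries σ ℂ) = 0
        rw [show coeff (Finsupp.single s j) (f : MvPowerSeries σ ℂ) = 0 from hlow j hj, smul_zero]) (by
        change a⁻¹ • coeff (Finsupp.single s k) (f : MvPowerSeries σ ℂ) = 1
        exact inv_mul_cancel₀ htop)
  -- The remainder has degree below `k` in `x_s`; `c i` collects the coefficient of `x_s ^ i` as a
  -- series in the other variables.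
  let c : ℕ → MvPowerSeries τ ℂ := fun i β =>
    coeff (Finsupp.embDomain e β + Finsupp.single s i) (lowPart s k u)
  have hc : ∀ i, IsConvergent (c i) := by
    intro i
    obtain ⟨ρ, hρ, hf⟩ := isConvergent_iff_wnorm.1 hu1
    refine isConvergent_iff_wnorm.2 ⟨ρ, hρ, ?_⟩
    have h1 : ((ρ : ℝ≥0∞) ^ i) * wnorm (fun _ => ρ) (c i) ≤ wnorm (fun _ => ρ) (lowPart s k u) := by
      rw [wnorm, ← ENNReal.tsum_mul_left]
      have hinj : Function.Injective
          fun β : τ →₀ ℕ => Finsupp.embDomain e β + Finsupp.single s i :=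
        (add_left_injective _).comp (Finsupp.embDomain_injective e)
      refine le_trans (le_of_eq ?_) (ENNReal.tsum_comp_le_tsum_of_injective hinj
        (fun α => ‖coeff α (lowPart s k u)‖ₑ * (polyWeight (fun _ => ρ) α : ℝ≥0∞)))
      refine tsum_congr fun β => ?_
      have h2 : polyWeight (fun _ : σ => ρ) (Finsupp.embDomain e β) =
          polyWeight (fun _ : τ => ρ) β := by
        rw [polyWeight, Finsupp.prod_embDomain, polyWeight]
      rw [polyWeight_add, polyWeight_single, h2]
      change _ * (‖coeff (Finsupp.embDomain e β + Finsupp.single s i) (lowPart s k u)‖ₑ * _) = _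
      push_cast
      ring
    intro h2
    rw [h2, ENNReal.mul_top (by simpa using fun h => absurd h hρ.ne'), top_le_iff] at h1
    exact hf h1
  refine ⟨fun i => ⟨c i, hc i⟩, a⁻¹ • ⟨shiftDown s k u, hu2⟩, ?_⟩
  have hs : s ∉ Set.range e := by rw [he]; simp
  have hlowc : (⟨lowPart s k u, hu1⟩ : ConvergentPowerSeries σ) =
      ∑ i ∈ range k, coord s ^ i * renameHom e ⟨c i, hc i⟩ := by
    refine ext_cf fun α => ?_
    have h1 : ∀ i, cf α (coord s ^ i * renameHom e (⟨c i, hc i⟩ : ConvergentPowerSeries τ)) =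
        if i = α s then coeff α (lowPart s k u) else 0 := by
      intro i
      change coeff α (X s ^ i * (renameHom e ⟨c i, hc i⟩ : ConvergentPowerSeries σ).1) = _
      rw [coeff_X_pow_mul_eq]
      by_cases hi : i = α s
      · rw [if_pos hi.le, if_pos hi]
        obtain ⟨β, hβ⟩ : ∃ β, Finsupp.embDomain e β = α - Finsupp.single s i := by
          refine ⟨_, Finsupp.embDomain_comapDomain fun j hj => ?_⟩
          rw [he]
          rintro rfl
          simp [hi] at hj
        rw [← hβ]
        refine (cf_renameHom_embDomain e ⟨c i, hc i⟩ β).trans ?_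
        change coeff (Finsupp.embDomain e β + Finsupp.single s i) (lowPart s k u) = _
        rw [hβ, tsub_add_cancel_of_le (by simpa using hi.le)]
      · rw [if_neg hi]
        split_ifs with h2
        · refine cf_renameHom_eq_zero e _ hs ?_
          simp only [Finsupp.tsub_apply, Finsupp.single_eq_same]
          omega
        · rfl
    have h2 : cf α (∑ i ∈ range k, coord s ^ i * renameHom e
        (⟨c i, hc i⟩ : ConvergentPowerSeries τ)) = ∑ i ∈ range k,
        cf α (coord s ^ i * renameHom e (⟨c i, hc i⟩ : ConvergentPowerSeries τ)) := by
      simp only [cf]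
      rw [AddSubmonoidClass.coe_finsetSum, map_sum]
    rw [h2]
    simp_rw [h1]
    rw [Finset.sum_ite_eq' (range k)]
    change coeff α (lowPart s k u) = _
    split_ifs with h3
    · rfl
    · rw [coeff_lowPart, if_neg (by simpa using h3)]
  rw [← hlowc]
  refine Subtype.ext (hu.trans ?_)
  change _ = lowPart s k u + f.1 * (a⁻¹ • shiftDown s k u)
  rw [mul_smul_comm, ← smul_mul_assoc]
  rfl

end Ring

/-! ## Convergent power series in one variable -/

/-- The ring `ℂ{t}`. -/
abbrev Ct : Type := ConvergentPowerSeries Unit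

/-- The coordinate of `ℂ{t}`. -/
def ct : Ct := coord ()

@[simp]
theorem constCoeff_ct : constCoeff ct = 0 := constCoeff_coord _

theorem Ct.ext_cf {f g : Ct} (h : ∀ n, cf (Finsupp.single () n) f = cf (Finsupp.single () n) g) :
    f = g :=
  CurveGerm.ext_cf fun α => by
    rw [show α = Finsupp.single () (α ()) from Finsupp.unique_ext (by simp)]
    exact h _

theorem cf_ct_pow_mul (k n : ℕ) (g : Ct) :
    cf (Finsupp.single () n) (ct ^ k * g) =
      if k ≤ n then cf (Finsupp.single () (n - k)) g else 0 := by
  change coeff (Finsupp.single () n) (X () ^ k * g.1) = _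
  rw [coeff_X_pow_mul_eq, Finsupp.single_eq_same, ← Finsupp.single_tsub]

theorem ct_dvd_iff {f : Ct} : ct ∣ f ↔ constCoeff f = 0 := by
  constructor
  · rintro ⟨g, rfl⟩
    simp
  · intro h
    obtain ⟨g, hg⟩ := eq_const_add_sum f
    rw [h, map_zero, zero_add, Fintype.sum_unique] at hg
    exact ⟨_, hg⟩

theorem ct_ne_zero : ct ≠ 0 := by
  intro h
  have h1 := cf_ct_pow_mul 1 1 1
  rw [pow_one, mul_one, h, if_pos le_rfl, Nat.sub_self, Finsupp.single_zero] at h1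
  have h2 : cf (0 : Unit →₀ ℕ) (1 : Ct) = 1 := (constCoeff_eq_cf _).symm.trans (map_one constCoeff)
  rw [h2] at h1
  exact zero_ne_one h1

theorem prime_ct : Prime ct := by
  refine ⟨ct_ne_zero, by simp [isUnit_iff], fun a b h => ?_⟩
  rw [ct_dvd_iff, map_mul, mul_eq_zero] at h
  rwa [ct_dvd_iff, ct_dvd_iff]

theorem ct_pow_dvd_iff {f : Ct} {n : ℕ} :
    ct ^ n ∣ f ↔ ∀ j < n, cf (Finsupp.single () j) f = 0 := by
  constructor
  · rintro ⟨g, rfl⟩ j hj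
    rw [cf_ct_pow_mul, if_neg (by omega)]
  · intro h
    induction n with
    | zero => simp
    | succ n ih =>
      obtain ⟨g, rfl⟩ := ih fun j hj => h j (by omega)
      have h1 := h n (by omega)
      rw [cf_ct_pow_mul, if_pos le_rfl, Nat.sub_self, Finsupp.single_zero] at h1
      obtain ⟨g', rfl⟩ := ct_dvd_iff.2 (show constCoeff g = 0 from h1)
      exact ⟨g', by ring⟩

theorem exists_eq_ct_pow_mul {f : Ct} (hf : f ≠ 0) :
    ∃ (n : ℕ) (u : Ct), constCoeff u ≠ 0 ∧ f = ct ^ n * u := by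
  have h1 : ∃ n, ¬ ct ^ (n + 1) ∣ f := by
    by_contra! h
    refine hf (Ct.ext_cf fun n => ?_)
    rw [ct_pow_dvd_iff.1 (h n) n (by omega)]
    rfl
  classical
  have h2 := Nat.find_spec h1
  have h3 : ct ^ Nat.find h1 ∣ f := by
    rcases Nat.eq_zero_or_pos (Nat.find h1) with h | h
    · rw [h]; simp
    · have := Nat.find_min h1 (Nat.sub_lt h one_pos)
      rwa [not_not, show Nat.find h1 - 1 + 1 = Nat.find h1 by omega] at this
  obtain ⟨u, hu⟩ := h3
  refine ⟨_, u, fun h0 => h2 ?_, hu⟩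
  obtain ⟨v, rfl⟩ := ct_dvd_iff.2 h0
  exact ⟨v, hu.trans (by ring)⟩

theorem isUnit_of_constCoeff {u : Ct} (hu : constCoeff u ≠ 0) : IsUnit u := (isUnit_iff u).2 hu

instance : IsDiscreteValuationRing Ct :=
  IsDiscreteValuationRing.ofHasUnitMulPowIrreducibleFactorization
    ⟨ct, prime_ct.irreducible, fun {x} hx => by
      obtain ⟨n, u, hu, rfl⟩ := exists_eq_ct_pow_mul hx
      obtain ⟨v, rfl⟩ := isUnit_of_constCoeff hu
      exact ⟨n, v, rfl⟩⟩

theorem cf_ct_pow_mul_self (n : ℕ) (u : Ct) :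
    cf (Finsupp.single () n) (ct ^ n * u) = constCoeff u := by
  rw [cf_ct_pow_mul, if_pos le_rfl, Nat.sub_self, Finsupp.single_zero]
  rfl

theorem not_ct_pow_succ_dvd {n : ℕ} {u : Ct} (hu : constCoeff u ≠ 0) :
    ¬ ct ^ (n + 1) ∣ ct ^ n * u := by
  rw [ct_pow_dvd_iff]
  intro h
  exact hu ((cf_ct_pow_mul_self n u).symm.trans (h n (by omega)))

theorem ct_pow_mul_unit_inj {n m : ℕ} {u v : Ct} (hu : constCoeff u ≠ 0) (hv : constCoeff v ≠ 0)
    (h : ct ^ n * u = ct ^ m * v) : n = m := by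
  by_contra hne
  rcases lt_or_gt_of_ne hne with h1 | h1
  · refine not_ct_pow_succ_dvd (n := n) hu ?_
    rw [h]
    exact (pow_dvd_pow _ h1).mul_right _
  · refine not_ct_pow_succ_dvd (n := m) hv ?_
    rw [← h]
    exact (pow_dvd_pow _ h1).mul_right _

/-- Composition of convergent power series in one variable. -/
def evalAt (ξ : Ct) (hξ : constCoeff ξ = 0) : Ct →ₐ[ℂ] Ct := substHom (fun _ => ξ) fun _ => hξ

@[simp]
theorem evalAt_ct (ξ : Ct) (hξ : constCoeff ξ = 0) : evalAt ξ hξ ct = ξ := substHom_coord _ _ _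

theorem Ct.hom_ext {σ : Type*} [Finite σ] {φ ψ : Ct →ₐ[ℂ] ConvergentPowerSeries σ}
    (h : φ ct = ψ ct) : φ = ψ := CurveGerm.hom_ext fun _ => h

/-- Every nonzero series in one variable is a power of the coordinate times a unit. -/
theorem Ct.map_injective {σ : Type*} [Finite σ] (φ : Ct →ₐ[ℂ] ConvergentPowerSeries σ)
    (h : φ ct ≠ 0) : Function.Injective φ := by
  rw [injective_iff_map_eq_zero]
  intro f hf
  by_contra h0
  obtain ⟨n, u, hu, rfl⟩ := exists_eq_ct_pow_mul h0
  rw [map_mul, map_pow] at hf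
  exact mul_ne_zero (pow_ne_zero _ h) ((isUnit_of_constCoeff hu).map φ).ne_zero hf

/-- The inclusion of a coordinate axis of the plane. -/
def axis (s : Fin 2) : Unit ↪ Fin 2 := ⟨fun _ => s, fun _ _ _ => rfl⟩

@[simp]
theorem axis_apply (s : Fin 2) (i : Unit) : axis s i = s := rfl

theorem mem_range_axis (s i : Fin 2) : i ∈ Set.range (axis s) ↔ i = s :=
  ⟨fun ⟨_, h⟩ => h.symm, fun h => ⟨(), h.symm⟩⟩

theorem cf_single_renameHom_axis (s : Fin 2) (j : ℕ) (f : Ct) :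
    cf (Finsupp.single s j) (renameHom (axis s) f) = cf (Finsupp.single () j) f := by
  rw [← cf_renameHom_embDomain (axis s), Finsupp.embDomain_single]
  rfl

@[simp]
theorem renameHom_axis_ct (s : Fin 2) : renameHom (axis s) ct = coord s := renameHom_coord _ _

/-- Substitution of two series in one variable into a series in two variables. -/
def evalAt₂ (ξ η : Ct) (hξ : constCoeff ξ = 0) (hη : constCoeff η = 0) :
    ConvergentPowerSeries (Fin 2) →ₐ[ℂ] Ct :=
  substHom ![ξ, η] fun j => by fin_cases j; exacts [hξ, hη]

@[simp]
theorem evalAt₂_zero (ξ η : Ct) (hξ : constCoeff ξ = 0) (hη : constCoeff η = 0) :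
    evalAt₂ ξ η hξ hη (coord 0) = ξ := substHom_coord _ _ _

@[simp]
theorem evalAt₂_one (ξ η : Ct) (hξ : constCoeff ξ = 0) (hη : constCoeff η = 0) :
    evalAt₂ ξ η hξ hη (coord 1) = η := substHom_coord _ _ _

@[simp]
theorem evalAt₂_axis_zero (ξ η : Ct) (hξ : constCoeff ξ = 0) (hη : constCoeff η = 0) (f : Ct) :
    evalAt₂ ξ η hξ hη (renameHom (axis 0) f) = evalAt ξ hξ f :=
  DFunLike.congr_fun (Ct.hom_ext (φ := (evalAt₂ ξ η hξ hη).comp (renameHom (axis 0)))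
    (by simp)) f

@[simp]
theorem evalAt₂_axis_one (ξ η : Ct) (hξ : constCoeff ξ = 0) (hη : constCoeff η = 0) (f : Ct) :
    evalAt₂ ξ η hξ hη (renameHom (axis 1) f) = evalAt η hη f :=
  DFunLike.congr_fun (Ct.hom_ext (φ := (evalAt₂ ξ η hξ hη).comp (renameHom (axis 1)))
    (by simp)) f

@[simp]
theorem evalAt_ct_self (h : constCoeff ct = 0) (f : Ct) : evalAt ct h f = f :=
  DFunLike.congr_fun (Ct.hom_ext (φ := evalAt ct h) (ψ := AlgHom.id ℂ Ct) (by simp)) f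

/-- Convergent power series are finite over `ℂ{ξ}` if `ξ` has order `e`, with basis the powers of
the coordinate of exponent less than `e`. -/
theorem exists_eq_sum_evalAt {e : ℕ} {ξ u : Ct} (hu : constCoeff u ≠ 0) (hξu : ξ = ct ^ e * u)
    (hξ : constCoeff ξ = 0) (g : Ct) :
    ∃ c : ℕ → Ct, g = ∑ j ∈ range e, ct ^ j * evalAt ξ hξ (c j) := by
  have hcf : ∀ j, cf (Finsupp.single (0 : Fin 2) j) (renameHom (axis 0) ξ - coord 1) =
      cf (Finsupp.single () j) ξ := by
    intro j
    have h2 : coeff (Finsupp.single (0 : Fin 2) j) (X 1 : MvPowerSeries (Fin 2) ℂ) = 0 := by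
      rw [coeff_X, if_neg]
      intro h
      have := DFunLike.congr_fun h 1
      simp at this
    change coeff _ ((renameHom (axis 0) ξ).1 - X 1) = _
    rw [map_sub, h2, sub_zero]
    exact cf_single_renameHom_axis 0 j ξ
  -- The series `g(x_0)` is divided by `ξ(x_0) - x_1`, which is regular of order `e` in `x_0`.
  -- Putting `x_1 = ξ(x_0)` afterwards kills the divisor and turns the coefficients into series in
  -- `ξ`.
  obtain ⟨c, q, h⟩ := weierstrass_division (axis 1) 0
    (fun i => by rw [mem_range_axis]; fin_cases i <;> simp) e (renameHom (axis 0) ξ - coord 1) (renameHom (axis 0) g)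
    (fun j hj => by rw [hcf, hξu, cf_ct_pow_mul, if_neg (by omega)])
    (by rw [hcf, hξu, cf_ct_pow_mul_self]; exact hu)
  refine ⟨c, ?_⟩
  have h2 := congrArg (evalAt₂ ct ξ constCoeff_ct hξ) h
  simp only [map_add, map_mul, map_sum, map_pow, map_sub, evalAt₂_axis_zero, evalAt₂_axis_one,
    evalAt₂_zero, evalAt₂_one, evalAt_ct_self, sub_self, zero_mul, add_zero] at h2
  exact h2

theorem evalAt_surjective {ξ u : Ct} (hu : constCoeff u ≠ 0) (hξu : ξ = ct * u)
    (hξ : constCoeff ξ = 0) : Function.Surjective (evalAt ξ hξ) := fun g => by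
  obtain ⟨c, hc⟩ := exists_eq_sum_evalAt (e := 1) hu (by rw [hξu, pow_one]) hξ g
  exact ⟨c 0, by simpa using hc.symm⟩

/-! ## Analytic algebras -/

/-- Convergent power series can be evaluated at non-units of an analytic algebra. -/
theorem exists_evalHom {A : Type*} [CommRing A] [Algebra ℂ A] {N : ℕ}
    (π : ConvergentPowerSeries (Fin N) →ₐ[ℂ] A) (hπ : Function.Surjective π) {τ : Type*} [Finite τ]
    (a : τ → A) (ha : ∀ j, ¬ IsUnit (a j)) :
    ∃ E : ConvergentPowerSeries τ →ₐ[ℂ] A, ∀ j, E (coord j) = a j := by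
  choose b hb using fun j => hπ (a j)
  have hb0 : ∀ j, constCoeff (b j) = 0 := by
    intro j
    by_contra h
    exact ha j (hb j ▸ ((isUnit_iff _).2 h).map π)
  exact ⟨π.comp (substHom b hb0), fun j => by simp [hb]⟩

/-! ## Puiseux series -/

theorem constCoeff_ct_pow {e : ℕ} (he : e ≠ 0) : constCoeff (ct ^ e) = 0 := by
  rw [map_pow, constCoeff_ct, zero_pow he]

/-- The substitution `t ↦ t ^ e`. -/
def ram (e : ℕ) (he : e ≠ 0) : Ct →ₐ[ℂ] Ct := evalAt (ct ^ e) (constCoeff_ct_pow he)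

@[simp]
theorem ram_ct (e : ℕ) (he : e ≠ 0) : ram e he ct = ct ^ e := evalAt_ct _ _

theorem ram_injective (e : ℕ) (he : e ≠ 0) : Function.Injective (ram e he) :=
  Ct.map_injective _ (by rw [ram_ct]; exact pow_ne_zero _ ct_ne_zero)

theorem ram_ram (e e' : ℕ) (he : e ≠ 0) (he' : e' ≠ 0) (f : Ct) :
    ram e he (ram e' he' f) = ram (e * e') (mul_ne_zero he he') f :=
  DFunLike.congr_fun (Ct.hom_ext (φ := (ram e he).comp (ram e' he'))
    (by simp [pow_mul])) f

theorem cf_coord_pow_mul_axis (j i : ℕ) (c : Ct) :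
    cf (Finsupp.single (0 : Fin 2) j) (coord 0 ^ i * renameHom (axis 1) c) =
      if j = i then constCoeff c else 0 := by
  change coeff _ (X 0 ^ i * (renameHom (axis 1) c).1) = _
  rw [coeff_X_pow_mul_eq, Finsupp.single_eq_same, ← Finsupp.single_tsub]
  have h0 : cf (0 : Fin 2 →₀ ℕ) (renameHom (axis 1) c) = constCoeff c :=
    (constCoeff_eq_cf _).symm.trans (constCoeff_map _ _)
  by_cases h1 : i ≤ j
  · rw [if_pos h1]
    by_cases h2 : j = i
    · rw [if_pos h2, h2, Nat.sub_self, Finsupp.single_zero]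
      exact h0
    · rw [if_neg h2]
      refine cf_renameHom_eq_zero (axis 1) c (s := 0) (by simp) ?_
      rw [Finsupp.single_eq_same]
      omega
  · rw [if_neg h1, if_neg (by omega)]

theorem cf_sum {σ ι : Type*} (α : σ →₀ ℕ) (s : Finset ι) (f : ι → ConvergentPowerSeries σ) :
    cf α (∑ i ∈ s, f i) = ∑ i ∈ s, cf α (f i) := by
  exact map_sum ((MvPowerSeries.coeff α).comp (ConvergentPowerSeries σ).val.toLinearMap) f s

theorem exists_monic_of_coeff {R : Type*} [CommRing R] [Nontrivial R] (n : ℕ) (b : ℕ → R) :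
    ∃ P : Polynomial R, P.Monic ∧ P.natDegree = n ∧ ∀ j < n, P.coeff j = b j := by
  let L : Polynomial R := ∑ i ∈ range n, Polynomial.C (b i) * Polynomial.X ^ i
  have hLdeg : L.degree < n := by
    rw [← Polynomial.mem_degreeLT]
    refine Submodule.sum_mem _ fun i hi => ?_
    rw [Polynomial.mem_degreeLT]
    exact (Polynomial.degree_C_mul_X_pow_le _ _).trans_lt
      (by exact_mod_cast mem_range.1 hi)
  refine ⟨Polynomial.X ^ n + L, Polynomial.monic_X_pow_add hLdeg, ?_, fun j hj => ?_⟩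
  · refine Polynomial.natDegree_eq_of_degree_eq_some ?_
    rw [Polynomial.degree_add_eq_left_of_degree_lt] <;> rw [Polynomial.degree_X_pow]
    exact hLdeg
  · simp only [L, Polynomial.coeff_add, Polynomial.finsetSum_coeff,
      Polynomial.coeff_C_mul_X_pow, Polynomial.coeff_X_pow]
    rw [Finset.sum_ite_eq, if_pos (mem_range.2 hj), if_neg hj.ne, zero_add]

theorem cf_eval₂_axis (G : Polynomial Ct) (j : ℕ) :
    cf (Finsupp.single (0 : Fin 2) j)
      (G.eval₂ (renameHom (axis 1) : Ct →+* ConvergentPowerSeries (Fin 2)) (coord 0)) =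
      constCoeff (G.coeff j) := by
  rw [Polynomial.eval₂_eq_sum_range, cf_sum]
  have h : ∀ i, cf (Finsupp.single (0 : Fin 2) j)
      ((renameHom (axis 1) : Ct →+* ConvergentPowerSeries (Fin 2)) (G.coeff i) * coord 0 ^ i) =
      if j = i then constCoeff (G.coeff i) else 0 := by
    intro i
    rw [mul_comm]
    exact cf_coord_pow_mul_axis j i _
  simp_rw [h]
  rw [Finset.sum_ite_eq]
  split_ifs with h1
  · rfl
  · rw [Polynomial.coeff_eq_zero_of_natDegree_lt (by
      rw [mem_range, not_lt] at h1; omega),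
      map_zero]

theorem evalAt₂_eval₂_axis (P : Polynomial Ct) (y ξ : Ct) (hy : constCoeff y = 0)
    (hξ : constCoeff ξ = 0) :
    evalAt₂ y ξ hy hξ
      (P.eval₂ (renameHom (axis 1) : Ct →+* ConvergentPowerSeries (Fin 2)) (coord 0)) =
      P.eval₂ (evalAt ξ hξ : Ct →+* Ct) y := by
  have h := Polynomial.hom_eval₂ P (renameHom (axis 1) : Ct →+* ConvergentPowerSeries (Fin 2))
    (evalAt₂ y ξ hy hξ : ConvergentPowerSeries (Fin 2) →+* Ct) (coord 0)
  refine h.trans ?_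
  congr 1
  · exact RingHom.ext fun f => evalAt₂_axis_one y ξ hy hξ f
  · exact evalAt₂_zero y ξ hy hξ

/-- Weierstrass preparation for polynomials: small roots of `G` are controlled by a Weierstrass
polynomial whose degree is the multiplicity of the root `0` of `G` at the origin. -/
theorem exists_weierstrass_polynomial (G : Polynomial Ct) (k : ℕ)
    (hlow : ∀ j < k, constCoeff (G.coeff j) = 0) (htop : constCoeff (G.coeff k) ≠ 0) :
    ∃ W : Polynomial Ct, W.Monic ∧ W.natDegree = k ∧ (∀ j < k, constCoeff (W.coeff j) = 0) ∧
      ∀ (ξ y : Ct) (hξ : constCoeff ξ = 0), constCoeff y = 0 →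
        W.eval₂ (evalAt ξ hξ : Ct →+* Ct) y = 0 → G.eval₂ (evalAt ξ hξ : Ct →+* Ct) y = 0 := by
  set ev : Polynomial Ct → ConvergentPowerSeries (Fin 2) := fun P =>
    P.eval₂ (renameHom (axis 1) : Ct →+* ConvergentPowerSeries (Fin 2)) (coord 0) with hev
  -- Dividing `x_0 ^ k` by `G` and moving the remainder to the left gives the Weierstrass polynomial
  -- `W = G q`.
  obtain ⟨c, q, h⟩ := weierstrass_division (axis 1) 0
    (fun i => by rw [mem_range_axis]; fin_cases i <;> simp) k (ev G) (coord 0 ^ k)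
    (fun j hj => by rw [hev, cf_eval₂_axis]; exact hlow j hj)
    (by rw [hev, cf_eval₂_axis]; exact htop)
  have h00 : constCoeff (0 : Ct) = 0 := map_zero _
  have hconst : ∀ f : Ct, evalAt 0 h00 f = algebraMap ℂ Ct (constCoeff f) := by
    intro f
    obtain ⟨g, hg⟩ := eq_const_add_sum f
    rw [Fintype.sum_unique] at hg
    conv_lhs => rw [hg]
    rw [map_add, AlgHom.commutes, map_mul]
    change _ + evalAt 0 h00 ct * _ = _
    rw [evalAt_ct, zero_mul, add_zero]
  -- Restriction to `x_1 = 0`: there `G` is divisible by `t ^ k`, hence so is the remainder. Its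
  -- degree is below `k`, so its coefficients vanish at the origin.
  have hG0 : ct ^ k ∣ evalAt₂ ct 0 constCoeff_ct h00 (ev G) := by
    rw [hev, evalAt₂_eval₂_axis, Polynomial.eval₂_eq_sum_range]
    refine Finset.dvd_sum fun j _ => ?_
    by_cases hj : j < k
    · have : (evalAt 0 h00 : Ct →+* Ct) (G.coeff j) = 0 := by
        change evalAt 0 h00 (G.coeff j) = 0
        rw [hconst, hlow j hj, map_zero]
      rw [this, zero_mul]
      exact dvd_zero _
    · exact (pow_dvd_pow _ (not_lt.1 hj)).mul_left _
  obtain ⟨v, hv⟩ := hG0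
  have h1 := congrArg (evalAt₂ ct 0 constCoeff_ct h00) h
  simp only [map_add, map_mul, map_sum, map_pow, evalAt₂_axis_one, evalAt₂_zero, hconst, hv] at h1
  have h2 : ct ^ k ∣ ∑ i ∈ range k, ct ^ i * algebraMap ℂ Ct (constCoeff (c i)) :=
    ⟨1 - v * evalAt₂ ct 0 constCoeff_ct h00 q, by linear_combination -h1⟩
  have hcf : ∀ (i j : ℕ) (a : ℂ), cf (Finsupp.single () j) (ct ^ i * algebraMap ℂ Ct a) =
      if j = i then a else 0 := by
    intro i j a
    rw [cf_ct_pow_mul]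
    change (if i ≤ j then coeff _ (algebraMap ℂ (MvPowerSeries Unit ℂ) a) else 0) = _
    rw [MvPowerSeries.algebraMap_apply, coeff_C]
    by_cases h3 : j = i
    · simp [h3]
    · by_cases h4 : i ≤ j
      · rw [if_pos h4, if_neg h3, if_neg]
        rw [Finsupp.single_eq_zero]
        omega
      · rw [if_neg h4, if_neg h3]
  have hc : ∀ j < k, constCoeff (c j) = 0 := by
    intro j hj
    have h3 := ct_pow_dvd_iff.1 h2 j hj
    rw [cf_sum] at h3
    simp_rw [hcf] at h3
    rwa [Finset.sum_ite_eq, if_pos (mem_range.2 hj)] at h3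
  -- On `x_1 = 0` the remainder is now zero; cancelling `t ^ k` exhibits an inverse of the
  -- restricted quotient.
  have hq : IsUnit q := by
    rw [Finset.sum_eq_zero fun i hi => by rw [hc i (mem_range.1 hi), map_zero, mul_zero],
      zero_add] at h1
    have h3 : v * evalAt₂ ct 0 constCoeff_ct h00 q = 1 :=
      mul_left_cancel₀ (pow_ne_zero k ct_ne_zero) (by rw [← mul_assoc, ← h1, mul_one])
    have h4 : IsUnit (evalAt₂ ct 0 constCoeff_ct h00 q) :=
      IsUnit.of_mul_eq_one _ ((mul_comm _ _).trans h3)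
    rw [isUnit_iff, constCoeff_map] at h4
    rwa [isUnit_iff]
  obtain ⟨W, hW, hWk, hWc⟩ := exists_monic_of_coeff k fun i => -c i
  refine ⟨W, hW, hWk, fun j hj => ?_, ?_⟩
  · rw [hWc j hj, map_neg, hc j hj, neg_zero]
  · intro ξ y hξ hy hW0
    have h3 : ev W = ev G * q := by
      have h4 : ev W =
          coord 0 ^ k - ∑ i ∈ range k, coord 0 ^ i * renameHom (axis 1) (c i) := by
        have h5 : W.coeff k = 1 := by rw [← hWk]; exact hW.coeff_natDegree
        simp only [hev]
        rw [Polynomial.eval₂_eq_sum_range, hWk, Finset.sum_range_succ, h5, map_one, one_mul,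
          add_comm, sub_eq_add_neg, ← Finset.sum_neg_distrib]
        congr 1
        refine Finset.sum_congr rfl fun i hi => ?_
        rw [hWc i (mem_range.1 hi), map_neg, mul_comm]
        exact mul_neg (coord 0 ^ i) (renameHom (axis 1) (c i))
      rw [h4, h]
      ring
    have h5 := congrArg (evalAt₂ y ξ hy hξ) h3
    rw [hev, map_mul, evalAt₂_eval₂_axis, evalAt₂_eval₂_axis, hW0] at h5
    exact (mul_eq_zero.1 h5.symm).resolve_right (hq.map (evalAt₂ y ξ hy hξ)).ne_zero

/-- The formula behind the Tschirnhaus shift: a suitable `r` removes the subleading coefficient in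
characteristic zero. -/
theorem coeff_taylor_pred {R : Type*} [CommRing R] {n : ℕ} (hn : 1 ≤ n) (r : R)
    {F : Polynomial R} (hF : F.natDegree ≤ n) :
    (Polynomial.taylor r F).coeff (n - 1) = F.coeff (n - 1) + n * r * F.coeff n := by
  obtain ⟨m, rfl⟩ := Nat.exists_eq_add_of_le' hn
  rw [Nat.add_sub_cancel, Polynomial.taylor_coeff]
  have hdeg : (Polynomial.hasseDeriv m F).natDegree < 2 := by
    have := Polynomial.natDegree_hasseDeriv_le F m
    omega
  rw [Polynomial.eval_eq_sum_range' hdeg]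
  simp [Finset.sum_range_succ, Polynomial.hasseDeriv_coeff, add_comm 1 m]
  ring

theorem eval₂_taylor {R S : Type*} [CommRing R] [CommRing S] (φ : R →+* S) (r : R) (y : S)
    (F : Polynomial R) :
    (Polynomial.taylor r F).eval₂ φ y = F.eval₂ φ (y + φ r) := by
  rw [Polynomial.taylor_apply, Polynomial.eval₂_comp]
  simp

theorem exists_evalAt_eq_ram (e : ℕ) (he : e ≠ 0) (f : Ct) {n : ℕ} {u : Ct}
    (hf : f = ct ^ n * u) : ram e he f = ct ^ (e * n) * ram e he u := by
  rw [hf, map_mul, map_pow, ram_ct, ← pow_mul]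

/-- Newton polygon: after ramification and rescaling, a monic polynomial that is not a power of the
variable becomes one that is not a power of the variable at the origin. -/
theorem exists_newton_slope {n : ℕ} {F : Polynomial Ct} (hF : F.Monic) (hn : F.natDegree = n)
    {j₀ : ℕ} (hj₀ : j₀ < n) (hFj : F.coeff j₀ ≠ 0) :
    ∃ (N : ℕ) (hN : N ≠ 0) (p : ℕ) (G : Polynomial Ct), G.Monic ∧ G.natDegree = n ∧
      (∃ j < n, constCoeff (G.coeff j) ≠ 0) ∧
      ∀ j ≤ n, ram N hN (F.coeff j) = ct ^ (p * (n - j)) * G.coeff j := by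
  classical
  have key : ∀ j, F.coeff j ≠ 0 → ∃ (o : ℕ) (u : Ct), constCoeff u ≠ 0 ∧
    F.coeff j = ct ^ o * u := fun j hj => exists_eq_ct_pow_mul hj
  choose! o u hu hou using key
  -- With `N = n!` every slope `o j / (n - j)` of the Newton polygon becomes an integer after `t ↦ t
  -- ^ N`; below, `p` is the least of these rescaled slopes.
  let N := n.factorial
  have hN : N ≠ 0 := Nat.factorial_ne_zero n
  let s := (range n).filter fun j => F.coeff j ≠ 0
  obtain ⟨j₁, hj₁, hmin⟩ := s.exists_min_image (fun j => o j * (N / (n - j)))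
    ⟨j₀, by simp [s, hj₀, hFj]⟩
  set p := o j₁ * (N / (n - j₁)) with hp
  have hs : ∀ j, j ∈ s ↔ j < n ∧ F.coeff j ≠ 0 := fun j => by simp [s]
  have hdvd : ∀ j < n, N / (n - j) * (n - j) = N := fun j hj =>
    Nat.div_mul_cancel (Nat.dvd_factorial (by omega) (by omega))
  have hle : ∀ j, j ∈ s → p * (n - j) ≤ N * o j := by
    intro j hj
    have h1 := hmin j hj
    calc p * (n - j) ≤ o j * (N / (n - j)) * (n - j) := by gcongr
      _ = N * o j := by rw [mul_assoc, hdvd j ((hs j).1 hj).1, mul_comm]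
  let b : ℕ → Ct := fun j =>
    if j ∈ s then ct ^ (N * o j - p * (n - j)) * ram N hN (u j) else 0
  obtain ⟨G, hmon, hdeg, hLc⟩ := exists_monic_of_coeff n b
  refine ⟨N, hN, p, G, hmon, hdeg, ⟨j₁, ((hs _).1 hj₁).1, ?_⟩, ?_⟩
  · rw [hLc _ ((hs _).1 hj₁).1]
    have h1 : N * o j₁ - p * (n - j₁) = 0 := by
      rw [hp, mul_assoc, hdvd _ ((hs _).1 hj₁).1, mul_comm, Nat.sub_self]
    simp only [b, if_pos hj₁, h1, pow_zero, one_mul, constCoeff_map]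
    exact hu _ ((hs _).1 hj₁).2
  · intro j hj
    rcases hj.lt_or_eq with hj | rfl
    · rw [hLc j hj]
      by_cases hjs : j ∈ s
      · rw [exists_evalAt_eq_ram N hN _ (hou j ((hs j).1 hjs).2)]
        simp only [b, if_pos hjs]
        rw [← mul_assoc, ← pow_add, Nat.add_sub_cancel' (hle j hjs)]
      · have h0 : F.coeff j = 0 := by
          by_contra h
          exact hjs ((hs j).2 ⟨hj, h⟩)
        simp [b, hjs, h0]
    · have h1 : F.coeff j = 1 := by rw [← hn]; exact hF.coeff_natDegree
      have h2 : G.coeff j = 1 := by rw [← hdeg]; exact hmon.coeff_natDegree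
      rw [h1, h2, map_one, Nat.sub_self, mul_zero, pow_zero, one_mul]

/-- Puiseux's theorem: a monic polynomial over `ℂ{t}` acquires a root after a substitution
`t ↦ t ^ e`. -/
theorem puiseux (n : ℕ) : ∀ F : Polynomial Ct, F.Monic → F.natDegree = n → 1 ≤ n →
    ∃ (e : ℕ) (he : e ≠ 0) (y : Ct), F.eval₂ (ram e he : Ct →+* Ct) y = 0 := by
  induction n using Nat.strong_induction_on with
  | _ n ih =>
  intro F₀ hF₀ hn₀ hn1
  have hnC : (n : ℂ) ≠ 0 := by exact_mod_cast (by omega : n ≠ 0)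
  -- Tschirnhaus shift: the subleading coefficient becomes zero, which later excludes an `n`-fold
  -- root of the reduction at the origin.
  set r : Ct := -(algebraMap ℂ Ct (n : ℂ)⁻¹ * F₀.coeff (n - 1)) with hr
  set F := Polynomial.taylor r F₀ with hFdef
  have hF : F.Monic := by
    rw [hFdef, Polynomial.Monic, Polynomial.leadingCoeff_taylor]; exact hF₀
  have hn : F.natDegree = n := by rw [hFdef, Polynomial.natDegree_taylor, hn₀]
  have hFpred : F.coeff (n - 1) = 0 := by
    have h1 : F₀.coeff n = 1 := by rw [← hn₀]; exact hF₀.coeff_natDegree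
    rw [hFdef, coeff_taylor_pred hn1 r hn₀.le, h1, hr]
    have h2 : (n : Ct) * algebraMap ℂ Ct (n : ℂ)⁻¹ = 1 := by
      rw [← map_natCast (algebraMap ℂ Ct) n, ← map_mul, mul_inv_cancel₀ hnC, map_one]
    linear_combination (-F₀.coeff (n - 1)) * h2
  suffices h : ∃ (e : ℕ) (he : e ≠ 0) (y : Ct), F.eval₂ (ram e he : Ct →+* Ct) y = 0 by
    obtain ⟨e, he, y, hy⟩ := h
    exact ⟨e, he, y + ram e he r, by rwa [hFdef, eval₂_taylor] at hy⟩
  by_cases hall : ∀ j < n, F.coeff j = 0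
  · refine ⟨1, one_ne_zero, 0, ?_⟩
    rw [Polynomial.eval₂_at_zero, hall 0 (by omega), map_zero]
  push Not at hall
  obtain ⟨j₀, hj₀, hFj⟩ := hall
  obtain ⟨N, hN, p, G, hG, hGn, ⟨j₁, hj₁, hGj⟩, hFG⟩ := exists_newton_slope hF hn hj₀ hFj
  have hGpred : G.coeff (n - 1) = 0 := by
    have h1 := hFG (n - 1) (by omega)
    rw [hFpred, map_zero] at h1
    exact (mul_eq_zero.1 h1.symm).resolve_left (pow_ne_zero _ ct_ne_zero)
  suffices h : ∃ (e : ℕ) (he : e ≠ 0) (y : Ct), G.eval₂ (ram e he : Ct →+* Ct) y = 0 by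
    obtain ⟨e, he, y, hy⟩ := h
    -- A root of `G` is rescaled by the slope: `F(t ^ N)` is obtained from `G` by weighting the
    -- coefficient of degree `j` with `t ^ (p (n - j))`.
    refine ⟨e * N, mul_ne_zero he hN, ct ^ (e * p) * y, ?_⟩
    rw [Polynomial.eval₂_eq_sum_range, hGn] at hy
    rw [Polynomial.eval₂_eq_sum_range, hn]
    have h1 : ∀ j ∈ range (n + 1), (ram (e * N) (mul_ne_zero he hN) : Ct →+* Ct) (F.coeff j) *
        (ct ^ (e * p) * y) ^ j =
        ct ^ (e * p * n) * ((ram e he : Ct →+* Ct) (G.coeff j) * y ^ j) := by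
      intro j hj
      have hjn : j ≤ n := by simpa [Nat.lt_succ_iff] using hj
      change ram (e * N) (mul_ne_zero he hN) (F.coeff j) * _ = _ * (ram e he (G.coeff j) * _)
      rw [← ram_ram e N he hN, hFG j hjn, map_mul, map_pow, ram_ct, mul_pow]
      have h2 : (ct ^ e) ^ (p * (n - j)) * (ct ^ (e * p)) ^ j = ct ^ (e * p * n) := by
        rw [← pow_mul, ← pow_mul, ← pow_add]
        congr 1
        rw [← mul_assoc, ← mul_add, Nat.sub_add_cancel hjn]
      rw [← h2]
      ring
    rw [Finset.sum_congr rfl h1, ← Finset.mul_sum, hy, mul_zero]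
  set G₀ : Polynomial ℂ := G.map ((constCoeff : Ct →ₐ[ℂ] ℂ) : Ct →+* ℂ) with hG₀
  have hG₀deg : G₀.natDegree = n := by rw [hG₀, hG.natDegree_map, hGn]
  obtain ⟨a, ha⟩ : ∃ a, G₀.IsRoot a := by
    refine IsAlgClosed.exists_root G₀ ?_
    rw [Polynomial.degree_eq_natDegree (hG.map _).ne_zero, hG₀deg]
    exact_mod_cast (by omega : n ≠ 0)
  set H := Polynomial.taylor (algebraMap ℂ Ct a) G with hH
  set H₀ := Polynomial.taylor a G₀ with hH₀
  have hHH : H.map ((constCoeff : Ct →ₐ[ℂ] ℂ) : Ct →+* ℂ) = H₀ := by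
    rw [hH, hH₀, hG₀, Polynomial.map_taylor]
    congr 2
  have hH₀m : H₀.Monic := by
    rw [hH₀, Polynomial.Monic, Polynomial.leadingCoeff_taylor]; exact hG.map _
  have hH₀deg : H₀.natDegree = n := by rw [hH₀, Polynomial.natDegree_taylor, hG₀deg]
  have hcoef : ∀ j, constCoeff (H.coeff j) = H₀.coeff j := by
    intro j
    rw [← hHH, Polynomial.coeff_map]
    rfl
  set k := H₀.natTrailingDegree with hk
  have hk1 : k ≠ 0 := by
    rw [hk, Polynomial.natTrailingDegree_ne_zero]
    refine ⟨hH₀m.ne_zero, ?_⟩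
    rw [hH₀, Polynomial.taylor_coeff_zero]
    exact ha
  -- If `a` were an `n`-fold root, the vanishing subleading coefficient would give `n a = 0`. Then
  -- `a = 0` and the reduction would be a pure power, against the nonzero coefficient `j₁` supplied
  -- by the Newton slope.
  have hkn : k < n := by
    refine lt_of_le_of_ne (hH₀deg ▸ Polynomial.natTrailingDegree_le_natDegree _) fun hkn => ?_
    have h1 : ∀ j < n, H₀.coeff j = 0 := fun j hj =>
      Polynomial.coeff_eq_zero_of_lt_natTrailingDegree (by omega)
    have h2 := h1 (n - 1) (by omega)
    rw [hH₀, coeff_taylor_pred hn1 a hG₀deg.le] at h2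
    have h3 : G₀.coeff (n - 1) = 0 := by
      rw [hG₀, Polynomial.coeff_map, hGpred, map_zero]
    have h4 : G₀.coeff n = 1 := by rw [← hG₀deg]; exact (hG.map _).coeff_natDegree
    rw [h3, h4, zero_add, mul_one] at h2
    have ha0 : a = 0 := (mul_eq_zero.1 h2).resolve_left hnC
    have h5 := h1 j₁ hj₁
    rw [hH₀, ha0, Polynomial.taylor_zero, hG₀, Polynomial.coeff_map] at h5
    exact hGj h5
  -- The roots of `G` near `a` are governed by a Weierstrass polynomial of degree `k < n`, to which
  -- induction applies.
  obtain ⟨W, hW, hWk, hWlow, hWroot⟩ := exists_weierstrass_polynomial H k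
    (fun j hj => by
      rw [hcoef]; exact Polynomial.coeff_eq_zero_of_lt_natTrailingDegree hj)
    (by
      rw [hcoef]
      exact Polynomial.trailingCoeff_nonzero_iff_nonzero.2 hH₀m.ne_zero)
  obtain ⟨e, he, y, hy⟩ := ih k hkn W hW hWk (Nat.one_le_iff_ne_zero.2 hk1)
  have hy0 : constCoeff y = 0 := by
    have h1 := congrArg constCoeff hy
    rw [Polynomial.eval₂_eq_sum_range, map_sum, hWk, Finset.sum_range_succ] at h1
    have h2 : ∀ j ∈ range k,
        constCoeff ((ram e he : Ct →+* Ct) (W.coeff j) * y ^ j) = 0 := by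
      intro j hj
      rw [map_mul]
      change constCoeff (ram e he (W.coeff j)) * _ = 0
      rw [constCoeff_map, hWlow j (mem_range.1 hj), zero_mul]
    have h3 : W.coeff k = 1 := by rw [← hWk]; exact hW.coeff_natDegree
    rw [Finset.sum_eq_zero h2, zero_add, h3, map_one, one_mul, map_zero, map_pow] at h1
    exact pow_eq_zero_iff hk1 |>.1 h1
  have h1 := hWroot (ct ^ e) y (constCoeff_ct_pow he) hy0 hy
  rw [hH, eval₂_taylor] at h1
  exact ⟨e, he, _, h1⟩

/-! ## Parametrization of irreducible germs -/

section Primitive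

open scoped IntermediateField nonZeroDivisors

attribute [local instance] FractionRing.liftAlgebra FractionRing.isScalarTower_liftAlgebra

/-- A finite extension of integrally closed domains of characteristic zero has an element `b` such
that embeddings of the extension correspond to roots of the minimal polynomial of `b`. -/
theorem exists_primitive_element_extension (R B : Type*) [CommRing R] [IsDomain R]
    [IsIntegrallyClosed R] [CharZero R] [CommRing B] [IsDomain B] [Algebra R B] [Module.Finite R B]
    [FaithfulSMul R B] :
    ∃ b : B, ∀ (Ω : Type) [Field Ω] (ρ : R →+* Ω) (y : Ω), Function.Injective ρ →
      (minpoly R b).eval₂ ρ y = 0 →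
      ∃ τ : B →+* Ω, Function.Injective τ ∧ (∀ r, τ (algebraMap R B r) = ρ r) ∧ τ b = y := by
  let K := FractionRing R
  let L := FractionRing B
  have : CharZero K := charZero_of_injective_algebraMap (IsFractionRing.injective R K)
  have : Module.IsTorsionFree R B := inferInstance
  have hfin : FiniteDimensional K L := .of_isLocalization R B R⁰
  obtain ⟨α, hα⟩ := Field.exists_primitive_element K L
  -- Clearing a denominator from `R` puts the primitive element into `B` without changing the field
  -- it generates.
  obtain ⟨⟨b, d⟩, hbd⟩ := IsLocalization.surj (Algebra.algebraMapSubmonoid B R⁰) α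
  obtain ⟨d', hd', hdd'⟩ := d.2
  have hd'0 : d' ≠ 0 := nonZeroDivisors.ne_zero hd'
  have hb : K⟮algebraMap B L b⟯ = ⊤ := by
    have h1 : algebraMap B L b = algebraMap K L (algebraMap R K d') * α := by
      rw [← hbd, ← IsScalarTower.algebraMap_apply R K L, IsScalarTower.algebraMap_apply R B L,
        hdd', mul_comm]
    have h2 : algebraMap K L (algebraMap R K d') ≠ 0 := by
      rw [map_ne_zero, map_ne_zero_iff _ (IsFractionRing.injective R K)]
      exact hd'0
    rw [eq_top_iff, ← hα, IntermediateField.adjoin_le_iff, Set.singleton_subset_iff]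
    have h3 : α = (algebraMap K L (algebraMap R K d'))⁻¹ * algebraMap B L b := by
      rw [h1, inv_mul_cancel_left₀ h2]
    rw [h3]
    refine mul_mem (inv_mem (IntermediateField.algebraMap_mem _ _)) ?_
    exact IntermediateField.mem_adjoin_simple_self K _
  refine ⟨b, fun Ω _ ρ y hρ hy => ?_⟩
  have hint : IsIntegral R b := Algebra.IsIntegral.isIntegral b
  have hintK : IsIntegral K (algebraMap B L b) := Algebra.IsIntegral.isIntegral _
  -- Integral closedness of `R` makes the minimal polynomials over `R` and over its fraction field
  -- agree, so a root of the former determines an embedding.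
  have hmin := minpoly.isIntegrallyClosed_eq_field_fractions K L hint
  let ρK : K →+* Ω := IsFractionRing.lift hρ
  have hρK : ∀ r, ρK (algebraMap R K r) = ρ r := IsFractionRing.lift_algebraMap hρ
  have hroot : (minpoly K (algebraMap B L b)).eval₂ ρK y = 0 := by
    rw [hmin, Polynomial.eval₂_map, show ρK.comp (algebraMap R K) = ρ from RingHom.ext hρK, hy]
  let T : AdjoinRoot (minpoly K (algebraMap B L b)) →+* Ω := AdjoinRoot.lift ρK y hroot
  let e : AdjoinRoot (minpoly K (algebraMap B L b)) ≃ₐ[K] K⟮algebraMap B L b⟯ :=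
    IntermediateField.adjoinRootEquivAdjoin K hintK
  let e' : L ≃ₐ[K] K⟮algebraMap B L b⟯ :=
    (IntermediateField.topEquiv.symm.trans (IntermediateField.equivOfEq hb.symm))
  let ε : L ≃ₐ[K] AdjoinRoot (minpoly K (algebraMap B L b)) := e'.trans e.symm
  have hεb : ε (algebraMap B L b) = AdjoinRoot.root _ := by
    have h1 : e' (algebraMap B L b) = IntermediateField.AdjoinSimple.gen K (algebraMap B L b) :=
      rfl
    change e.symm (e' _) = _
    rw [h1]
    exact IntermediateField.adjoinRootEquivAdjoin_symm_apply_gen K hintK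
  let τL : L →+* Ω := T.comp (ε : L →+* AdjoinRoot (minpoly K (algebraMap B L b)))
  refine ⟨τL.comp (algebraMap B L), τL.injective.comp (IsFractionRing.injective B L), ?_, ?_⟩
  · intro r
    change T (ε (algebraMap B L (algebraMap R B r))) = ρ r
    rw [← IsScalarTower.algebraMap_apply R B L, IsScalarTower.algebraMap_apply R K L,
      AlgEquiv.commutes]
    exact (AdjoinRoot.lift_of hroot).trans (hρK r)
  · change T (ε (algebraMap B L b)) = y
    rw [hεb]
    exact AdjoinRoot.lift_root hroot

end Primitive

theorem exists_ringHom_lift {A B C : Type*} [CommRing A] [CommRing B] [CommRing C] (f : A →+* C)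
    (g : B →+* C) (hg : Function.Injective g) (h : ∀ a, ∃ b, g b = f a) :
    ∃ l : A →+* B, ∀ a, g (l a) = f a := by
  choose l hl using h
  exact ⟨{ toFun := l
           map_one' := hg (by rw [hl, map_one, map_one])
           map_mul' := fun a b => hg (by rw [hl, map_mul, map_mul, hl, hl])
           map_zero' := hg (by rw [hl, map_zero, map_zero])
           map_add' := fun a b => hg (by rw [hl, map_add, map_add, hl, hl]) }, hl⟩

/-! ### Rotations of `ℂ{t}` by roots of unity. -/

theorem constCoeff_smul_ct (ω : ℂ) : constCoeff (ω • ct) = 0 := by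
  rw [map_smul, constCoeff_ct, smul_zero]

/-- The substitution `t ↦ ω t`. -/
def rot (ω : ℂ) : Ct →ₐ[ℂ] Ct := evalAt (ω • ct) (constCoeff_smul_ct ω)

@[simp]
theorem rot_ct (ω : ℂ) : rot ω ct = ω • ct := evalAt_ct _ _

theorem rot_rot (ω ω' : ℂ) (f : Ct) : rot ω (rot ω' f) = rot (ω * ω') f :=
  DFunLike.congr_fun (Ct.hom_ext (φ := (rot ω).comp (rot ω'))
    (by simp [smul_smul, mul_comm])) f

theorem rot_ram {ω : ℂ} {e : ℕ} (he : e ≠ 0) (h : ω ^ e = 1) (f : Ct) :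
    rot ω (ram e he f) = ram e he f :=
  DFunLike.congr_fun (Ct.hom_ext (φ := (rot ω).comp (ram e he))
    (by simp [smul_pow, h])) f

theorem rot_injective {ω : ℂ} (h : ω ≠ 0) : Function.Injective (rot ω) :=
  Ct.map_injective _ (by rw [rot_ct]; exact smul_ne_zero h ct_ne_zero)

theorem exists_eq_sum_ram (e : ℕ) (he : e ≠ 0) (g : Ct) :
    ∃ c : ℕ → Ct, g = ∑ j ∈ range e, ct ^ j * ram e he (c j) :=
  exists_eq_sum_evalAt (u := 1) (by simp) (mul_one _).symm (constCoeff_ct_pow he) g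

/-- A series that is invariant under a root of unity of order `d` is a series in `t ^ d`. -/
theorem exists_ram_of_rot {ω : ℂ} {d : ℕ} (hd : d ≠ 0) (hω : IsPrimitiveRoot ω d) {y : Ct}
    (hy : rot ω y = y) : ∃ y', y = ram d hd y' := by
  obtain ⟨c, hc⟩ := exists_eq_sum_ram d hd y
  have h1 : ∀ l : ℕ, rot (ω ^ l) y = y := by
    intro l
    induction l with
    | zero =>
      rw [pow_zero]
      exact DFunLike.congr_fun (Ct.hom_ext (φ := rot 1) (ψ := AlgHom.id ℂ Ct) (by simp)) y
    | succ l ih => rw [pow_succ, ← rot_rot, hy, ih]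
  have h2 : ∀ l : ℕ, y = ∑ j ∈ range d, (ω ^ l) ^ j • (ct ^ j * ram d hd (c j)) := by
    intro l
    conv_lhs => rw [← h1 l, hc]
    rw [map_sum]
    refine Finset.sum_congr rfl fun j _ => ?_
    rw [map_mul, map_pow, rot_ct, rot_ram hd (by rw [← pow_mul, mul_comm, pow_mul, hω.pow_eq_one,
      one_pow]), smul_pow, smul_mul_assoc]
  -- Averaging over all rotations: the geometric sums annihilate every component except `j = 0`.
  have h3 : (d : ℂ) • y = (d : ℂ) • ram d hd (c 0) := by
    calc (d : ℂ) • y = ∑ l ∈ range d, y := by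
          rw [Finset.sum_const, card_range, Nat.cast_smul_eq_nsmul]
      _ = ∑ l ∈ range d, ∑ j ∈ range d, (ω ^ l) ^ j • (ct ^ j * ram d hd (c j)) :=
          Finset.sum_congr rfl fun l _ => h2 l
      _ = ∑ j ∈ range d, (∑ l ∈ range d, (ω ^ j) ^ l) • (ct ^ j * ram d hd (c j)) := by
          rw [Finset.sum_comm]
          refine Finset.sum_congr rfl fun j _ => ?_
          rw [Finset.sum_smul]
          refine Finset.sum_congr rfl fun l _ => ?_
          rw [← pow_mul, ← pow_mul, mul_comm]
      _ = (∑ l ∈ range d, (ω ^ 0) ^ l) • (ct ^ 0 * ram d hd (c 0)) := by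
          refine Finset.sum_eq_single_of_mem 0 (mem_range.2 (Nat.pos_of_ne_zero hd)) ?_
          intro j hj hj0
          have hne : ω ^ j ≠ 1 := hω.pow_ne_one_of_pos_of_lt hj0 (mem_range.1 hj)
          have h4 : (ω ^ j - 1) * ∑ l ∈ range d, (ω ^ j) ^ l = 0 := by
            rw [mul_geom_sum, ← pow_mul, mul_comm, pow_mul, hω.pow_eq_one, one_pow, sub_self]
          rw [(mul_eq_zero.1 h4).resolve_left (sub_ne_zero.2 hne), zero_smul]
      _ = _ := by simp
  have hdC : (d : ℂ) ≠ 0 := by exact_mod_cast hd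
  exact ⟨c 0, smul_right_injective Ct hdC h3⟩

/-- If the conjugates of `y` are distinct then the algebra generated by `y` over `ℂ{t ^ e}`
contains a power of the maximal ideal of `ℂ{t}`. -/
theorem exists_conductor_of_conjugates {e : ℕ} (he : e ≠ 0) {ζ : ℂ} (hζ : IsPrimitiveRoot ζ e)
    {y : Ct} (hy : ∀ i < e, ∀ j < e, rot (ζ ^ i) y = rot (ζ ^ j) y → i = j) :
    ∃ N : ℕ, ∀ g : Ct, ∃ c : ℕ → Ct, ct ^ N * g = ∑ i ∈ range e, ram e he (c i) * y ^ i := by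
  classical
  -- A relation would be a polynomial of degree below `e` with coefficients fixed by the rotations,
  -- hence with the `e` distinct conjugates of `y` as roots.
  have hindep : ∀ c : Fin e → Ct, ∑ i, ram e he (c i) * y ^ (i : ℕ) = 0 → c = 0 := by
    intro c hc
    let P : Polynomial Ct := ∑ i : Fin e, Polynomial.C (ram e he (c i)) * Polynomial.X ^ (i : ℕ)
    have hP0 : P = 0 := by
      refine Polynomial.eq_zero_of_degree_lt_of_eval_finset_eq_zero
        ((range e).image fun j => rot (ζ ^ j) y) ?_ ?_
      · rw [Finset.card_image_of_injOn fun i hi j hj h =>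
          hy i (mem_range.1 hi) j (mem_range.1 hj) h, card_range, ← Polynomial.mem_degreeLT]
        refine Submodule.sum_mem _ fun i _ => ?_
        rw [Polynomial.mem_degreeLT]
        exact (Polynomial.degree_C_mul_X_pow_le _ _).trans_lt (by exact_mod_cast i.2)
      · intro x hx
        obtain ⟨j, -, rfl⟩ := Finset.mem_image.1 hx
        have h1 := congrArg (rot (ζ ^ j)) hc
        rw [map_sum, map_zero] at h1
        simp only [P, Polynomial.eval_finsetSum, Polynomial.eval_mul, Polynomial.eval_C,
          Polynomial.eval_pow, Polynomial.eval_X]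
        rw [← h1]
        refine Finset.sum_congr rfl fun i _ => ?_
        rw [map_mul, map_pow, rot_ram he (by rw [← pow_mul, mul_comm, pow_mul, hζ.pow_eq_one,
          one_pow])]
    funext i
    have h1 := congrArg (fun Q => Polynomial.coeff Q (i : ℕ)) hP0
    simp only [P, Polynomial.finsetSum_coeff, Polynomial.coeff_C_mul_X_pow,
      Polynomial.coeff_zero] at h1
    rw [Finset.sum_eq_single i (fun j _ hj => if_neg fun h => hj (Fin.ext h.symm)) (by simp),
      if_pos rfl] at h1
    exact ram_injective e he (h1.trans (map_zero _).symm)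
  choose m hm using fun i : ℕ => exists_eq_sum_ram e he (y ^ i)
  let M : Matrix (Fin e) (Fin e) Ct := fun i j => m i j
  have hM : ∀ i : Fin e, y ^ (i : ℕ) = ∑ j : Fin e, ct ^ (j : ℕ) * ram e he (M i j) := by
    intro i
    rw [hm i, ← Fin.sum_univ_eq_sum_range (fun j => ct ^ j * ram e he (m i j))]
  have hcomb : ∀ v : Fin e → Ct, ∑ i, ram e he (v i) * y ^ (i : ℕ) =
      ∑ j : Fin e, ct ^ (j : ℕ) * ram e he (Matrix.vecMul v M j) := by
    intro v
    simp_rw [hM, Finset.mul_sum]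
    rw [Finset.sum_comm]
    refine Finset.sum_congr rfl fun j _ => ?_
    rw [Matrix.vecMul, dotProduct, map_sum, Finset.mul_sum]
    refine Finset.sum_congr rfl fun i _ => ?_
    rw [map_mul]
    ring
  -- `M` expresses the powers of `y` in the basis `1, t, …, t ^ (e - 1)` over `ℂ{t ^ e}`. By
  -- Cramer's rule, `M.det` times any series is a combination of powers of `y`, and the order of its
  -- image is the conductor exponent.
  have hdet : M.det ≠ 0 := by
    intro h0
    obtain ⟨v, hv, hvM⟩ := Matrix.exists_vecMul_eq_zero_iff.2 h0
    exact hv (hindep v (by rw [hcomb, hvM]; simp))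
  obtain ⟨n, u, hu, hdu⟩ := exists_eq_ct_pow_mul
    ((map_ne_zero_iff _ (ram_injective e he)).2 hdet)
  obtain ⟨u, rfl⟩ := isUnit_of_constCoeff hu
  refine ⟨n, fun g => ?_⟩
  obtain ⟨b, hb⟩ := exists_eq_sum_ram e he (((u⁻¹ : Ctˣ) : Ct) * g)
  let v : Fin e → Ct := Matrix.vecMul (fun k : Fin e => b k) M.adjugate
  have hv : Matrix.vecMul v M = fun k : Fin e => M.det * b k := by
    rw [Matrix.vecMul_vecMul, Matrix.adjugate_mul, Matrix.vecMul_smul, Matrix.vecMul_one]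
    rfl
  refine ⟨fun i => if h : i < e then v ⟨i, h⟩ else 0, ?_⟩
  rw [← Fin.sum_univ_eq_sum_range (fun i => ram e he (if h : i < e then v ⟨i, h⟩ else 0) * y ^ i)]
  simp only [Fin.is_lt, dif_pos, Fin.eta]
  rw [hcomb, hv]
  simp only [map_mul]
  calc ct ^ n * g = (ct ^ n * u) * (((u⁻¹ : Ctˣ) : Ct) * g) := by
        rw [mul_assoc, Units.mul_inv_cancel_left]
    _ = ram e he M.det * ∑ j ∈ range e, ct ^ j * ram e he (b j) := by rw [← hdu, ← hb]
    _ = _ := by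
        rw [← Fin.sum_univ_eq_sum_range (fun j => ct ^ j * ram e he (b j)), Finset.mul_sum]
        refine Finset.sum_congr rfl fun j _ => ?_
        ring

/-- A finite domain over `ℂ{z}` embeds in `ℂ{t}`, and the image contains a power of the maximal
ideal. -/
theorem exists_parametrization {B : Type*} [CommRing B] [IsDomain B] [Algebra ℂ B]
    (j : Ct →ₐ[ℂ] B) (hj : Function.Injective j) (hfin : j.Finite) :
    ∃ φ : B →ₐ[ℂ] Ct, Function.Injective φ ∧ ∃ N : ℕ, ∀ g : Ct, ∃ b : B, φ b = ct ^ N * g := by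
  classical
  let _ : Algebra Ct B := j.toRingHom.toAlgebra
  have : Module.Finite Ct B := hfin
  have : FaithfulSMul Ct B := (faithfulSMul_iff_algebraMap_injective Ct B).2 hj
  have : CharZero Ct := charZero_of_injective_algebraMap (algebraMap ℂ Ct).injective
  obtain ⟨b, hb⟩ := exists_primitive_element_extension Ct B
  have hint : IsIntegral Ct b := Algebra.IsIntegral.isIntegral b
  -- The ramification index is taken least possible; otherwise the parametrization could be a
  -- multiple cover and have no conductor.
  have hex : ∃ e : ℕ, ∃ (he : e ≠ 0) (y : Ct), (minpoly Ct b).eval₂ (ram e he : Ct →+* Ct) y = 0 :=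
    puiseux _ (minpoly Ct b) (minpoly.monic hint) rfl (minpoly.natDegree_pos hint)
  obtain ⟨he, y, hy⟩ := Nat.find_spec hex
  set e := Nat.find hex with hedef
  have hmin : ∀ e' < e, ∀ (he' : e' ≠ 0) (y' : Ct),
      (minpoly Ct b).eval₂ (ram e' he' : Ct →+* Ct) y' ≠ 0 := fun e' h' he' y' h =>
    Nat.find_min hex h' ⟨he', y', h⟩
  let Ω := FractionRing Ct
  have hΩ : Function.Injective (algebraMap Ct Ω) := IsFractionRing.injective Ct Ω
  obtain ⟨τ, hτ, hτr, hτb⟩ := hb Ω ((algebraMap Ct Ω).comp (ram e he : Ct →+* Ct))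
    (algebraMap Ct Ω y) (hΩ.comp (ram_injective e he))
    (by rw [← Polynomial.hom_eval₂, hy, map_zero])
  -- Elements of `B` are integral over `ℂ{z}`, so their images are fractions integral over `ℂ{t}`,
  -- hence lie in `ℂ{t}`.
  have himg : ∀ x : B, ∃ z : Ct, algebraMap Ct Ω z = τ x := by
    intro x
    obtain ⟨p, hp, hpx⟩ : IsIntegral Ct x := Algebra.IsIntegral.isIntegral x
    refine IsIntegrallyClosed.isIntegral_iff.1 ⟨p.map (ram e he : Ct →+* Ct), hp.map _, ?_⟩
    rw [Polynomial.eval₂_map]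
    have h1 := congrArg τ hpx
    rw [Polynomial.hom_eval₂, map_zero] at h1
    rwa [show τ.comp (algebraMap Ct B) = (algebraMap Ct Ω).comp (ram e he : Ct →+* Ct) from
      RingHom.ext hτr] at h1
  obtain ⟨φ, hφ⟩ := exists_ringHom_lift τ (algebraMap Ct Ω) hΩ himg
  have hφj : ∀ f : Ct, φ (j f) = ram e he f := fun f => hΩ ((hφ _).trans (hτr f))
  have hφb : φ b = y := hΩ ((hφ _).trans hτb)
  let Φ : B →ₐ[ℂ] Ct :=
    { φ with
      commutes' := fun c => by
        have h1 := hφj (algebraMap ℂ Ct c)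
        rw [AlgHom.commutes, AlgHom.commutes] at h1
        exact h1 }
  have hζ := Complex.isPrimitiveRoot_exp e he
  set ζ := Complex.exp (2 * Real.pi * Complex.I / e) with hζdef
  have hζ0 : ζ ≠ 0 := Complex.exp_ne_zero _
  -- A rotation of order `d > 1` fixing `y` would make `y` a series in `t ^ d`, giving a root with
  -- ramification `e / d < e`.
  have hroot : ∀ k < e, 0 < k → rot (ζ ^ k) y ≠ y := by
    intro k hke hk0 hk
    have hω1 : (ζ ^ k) ^ e = 1 := by rw [← pow_mul, mul_comm, pow_mul, hζ.pow_eq_one, one_pow]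
    have hpr := IsPrimitiveRoot.orderOf (ζ ^ k)
    have hd0 : orderOf (ζ ^ k) ≠ 0 := by
      intro h0
      exact he (Nat.eq_zero_of_zero_dvd (h0 ▸ orderOf_dvd_of_pow_eq_one hω1))
    obtain ⟨e', he'⟩ := orderOf_dvd_of_pow_eq_one hω1
    obtain ⟨y', hy'⟩ := exists_ram_of_rot hd0 hpr hk
    have he'0 : e' ≠ 0 := by
      rintro rfl
      exact he (by rw [he', mul_zero])
    have hd1 : orderOf (ζ ^ k) ≠ 1 := by
      rw [Ne, orderOf_eq_one_iff]
      exact hζ.pow_ne_one_of_pos_of_lt hk0.ne' hke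
    have hlt : e' < e := by
      rw [he']
      have : 2 ≤ orderOf (ζ ^ k) := by omega
      nlinarith [Nat.pos_of_ne_zero he'0]
    refine hmin e' hlt he'0 y' (ram_injective _ hd0 ?_)
    rw [map_zero]
    have h1 : (ram (orderOf (ζ ^ k)) hd0 : Ct →+* Ct).comp (ram e' he'0 : Ct →+* Ct) =
        (ram e he : Ct →+* Ct) := by
      refine RingHom.ext fun f => ?_
      change ram _ hd0 (ram e' he'0 f) = ram e he f
      rw [ram_ram]
      congr 1
      simp only [he']
    have h2 := Polynomial.hom_eval₂ (minpoly Ct b) (ram e' he'0 : Ct →+* Ct)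
      (ram (orderOf (ζ ^ k)) hd0 : Ct →+* Ct) y'
    rw [h1] at h2
    refine h2.trans ?_
    rw [← hy]
    congr 1
    exact hy'.symm
  have hconj : ∀ i < e, ∀ k < e, rot (ζ ^ i) y = rot (ζ ^ k) y → i = k := by
    have key : ∀ i k, i < k → k < e → rot (ζ ^ i) y ≠ rot (ζ ^ k) y := by
      intro i k hik hke h
      refine hroot (k - i) (by omega) (by omega) (rot_injective (pow_ne_zero i hζ0) ?_)
      rw [rot_rot, ← pow_add, Nat.add_sub_cancel' hik.le, h]
    intro i hi k hk h
    rcases lt_trichotomy i k with h1 | h1 | h1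
    · exact absurd h (key i k h1 hk)
    · exact h1
    · exact absurd h.symm (key k i h1 hi)
  obtain ⟨N, hN⟩ := exists_conductor_of_conjugates he hζ hconj
  refine ⟨Φ, fun x x' hx => hτ ?_, N, fun g => ?_⟩
  · rw [← hφ, ← hφ]
    exact congrArg _ hx
  · obtain ⟨c, hc⟩ := hN g
    refine ⟨∑ i ∈ range e, j (c i) * b ^ i, ?_⟩
    rw [hc]
    change φ _ = _
    rw [map_sum]
    refine Finset.sum_congr rfl fun i _ => ?_
    rw [map_mul, map_pow, hφj, hφb]

/-! ## Noether normalization of analytic algebras -/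

section Noether

variable {σ : Type*}

theorem constCoeff_smul_ct' (p : σ → ℂ) (j : σ) : constCoeff (p j • ct) = 0 := by
  rw [map_smul, constCoeff_ct, smul_zero]

variable [Finite σ]

/-- Restriction of a convergent power series to the line through `p`. -/
def line (p : σ → ℂ) : ConvergentPowerSeries σ →ₐ[ℂ] Ct :=
  substHom (fun j => p j • ct) (constCoeff_smul_ct' p)

@[simp]
theorem line_coord (p : σ → ℂ) (j : σ) : line p (coord j) = p j • ct := substHom_coord _ _ _

theorem cf_line [Fintype σ] [DecidableEq σ] (p : σ → ℂ) (f : ConvergentPowerSeries σ) (n : ℕ) :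
    cf (Finsupp.single () n) (line p f) =
      ∑ d ∈ finsuppAntidiag univ n, cf d f * ∏ j, p j ^ d j := by
  have hterm : ∀ d : σ →₀ ℕ, coeff (Finsupp.single () n)
      (d.prod fun s e => ((p s • ct : Ct) : MvPowerSeries Unit ℂ) ^ e) =
      if d.degree = n then ∏ j, p j ^ d j else 0 := by
    intro d
    have h1 : (d.prod fun s e => ((p s • ct : Ct) : MvPowerSeries Unit ℂ) ^ e) =
        (∏ j, p j ^ d j) • (X () : MvPowerSeries Unit ℂ) ^ d.degree := by
      rw [Finsupp.prod_fintype _ _ (fun _ => pow_zero _), Finsupp.degree_eq_sum]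
      change ∏ i, (p i • (X () : MvPowerSeries Unit ℂ)) ^ d i = _
      simp_rw [smul_pow]
      rw [Finset.prod_smul, Finset.prod_pow_eq_pow_sum]
    rw [h1, map_smul, coeff_X_pow, smul_eq_mul]
    by_cases h2 : d.degree = n
    · simp [h2]
    · rw [if_neg, if_neg h2, mul_zero]
      exact fun h3 => h2 (Finsupp.single_injective () h3).symm
  rw [cf, line, coe_substHom, coeff_subst (hasSubst (constCoeff_smul_ct' p))]
  simp_rw [hterm]
  rw [finsum_eq_sum_of_support_subset (s := finsuppAntidiag univ n)]
  · refine Finset.sum_congr rfl fun d hd => ?_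
    rw [if_pos]
    · rfl
    · rw [Finsupp.degree_eq_sum]
      exact (mem_finsuppAntidiag.1 hd).1
  · intro d hd
    rw [Function.mem_support] at hd
    rw [mem_coe, mem_finsuppAntidiag]
    refine ⟨?_, subset_univ _⟩
    by_contra h
    rw [← Finsupp.degree_eq_sum] at h
    rw [if_neg h, smul_zero] at hd
    exact hd rfl

theorem cf_single_eq_cf_line [DecidableEq σ] (s : σ) (f : ConvergentPowerSeries σ) (n : ℕ) :
    cf (Finsupp.single s n) f = cf (Finsupp.single () n) (line (Pi.single s 1) f) := by
  have := Fintype.ofFinite σ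
  rw [cf_line, Finset.sum_eq_single (Finsupp.single s n)]
  · rw [Finset.prod_eq_one, mul_one]
    intro j _
    by_cases hj : j = s
    · subst hj; simp
    · simp [Finsupp.single_eq_of_ne hj]
  · intro d hd hne
    rw [mem_finsuppAntidiag] at hd
    obtain ⟨j, hj, hdj⟩ : ∃ j, j ≠ s ∧ d j ≠ 0 := by
      by_contra! h
      refine hne (Finsupp.ext fun j => ?_)
      by_cases hj : j = s
      · subst hj
        rw [Finsupp.single_eq_same, ← hd.1]
        exact (Finset.sum_eq_single_of_mem j (mem_univ _) fun i _ hi => h i hi).symm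
      · rw [h j hj, Finsupp.single_eq_of_ne hj]
    rw [Finset.prod_eq_zero (mem_univ j), mul_zero]
    rw [Pi.single_eq_of_ne hj, zero_pow hdj]
  · intro h
    refine absurd ?_ h
    rw [mem_finsuppAntidiag]
    refine ⟨?_, subset_univ _⟩
    rw [← Finsupp.degree_eq_sum, Finsupp.degree_single]

/-- A nonzero series is nonzero on some line transverse to a given coordinate hyperplane. -/
theorem exists_line_ne_zero (s : σ) {f : ConvergentPowerSeries σ} (hf : f ≠ 0) :
    ∃ p : σ → ℂ, p s ≠ 0 ∧ line p f ≠ 0 := by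
  classical
  have := Fintype.ofFinite σ
  obtain ⟨d₀, hd₀⟩ : ∃ d, cf d f ≠ 0 := by
    by_contra! h
    exact hf (ext_cf fun α => by rw [h α]; rfl)
  let n := d₀.degree
  let P : MvPolynomial σ ℂ := ∑ d ∈ finsuppAntidiag univ n, MvPolynomial.monomial d (cf d f)
  have hP : P ≠ 0 := by
    intro h
    have h1 := congrArg (MvPolynomial.coeff d₀) h
    simp only [P, MvPolynomial.coeff_sum, MvPolynomial.coeff_monomial,
      MvPolynomial.coeff_zero] at h1
    rw [Finset.sum_ite_eq', if_pos] at h1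
    · exact hd₀ h1
    · rw [mem_finsuppAntidiag]
      exact ⟨(Finsupp.degree_eq_sum _).symm, subset_univ _⟩
  -- `P` is a nonzero homogeneous component of `f`; the factor `X s` makes the chosen direction
  -- transverse to the hyperplane `x_s = 0`.
  obtain ⟨p, hp⟩ : ∃ p : σ → ℂ, MvPolynomial.eval p (P * MvPolynomial.X s) ≠ 0 := by
    by_contra! h
    refine mul_ne_zero hP (MvPolynomial.X_ne_zero s) (MvPolynomial.funext fun x => ?_)
    rw [h x, map_zero]
  rw [map_mul, MvPolynomial.eval_X] at hp
  refine ⟨p, right_ne_zero_of_mul hp, fun h => left_ne_zero_of_mul hp ?_⟩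
  have h1 := cf_line p f n
  rw [h] at h1
  simp only [P, map_sum, MvPolynomial.eval_monomial]
  rw [show cf (Finsupp.single () n) (0 : Ct) = 0 from rfl] at h1
  rw [h1]
  refine Finset.sum_congr rfl fun d _ => ?_
  rw [Finsupp.prod_fintype _ _ (fun _ => pow_zero _)]

/-- After a linear change of coordinates, a nonzero series is regular in a given coordinate. -/
theorem exists_linear_change (s : σ) {f : ConvergentPowerSeries σ} (hf : f ≠ 0) :
    ∃ T T' : ConvergentPowerSeries σ →ₐ[ℂ] ConvergentPowerSeries σ, (∀ g, T' (T g) = g) ∧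
      ∃ k, (∀ j < k, cf (Finsupp.single s j) (T f) = 0) ∧ cf (Finsupp.single s k) (T f) ≠ 0 := by
  classical
  obtain ⟨p, hps, hp⟩ := exists_line_ne_zero s hf
  -- A shear that carries the axis of `s` to the line through `p`, so that the restriction of `T f`
  -- to this axis is `line p f`.
  let a : σ → ConvergentPowerSeries σ := fun j =>
    if j = s then p s • coord s else coord j + p j • coord s
  have ha : ∀ j, constCoeff (a j) = 0 := by
    intro j
    dsimp only [a]
    split_ifs <;> simp
  let a' : σ → ConvergentPowerSeries σ := fun j =>
    if j = s then (p s)⁻¹ • coord s else coord j - (p j * (p s)⁻¹) • coord s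
  have ha' : ∀ j, constCoeff (a' j) = 0 := by
    intro j
    dsimp only [a']
    split_ifs <;> simp
  have ha's : substHom a' ha' (coord s) = (p s)⁻¹ • coord s := by
    rw [substHom_coord]
    exact if_pos rfl
  refine ⟨substHom a ha, substHom a' ha', fun g => ?_, ?_⟩
  · refine DFunLike.congr_fun (CurveGerm.hom_ext (φ := (substHom a' ha').comp (substHom a ha))
      (ψ := AlgHom.id ℂ _) fun j => ?_) g
    rw [AlgHom.comp_apply, substHom_coord, AlgHom.id_apply]
    by_cases hj : j = s
    · rw [show a j = p s • coord s from if_pos hj, map_smul, ha's, smul_smul,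
        mul_inv_cancel₀ hps, one_smul, hj]
    · rw [show a j = coord j + p j • coord s from if_neg hj, map_add, map_smul, ha's,
        substHom_coord, show a' j = coord j - (p j * (p s)⁻¹) • coord s from if_neg hj, smul_smul,
        sub_add_cancel]
  · have h1 : line (Pi.single s 1) (substHom a ha f) = line p f := by
      refine DFunLike.congr_fun (CurveGerm.hom_ext
        (φ := (line (Pi.single s 1)).comp (substHom a ha)) (ψ := line p) fun j => ?_) f
      rw [AlgHom.comp_apply, substHom_coord, line_coord]
      by_cases hj : j = s
      · subst hj
        rw [show a j = p j • coord j from if_pos rfl, map_smul, line_coord, Pi.single_eq_same,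
          one_smul]
      · rw [show a j = coord j + p j • coord s from if_neg hj, map_add, map_smul, line_coord,
          line_coord, Pi.single_eq_same, Pi.single_eq_of_ne hj, zero_smul, one_smul, zero_add]
    obtain ⟨n, u, hu, hnu⟩ := exists_eq_ct_pow_mul hp
    refine ⟨n, fun j hj => ?_, ?_⟩
    · rw [cf_single_eq_cf_line, h1, hnu, cf_ct_pow_mul, if_neg (by omega)]
    · rw [cf_single_eq_cf_line, h1, hnu, cf_ct_pow_mul_self]
      exact hu

/-- Modulo `f`, the powers `1, x, …, x ^ (k - 1)` generate `S` over `R`; since `f` dies in `A`,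
finiteness over `S` is finiteness over `S ⧸ (f)`. -/
theorem _root_.AlgHom.Finite.comp_of_division {R S A : Type*} [CommRing R] [CommRing S] [CommRing A]
    [Algebra ℂ R] [Algebra ℂ S] [Algebra ℂ A] (r : R →ₐ[ℂ] S) (x f : S) (k : ℕ)
    (hdiv : ∀ g : S, ∃ (c : ℕ → R) (q : S), g = ∑ i ∈ range k, x ^ i * r (c i) + f * q)
    (π : S →ₐ[ℂ] A) (hπ : π.Finite) (hf : π f = 0) : (π.comp r).Finite := by
  let I : Ideal S := Ideal.span {f}
  let φ : R →ₐ[ℂ] S ⧸ I := (Ideal.Quotient.mkₐ ℂ I).comp r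
  have hφ : φ.Finite := by
    classical
    let _ := φ.toRingHom.toAlgebra
    refine ⟨⟨(range k).image fun i => Ideal.Quotient.mk I (x ^ i), ?_⟩⟩
    rw [eq_top_iff]
    rintro y -
    obtain ⟨g, rfl⟩ := Ideal.Quotient.mk_surjective y
    obtain ⟨c, q, hg⟩ := hdiv g
    have h1 : Ideal.Quotient.mk I g = ∑ i ∈ range k, c i • Ideal.Quotient.mk I (x ^ i) := by
      conv_lhs => rw [hg]
      rw [map_add, Ideal.Quotient.eq_zero_iff_mem.2
        (Ideal.mul_mem_right _ _ (Ideal.mem_span_singleton_self f)), add_zero, map_sum]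
      refine Finset.sum_congr rfl fun i _ => ?_
      rw [map_mul, mul_comm]
      rfl
    rw [h1]
    exact Submodule.sum_mem _ fun i hi => Submodule.smul_mem _ _
      (Submodule.subset_span (mem_coe.2 (mem_image_of_mem _ hi)))
  let ψ : S ⧸ I →ₐ[ℂ] A := Ideal.Quotient.liftₐ I π fun a ha => by
    obtain ⟨b, rfl⟩ := Ideal.mem_span_singleton'.1 ha
    rw [map_mul, hf, mul_zero]
  have hψ : ψ.Finite := by
    refine AlgHom.Finite.of_comp_finite (f := Ideal.Quotient.mkₐ ℂ I) ?_
    rwa [show ψ.comp (Ideal.Quotient.mkₐ ℂ I) = π from Ideal.Quotient.liftₐ_comp I π _]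
  exact hψ.comp hφ

/-- An analytic algebra in which a regular series vanishes is finite over the ring of convergent
power series in the remaining variables. -/
theorem finite_of_regular {τ A : Type*} [Finite τ] [CommRing A] [Algebra ℂ A] (e : τ ↪ σ) (s : σ)
    (he : ∀ i, i ∈ Set.range e ↔ i ≠ s) (k : ℕ) (f : ConvergentPowerSeries σ)
    (hlow : ∀ j < k, cf (Finsupp.single s j) f = 0) (htop : cf (Finsupp.single s k) f ≠ 0)
    (π : ConvergentPowerSeries σ →ₐ[ℂ] A) (hπ : π.Finite)
    (hf : π f = 0) :
    (π.comp (renameHom e)).Finite :=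
  AlgHom.Finite.comp_of_division (renameHom e) (coord s) f k
    (fun g => weierstrass_division e s he k f g hlow htop) π hπ hf

/-- Noether normalization: an analytic algebra is finite over a ring of convergent power series. -/
theorem exists_finite_injective {A : Type*} [CommRing A] [Algebra ℂ A] [Nontrivial A] {N : ℕ}
    (π : ConvergentPowerSeries (Fin N) →ₐ[ℂ] A) (hπ : Function.Surjective π) :
    ∃ (d : ℕ) (j : ConvergentPowerSeries (Fin d) →ₐ[ℂ] A),
      j.Finite ∧ Function.Injective j := by
  classical
  -- The number of variables is least possible. A nonzero series in the kernel, made regular by a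
  -- linear change, would allow one more variable to be eliminated.
  have hex : ∃ d, ∃ j : ConvergentPowerSeries (Fin d) →ₐ[ℂ] A,
      j.Finite :=
    ⟨N, π, AlgHom.Finite.of_surjective _ hπ⟩
  obtain ⟨j, hj⟩ := Nat.find_spec hex
  refine ⟨Nat.find hex, j, hj, ?_⟩
  have hmin := fun m hm => Nat.find_min hex (m := m) hm
  generalize Nat.find hex = d at j hj hmin
  rw [injective_iff_map_eq_zero]
  intro f hf
  by_contra hf0
  rcases d with _ | d
  · obtain ⟨g, hg⟩ := eq_const_add_sum f
    rw [Finset.univ_eq_empty, Finset.sum_empty, add_zero] at hg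
    have h1 : IsUnit f := by
      rw [isUnit_iff]
      intro h0
      rw [h0, map_zero] at hg
      exact hf0 hg
    exact (h1.map j).ne_zero hf
  · obtain ⟨T, T', hTT', k, hlow, htop⟩ := exists_linear_change 0 hf0
    refine hmin d (Nat.lt_succ_self d) ⟨(j.comp T').comp (renameHom (Fin.succEmb d)), ?_⟩
    refine finite_of_regular (Fin.succEmb d) 0 (fun i => ?_) k (T f) hlow htop (j.comp T') ?_ ?_
    · simp [Fin.range_succ]
    · exact hj.comp (AlgHom.Finite.of_surjective T' fun g => ⟨T g, hTT' g⟩)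
    · rw [AlgHom.comp_apply, hTT', hf]

end Noether

/-! ## One-dimensional analytic algebras -/

section DimOne

variable {A : Type*} [CommRing A]

/-- A minimal prime equal to the maximal ideal of a local ring would be the only prime, giving
dimension zero. -/
theorem not_isMaximal_of_mem_minimalPrimes [IsLocalRing A] (hdim : ringKrullDim A = 1)
    {p : Ideal A} (hp : p ∈ minimalPrimes A) : ¬ p.IsMaximal := by
  intro hmax
  have h0 : Ring.KrullDimLE 0 A := by
    rw [Ring.krullDimLE_zero_iff]
    intro I hI
    have h1 : I ≤ p := IsLocalRing.eq_maximalIdeal hmax ▸ IsLocalRing.le_maximalIdeal hI.ne_top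
    rwa [le_antisymm h1 (hp.2 ⟨hI, bot_le⟩ h1)]
  rw [Ring.krullDimLE_iff, hdim] at h0
  exact absurd h0 (by decide)

variable [Algebra ℂ A]

/-- For `d = 0` the base is the field `ℂ`, so every prime of `A` is maximal. For `d ≥ 2` the chain
formed by zero, the kernel of restriction to the first axis and the maximal ideal lifts to `A` by
lying over and going up, which exceeds dimension one. -/
theorem eq_one_of_finite_injective (hdim : ringKrullDim A = 1) {d : ℕ}
    (j : ConvergentPowerSeries (Fin d) →ₐ[ℂ] A)
    (hj : j.Finite) (hinj : Function.Injective j) :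
    d = 1 := by
  let _ : Algebra (ConvergentPowerSeries (Fin d)) A :=
    j.toRingHom.toAlgebra
  have : Module.Finite (ConvergentPowerSeries (Fin d)) A := hj
  have halg : ∀ f, algebraMap (ConvergentPowerSeries (Fin d)) A f = j f := fun _ => rfl
  rcases d with _ | _ | d
  · exfalso
    have h0 : Ring.KrullDimLE 0 A := by
      rw [Ring.krullDimLE_zero_iff]
      intro I hI
      refine Ideal.isMaximal_of_isIntegral_of_isMaximal_comap
        (R := ConvergentPowerSeries (Fin 0)) I ?_
      have h1 : I.comap (algebraMap (ConvergentPowerSeries (Fin 0)) A) = ⊥ := by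
        rw [eq_bot_iff]
        intro f hf
        by_contra hf0
        obtain ⟨g, hg⟩ := eq_const_add_sum f
        rw [Finset.univ_eq_empty, Finset.sum_empty, add_zero] at hg
        have h1 : IsUnit f := by
          rw [isUnit_iff]
          intro h0
          rw [h0, map_zero] at hg
          exact hf0 hg
        exact hI.ne_top (Ideal.eq_top_of_isUnit_mem _ hf (h1.map _))
      rw [h1]
      refine ⟨⟨bot_ne_top, fun J hJ => ?_⟩⟩
      obtain ⟨f, hf, hf0⟩ := SetLike.exists_of_lt hJ
      obtain ⟨g, hg⟩ := eq_const_add_sum f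
      rw [Finset.univ_eq_empty, Finset.sum_empty, add_zero] at hg
      refine Ideal.eq_top_of_isUnit_mem _ hf ?_
      rw [isUnit_iff]
      intro h0
      rw [h0, map_zero] at hg
      exact hf0 hg
    rw [Ring.krullDimLE_iff, hdim] at h0
    exact absurd h0 (by decide)
  · rfl
  · exfalso
    have h1 : Ring.KrullDimLE 1 A := by
      rw [Ring.krullDimLE_iff, hdim]
      rfl
    rw [Ring.krullDimLE_one_iff] at h1
    let R := ConvergentPowerSeries (Fin (d + 2))
    let L : R →ₐ[ℂ] Ct := line (Pi.single 0 1)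
    let p₁ : Ideal R := RingHom.ker L
    have hp₁ : p₁.IsPrime := RingHom.ker_isPrime _
    have hc1 : (coord 1 : R) ∈ p₁ := by
      rw [RingHom.mem_ker, line_coord, Pi.single_eq_of_ne (by simp), zero_smul]
    have hc0 : (coord 0 : R) ∉ p₁ := by
      rw [RingHom.mem_ker, line_coord, Pi.single_eq_same, one_smul]
      exact ct_ne_zero
    have hc1' : (coord 1 : R) ≠ 0 := by
      intro h
      have := congrArg (line (Pi.single 1 1)) h
      rw [line_coord, Pi.single_eq_same, one_smul, map_zero] at this
      exact ct_ne_zero this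
    have hc0' : (coord 0 : R) ∈ IsLocalRing.maximalIdeal R := by
      rw [IsLocalRing.mem_maximalIdeal, mem_nonunits_iff, isUnit_iff, constCoeff_coord]
      simp
    have hker : (⊥ : Ideal A).comap (algebraMap R A) = ⊥ := by
      rw [← RingHom.ker_eq_comap_bot]
      exact (RingHom.injective_iff_ker_eq_bot _).1 hinj
    have hbot : (⊥ : Ideal R).IsPrime := Ideal.isPrime_bot
    obtain ⟨Q₀, -, hQ₀, hQ₀c⟩ := Ideal.exists_ideal_over_prime_of_isIntegral (⊥ : Ideal R)
      (⊥ : Ideal A) hker.le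
    obtain ⟨Q₁, hQ01, hQ₁, hQ₁c⟩ := Ideal.exists_ideal_over_prime_of_isIntegral p₁ Q₀
      (by rw [hQ₀c]; exact bot_le)
    obtain ⟨Q₂, hQ12, hQ₂, hQ₂c⟩ := Ideal.exists_ideal_over_prime_of_isIntegral
      (IsLocalRing.maximalIdeal R) Q₁ (by rw [hQ₁c]; exact IsLocalRing.le_maximalIdeal hp₁.ne_top)
    rcases h1 Q₁ hQ₁ with h2 | h2
    · have h3 := h2.2 ⟨hQ₀, bot_le⟩ hQ01
      have h4 : coord 1 ∈ Q₀.comap (algebraMap R A) :=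
        h3 (show coord 1 ∈ Q₁.comap (algebraMap R A) by rw [hQ₁c]; exact hc1)
      rw [hQ₀c] at h4
      exact hc1' h4
    · have h3 := h2.eq_of_le hQ₂.ne_top hQ12
      rw [← h3, hQ₁c] at hQ₂c
      exact hc0 (hQ₂c ▸ hc0')

/-- A one-dimensional analytic algebra is finite over `ℂ{z}`. -/
theorem exists_finite_injective_ct [Nontrivial A] (hdim : ringKrullDim A = 1) {N : ℕ}
    (π : ConvergentPowerSeries (Fin N) →ₐ[ℂ] A) (hπ : Function.Surjective π) :
    ∃ j : Ct →ₐ[ℂ] A, j.Finite ∧ Function.Injective j := by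
  obtain ⟨d, j, hj, hinj⟩ := exists_finite_injective π hπ
  obtain rfl := eq_one_of_finite_injective hdim j hj hinj
  let r : Ct →ₐ[ℂ] ConvergentPowerSeries (Fin 1) := renameHom fun _ => 0
  let r' : ConvergentPowerSeries (Fin 1) →ₐ[ℂ] Ct := renameHom fun _ => ()
  have h1 : ∀ f, r (r' f) = f := fun f =>
    DFunLike.congr_fun (CurveGerm.hom_ext (φ := r.comp r') (ψ := AlgHom.id ℂ _) fun i => by
      simp [r, r', Subsingleton.elim i 0]) f
  refine ⟨j.comp r, hj.comp (AlgHom.Finite.of_surjective r fun f => ⟨r' f, h1 f⟩), ?_⟩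
  refine hinj.comp (Ct.map_injective r ?_)
  intro h
  have := congrArg r' h
  simp only [r, r', ct, renameHom_coord, map_zero] at this
  exact ct_ne_zero this

end DimOne

/-! ## Models: germs inside a product of rings of convergent power series -/

/-- A parametrization of a curve germ: an embedding of its local algebra in a finite product of
rings `ℂ{t}` whose image contains a power of the Jacobson radical. -/
structure IsModel {O : Type*} [CommRing O] [Algebra ℂ O] {ι : Type*} (θ : O →ₐ[ℂ] (ι → Ct)) :
    Prop where
  injective : Function.Injective θ
  conductor : ∃ N : ℕ, ∀ g : ι → Ct, ∃ f : O, θ f = fun i => ct ^ N * g i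

/-- The normalization theorem: a reduced curve germ has a parametrization. -/
theorem IsReducedCurveGerm.exists_model {O : Type u} [CommRing O] [Algebra ℂ O]
    (hO : IsReducedCurveGerm O) :
    IsLocalRing O ∧ ∃ (ι : Type u) (_ : Finite ι) (θ : O →ₐ[ℂ] (ι → Ct)), IsModel θ := by
  classical
  obtain ⟨N, π, hπ⟩ := hO.exists_presentation
  have hdim := hO.krullDim_eq_one
  have hred := hO.isReduced
  have : Nontrivial O := by
    rw [← not_subsingleton_iff_nontrivial]
    intro h
    rw [ringKrullDim_eq_bot_of_subsingleton] at hdim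
    exact absurd hdim (by decide)
  have hloc : IsLocalRing O := IsLocalRing.of_surjective' (π : ConvergentPowerSeries (Fin N) →+* O) hπ
  refine ⟨hloc, ?_⟩
  obtain ⟨j, hj, hinj⟩ := exists_finite_injective_ct hdim π hπ
  have hnoeth : IsNoetherianRing O := by
    let _ : Algebra Ct O := j.toRingHom.toAlgebra
    have : Module.Finite Ct O := hj
    exact IsNoetherianRing.of_finite Ct O
  have hfinite : Finite (minimalPrimes O) := (minimalPrimes.finite_of_isNoetherianRing O).to_subtype
  have hpar : ∀ p : minimalPrimes O, ∃ φ : O →ₐ[ℂ] Ct, (∀ x, φ x = 0 ↔ x ∈ (p : Ideal O)) ∧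
      ∃ N : ℕ, ∀ g : Ct, ∃ b : O, φ b = ct ^ N * g := by
    rintro ⟨p, hp⟩
    have hpp : p.IsPrime := hp.1.1
    let jp : Ct →ₐ[ℂ] O ⧸ p := (Ideal.Quotient.mkₐ ℂ p).comp j
    have hjp : jp.Finite :=
      (AlgHom.Finite.of_surjective (Ideal.Quotient.mkₐ ℂ p) Ideal.Quotient.mk_surjective).comp hj
    have hjpi : Function.Injective jp := by
      have hker : RingHom.ker jp = p.comap (j : Ct →+* O) := by
        ext f
        rw [RingHom.mem_ker, Ideal.mem_comap, ← Ideal.Quotient.eq_zero_iff_mem]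
        rfl
      rw [RingHom.injective_iff_ker_eq_bot, hker]
      -- A nonzero prime of the discrete valuation ring `ℂ{z}` is maximal, and then so is `p` by
      -- integrality, which the dimension forbids.
      by_contra hne
      have hmax : (p.comap (j : Ct →+* O)).IsMaximal :=
        IsPrime.to_maximal_ideal (hpi := Ideal.comap_isPrime _ _) hne
      let _ : Algebra Ct O := j.toRingHom.toAlgebra
      have : Module.Finite Ct O := hj
      exact not_isMaximal_of_mem_minimalPrimes hdim hp
        (Ideal.isMaximal_of_isIntegral_of_isMaximal_comap (R := Ct) p hmax)
    obtain ⟨φ, hφ, M, hM⟩ := exists_parametrization jp hjpi hjp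
    refine ⟨φ.comp (Ideal.Quotient.mkₐ ℂ p), fun x => ?_, M, fun g => ?_⟩
    · rw [AlgHom.comp_apply, map_eq_zero_iff φ hφ]
      exact Ideal.Quotient.eq_zero_iff_mem
    · obtain ⟨b, hb⟩ := hM g
      obtain ⟨x, rfl⟩ := Ideal.Quotient.mk_surjective b
      exact ⟨x, hb⟩
  choose φ hφ M hM using hpar
  refine ⟨minimalPrimes O, hfinite, AlgHom.pi φ, ?_, ?_⟩
  · rw [injective_iff_map_eq_zero]
    intro x hx
    have h1 : x ∈ sInf (minimalPrimes O) := by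
      rw [Submodule.mem_sInf]
      intro p hp
      exact (hφ ⟨p, hp⟩ x).1 (congrFun hx ⟨p, hp⟩)
    rw [show sInf (minimalPrimes O) = nilradical O from Ideal.sInf_minimalPrimes,
      nilradical_eq_zero] at h1
    exact h1
  · have := Fintype.ofFinite (minimalPrimes O)
    -- Prime avoidance for the finitely many minimal primes: a function nonzero on one branch and
    -- vanishing on all others. It serves to glue the conductors of the branches.
    have hsep : ∀ p : minimalPrimes O, ∃ d : O, φ p d ≠ 0 ∧ ∀ q, q ≠ p → φ q d = 0 := by
      intro p
      have hpp : (p : Ideal O).IsPrime := p.2.1.1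
      have h1 : ¬ (∏ q ∈ univ.erase p, (q : Ideal O)) ≤ p := by
        rw [hpp.prod_le]
        rintro ⟨q, hq, hqp⟩
        refine ne_of_mem_erase hq (Subtype.ext (le_antisymm hqp ?_))
        exact p.2.2 q.2.1 hqp
      obtain ⟨d, hd, hdp⟩ := SetLike.not_le_iff_exists.1 h1
      refine ⟨d, fun h => hdp ((hφ p d).1 h), fun q hq => (hφ q d).2 ?_⟩
      exact (Ideal.prod_le_inf.trans (Finset.inf_le (mem_erase.2 ⟨hq, mem_univ q⟩))) hd
    choose d hd hd' using hsep
    choose n u hu hnu using fun p => exists_eq_ct_pow_mul (hd p)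
    let K := ∑ p, (M p + n p)
    refine ⟨K, fun g => ?_⟩
    have hcomp : ∀ p, ∃ b, φ p (d p * b) = ct ^ K * g p := by
      intro p
      obtain ⟨v, hv⟩ := isUnit_of_constCoeff (hu p)
      have hK : M p + n p ≤ K := Finset.single_le_sum (f := fun p => M p + n p)
        (fun _ _ => Nat.zero_le _) (mem_univ p)
      obtain ⟨b, hb⟩ := hM p (ct ^ (K - (M p + n p)) * (((v⁻¹ : Ctˣ) : Ct) * g p))
      refine ⟨b, ?_⟩
      rw [map_mul, hb, hnu p, ← hv]
      calc _ = ct ^ (M p + n p + (K - (M p + n p))) * (v * (((v⁻¹ : Ctˣ) : Ct) * g p)) := by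
            rw [pow_add, pow_add]; ring
        _ = _ := by rw [Nat.add_sub_cancel' hK, Units.mul_inv_cancel_left]
    choose b hb using hcomp
    refine ⟨∑ p, d p * b p, funext fun q => ?_⟩
    rw [AlgHom.pi_apply, map_sum, Finset.sum_eq_single q, hb]
    · intro p _ hpq
      rw [map_mul, hd' p q hpq.symm, zero_mul]
    · simp

/-! ## The normalization of a parametrized germ -/

section Model

variable {O : Type u} [CommRing O] [Algebra ℂ O] {ι : Type v}
  {θ : O →ₐ[ℂ] (ι → Ct)}

theorem IsModel.conductor_of_le (h : IsModel θ) :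
    ∃ N : ℕ, ∀ M, N ≤ M → ∀ g : ι → Ct, ∃ f : O, θ f = fun i => ct ^ M * g i := by
  obtain ⟨N, hN⟩ := h.conductor
  refine ⟨N, fun M hM g => ?_⟩
  obtain ⟨f, hf⟩ := hN fun i => ct ^ (M - N) * g i
  refine ⟨f, hf.trans (funext fun i => ?_)⟩
  rw [← mul_assoc, ← pow_add, Nat.add_sub_cancel' hM]

/-- A function vanishing on branch `i` is annihilated by the conductor element supported on that
branch alone. -/
theorem IsModel.mem_nonZeroDivisors_iff (h : IsModel θ) (b : O) :
    b ∈ nonZeroDivisors O ↔ ∀ i, θ b i ≠ 0 := by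
  classical
  constructor
  · intro hb i hi
    obtain ⟨N, hN⟩ := h.conductor
    obtain ⟨f, hf⟩ := hN (Pi.single i 1)
    have h1 : f * b = 0 := by
      apply h.injective
      rw [map_mul, hf, map_zero]
      funext j
      by_cases hj : j = i
      · subst hj; simp [hi]
      · simp [Pi.single_eq_of_ne hj]
    have h2 := (_root_.mem_nonZeroDivisors_iff.1 hb).2 f h1
    rw [h2, map_zero] at hf
    have h3 := congrFun hf i
    rw [Pi.single_eq_same, mul_one] at h3
    exact pow_ne_zero N ct_ne_zero h3.symm
  · intro hb
    have key : ∀ x, x * b = 0 → x = 0 := by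
      intro x hx
      apply h.injective
      rw [map_zero]
      funext i
      have h1 := congrFun ((map_mul θ x b).symm.trans (congrArg θ hx)) i
      rw [map_zero, Pi.mul_apply, Pi.zero_apply] at h1
      exact (mul_eq_zero.1 h1).resolve_right (hb i)
    exact _root_.mem_nonZeroDivisors_iff.2 ⟨fun x hx => key x (by rwa [mul_comm]), key⟩

/-- The total ring of fractions of a parametrized germ, as an algebra over its local algebra. -/
abbrev fractionAlgebra (θ : O →ₐ[ℂ] (ι → Ct)) : Algebra O (ι → FractionRing Ct) :=
  (((algebraMap Ct (FractionRing Ct)).compLeft ι).comp (θ : O →+* (ι → Ct))).toAlgebra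

/-- Numerators and denominators chosen branch by branch become elements of `O` after both are
multiplied by `t ^ N`. -/
theorem IsModel.isLocalization (h : IsModel θ) :
    let _ := fractionAlgebra θ
    IsLocalization (nonZeroDivisors O) (ι → FractionRing Ct) := by
  intro _
  have halg : ∀ f i, algebraMap O (ι → FractionRing Ct) f i = algebraMap Ct _ (θ f i) :=
    fun _ _ => rfl
  have hinj := IsFractionRing.injective Ct (FractionRing Ct)
  refine (isLocalization_iff _ _).2 ⟨fun b => ?_, fun z => ?_, fun {x y} hxy => ?_⟩
  · rw [Pi.isUnit_iff]
    intro i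
    rw [halg, isUnit_iff_ne_zero]
    exact fun h0 => (h.mem_nonZeroDivisors_iff b).1 b.2 i
      (hinj (h0.trans (map_zero _).symm))
  · have hz : ∀ i, ∃ p : Ct × Ct, p.2 ≠ 0 ∧
        z i * algebraMap Ct (FractionRing Ct) p.2 = algebraMap Ct (FractionRing Ct) p.1 := by
      intro i
      obtain ⟨⟨a, s⟩, hs⟩ := IsLocalization.surj (nonZeroDivisors Ct) (z i)
      exact ⟨(a, s), nonZeroDivisors.coe_ne_zero s, hs⟩
    choose p hp hz using hz
    obtain ⟨N, hN⟩ := h.conductor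
    obtain ⟨a, ha⟩ := hN fun i => (p i).1
    obtain ⟨s, hs⟩ := hN fun i => (p i).2
    refine ⟨(a, ⟨s, (h.mem_nonZeroDivisors_iff s).2 fun i => ?_⟩), funext fun i => ?_⟩
    · rw [hs]
      exact mul_ne_zero (pow_ne_zero _ ct_ne_zero) (hp i)
    · rw [Pi.mul_apply, halg, halg, ha, hs, map_mul, map_mul, ← hz i]
      ring
  · refine ⟨1, ?_⟩
    have : x = y := h.injective (funext fun i => hinj (congrFun hxy i))
    rw [this]

/-- A tuple splits as constants plus a multiple of `t`. The idempotents are roots of `X ^ 2 - X`, so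
tuples of constants are integral, and a high power of a multiple of `t` lies in the conductor, hence
in `O`. -/
theorem IsModel.isIntegralElem [Finite ι] (h : IsModel θ) (g : ι → Ct) :
    (θ : O →+* (ι → Ct)).IsIntegralElem g := by
  classical
  have := Fintype.ofFinite ι
  let _ : Algebra O (ι → Ct) := (θ : O →+* (ι → Ct)).toAlgebra
  have halg : ∀ f, algebraMap O (ι → Ct) f = θ f := fun _ => rfl
  change IsIntegral O g
  obtain ⟨N, hN⟩ := h.conductor_of_le
  have hidem : ∀ i, IsIntegral O (Pi.single i 1 : ι → Ct) := by
    intro i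
    refine ⟨Polynomial.X ^ 2 - Polynomial.X, ?_, ?_⟩
    · exact Polynomial.monic_X_pow_sub (Polynomial.degree_X_le.trans_lt (by norm_num))
    · rw [Polynomial.eval₂_sub, Polynomial.eval₂_X_pow, Polynomial.eval₂_X, sq,
        ← Pi.single_mul, one_mul, sub_self]
  have hconst : ∀ c : ι → ℂ, IsIntegral O (fun i => algebraMap ℂ Ct (c i)) := by
    intro c
    have h1 : (fun i => algebraMap ℂ Ct (c i)) =
        ∑ i, algebraMap O (ι → Ct) (algebraMap ℂ O (c i)) * Pi.single i 1 := by
      funext j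
      rw [Finset.sum_apply, Finset.sum_eq_single j]
      · rw [Pi.mul_apply, Pi.single_eq_same, mul_one, halg, AlgHom.commutes]
        rfl
      · intro i _ hij
        rw [Pi.mul_apply, Pi.single_eq_of_ne hij.symm, mul_zero]
      · simp
    rw [h1]
    exact IsIntegral.sum _ fun i _ => isIntegral_algebraMap.mul (hidem i)
  have hdvd : ∀ i, ct ∣ g i - algebraMap ℂ Ct (constCoeff (g i)) := by
    intro i
    rw [ct_dvd_iff, map_sub, AlgHom.commutes]
    simp
  choose q hq using hdvd
  have h2 : IsIntegral O fun i => ct * q i := by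
    refine IsIntegral.of_pow (n := N + 1) (Nat.succ_pos N) ?_
    obtain ⟨f, hf⟩ := hN (N + 1) (Nat.le_succ N) fun i => q i ^ (N + 1)
    have h3 : (fun i => ct * q i) ^ (N + 1) = algebraMap O (ι → Ct) f := by
      rw [halg, hf]
      funext i
      rw [Pi.pow_apply, mul_pow]
    rw [h3]
    exact isIntegral_algebraMap
  have h3 : g = (fun i => algebraMap ℂ Ct (constCoeff (g i))) + fun i => ct * q i := by
    funext i
    rw [Pi.add_apply, ← hq i, add_sub_cancel]
  rw [h3]
  exact (hconst _).add h2

/-- The normalization of a parametrized germ is the product of rings `ℂ{t}`. -/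
theorem IsModel.exists_normalization_equiv [Finite ι] (h : IsModel θ) :
    ∃ e : Normalization O ≃ₐ[ℂ] (ι → Ct), ∀ f, e (algebraMap O (Normalization O) f) = θ f := by
  let _ : Algebra O (ι → FractionRing Ct) := fractionAlgebra θ
  let _ : Algebra O (ι → Ct) := (θ : O →+* (ι → Ct)).toAlgebra
  let _ : Algebra (ι → Ct) (ι → FractionRing Ct) :=
    ((algebraMap Ct (FractionRing Ct)).compLeft ι).toAlgebra
  have : @IsScalarTower O (ι → Ct) (ι → FractionRing Ct) Algebra.toSMul Algebra.toSMul
      Algebra.toSMul := IsScalarTower.of_algebraMap_eq' rfl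
  have hloc : IsLocalization (nonZeroDivisors O) (ι → FractionRing Ct) := h.isLocalization
  have hinj := IsFractionRing.injective Ct (FractionRing Ct)
  have hic : IsIntegralClosure (ι → Ct) O (ι → FractionRing Ct) := by
    refine ⟨fun a b hab => funext fun i => hinj (congrFun hab i), fun {x} => ⟨?_, ?_⟩⟩
    · rintro ⟨p, hp, hpx⟩
      have hi : ∀ i, ∃ y : Ct, algebraMap Ct (FractionRing Ct) y = x i := by
        intro i
        refine IsIntegrallyClosed.algebraMap_eq_of_integral
          ⟨p.map ((Pi.evalRingHom (fun _ : ι => Ct) i).comp (θ : O →+* (ι → Ct))),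
            hp.map _, ?_⟩
        rw [Polynomial.eval₂_map]
        have h1 := congrArg (Pi.evalRingHom (fun _ : ι => FractionRing Ct) i) hpx
        rw [Polynomial.hom_eval₂, map_zero] at h1
        exact h1
      choose y hy using hi
      exact ⟨y, funext hy⟩
    · rintro ⟨y, rfl⟩
      exact IsIntegral.algebraMap (h.isIntegralElem y)
  let e₁ : FractionRing O ≃ₐ[O] (ι → FractionRing Ct) :=
    IsLocalization.algEquiv (nonZeroDivisors O) _ _
  let e₂ : Normalization O ≃ₐ[O] (ι → Ct) := e₁.mapIntegralClosure.trans
    (IsIntegralClosure.equiv O (integralClosure O (ι → FractionRing Ct)) (ι → FractionRing Ct)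
      (ι → Ct))
  have he₂ : ∀ f, e₂ (algebraMap O (Normalization O) f) = θ f := fun f => e₂.commutes f
  refine ⟨AlgEquiv.ofRingEquiv (f := e₂.toRingEquiv) fun c => ?_, he₂⟩
  rw [IsScalarTower.algebraMap_apply ℂ O (Normalization O)]
  exact (he₂ _).trans (θ.commutes c)

end Model

/-! ## Maximal ideals of a product of rings of convergent power series -/

section Product

variable (ι : Type v)

/-- The maximal ideal of `∏ ℂ{t}` at the point `i`. -/
def pointIdeal {ι : Type v} (i : ι) : Ideal (ι → Ct) :=
  (IsLocalRing.maximalIdeal Ct).comap (Pi.evalRingHom (fun _ : ι => Ct) i)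

variable {ι}

theorem mem_pointIdeal (i : ι) (f : ι → Ct) : f ∈ pointIdeal i ↔ ct ∣ f i := by
  rw [pointIdeal, Ideal.mem_comap, IsLocalRing.mem_maximalIdeal, mem_nonunits_iff, isUnit_iff,
    not_not, ← ct_dvd_iff]
  rfl

theorem pointIdeal_isMaximal (i : ι) : (pointIdeal i).IsMaximal :=
  Ideal.comap_isMaximal_of_surjective _ (Function.surjective_eval i)

/-- The ideal is principal, generated by the tuple with `t` at `i` and `1` elsewhere. -/
theorem mem_pointIdeal_pow (i : ι) (k : ℕ) (f : ι → Ct) :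
    f ∈ pointIdeal i ^ k ↔ ct ^ k ∣ f i := by
  classical
  have hdvd : ∀ (a : Ct) (f : ι → Ct), Function.update (1 : ι → Ct) i a ∣ f ↔ a ∣ f i := by
    intro a f
    constructor
    · rintro ⟨g, rfl⟩
      rw [Pi.mul_apply, Function.update_self]
      exact dvd_mul_right _ _
    · rintro ⟨g, hg⟩
      refine ⟨Function.update f i g, funext fun j => ?_⟩
      by_cases hj : j = i
      · subst hj; simp [hg]
      · simp [Function.update_of_ne hj]
  have h1 : pointIdeal i = Ideal.span {Function.update (1 : ι → Ct) i ct} := by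
    ext f
    rw [mem_pointIdeal, Ideal.mem_span_singleton, hdvd]
  have h2 : Function.update (1 : ι → Ct) i ct ^ k = Function.update (1 : ι → Ct) i (ct ^ k) := by
    funext j
    by_cases hj : j = i
    · subst hj; simp
    · simp [Function.update_of_ne hj]
  rw [h1, Ideal.span_singleton_pow, Ideal.mem_span_singleton, h2, hdvd]

theorem pointIdeal_injective : Function.Injective (pointIdeal : ι → Ideal (ι → Ct)) := by
  classical
  intro i j hij
  by_contra hne
  have h1 : (Pi.single j 1 : ι → Ct) ∈ pointIdeal i := by
    rw [mem_pointIdeal, Pi.single_eq_of_ne hne]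
    exact dvd_zero _
  rw [hij, mem_pointIdeal, Pi.single_eq_same] at h1
  exact prime_ct.not_dvd_one h1

/-- The idempotents add up to `1`, so one of them lies outside `M`; an element of `M` invertible at
that point would put it inside. -/
theorem exists_eq_pointIdeal [Finite ι] (M : Ideal (ι → Ct)) (hM : M.IsMaximal) :
    ∃ i, pointIdeal i = M := by
  classical
  have := Fintype.ofFinite ι
  obtain ⟨i, hi⟩ : ∃ i, (Pi.single i 1 : ι → Ct) ∉ M := by
    by_contra! h
    refine hM.ne_top ((Ideal.eq_top_iff_one M).2 ?_)
    rw [← Finset.univ_sum_single (1 : ι → Ct)]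
    exact M.sum_mem fun i _ => h i
  refine ⟨i, (hM.eq_of_le (pointIdeal_isMaximal i).ne_top fun f hf => ?_).symm⟩
  rw [mem_pointIdeal, ct_dvd_iff]
  by_contra hc
  obtain ⟨v, hv⟩ := isUnit_of_constCoeff hc
  refine hi ?_
  have h1 : (Pi.single i 1 : ι → Ct) = Pi.single i ((v⁻¹ : Ctˣ) : Ct) * f := by
    funext j
    by_cases hj : j = i
    · subst hj
      rw [Pi.mul_apply, Pi.single_eq_same, Pi.single_eq_same, ← hv, Units.inv_mul]
    · simp [Pi.single_eq_of_ne hj]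
  rw [h1]
  exact M.mul_mem_left _ hf

end Product

section Branches

variable {O : Type u} [CommRing O] [Algebra ℂ O] {ι : Type v} [Finite ι]
  {θ : O →ₐ[ℂ] (ι → Ct)}

/-- The branches of a parametrized germ and the orders of vanishing along them. -/
theorem IsModel.exists_branch_equiv (h : IsModel θ) :
    ∃ b : ι ≃ Branch O, ∀ i k f,
      algebraMap O (Normalization O) f ∈ (b i).asIdeal ^ k ↔ ct ^ k ∣ θ f i := by
  obtain ⟨e, he⟩ := h.exists_normalization_equiv
  let E : Normalization O ≃+* (ι → Ct) := e.toRingEquiv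
  have hmax : ∀ i, ((pointIdeal i).comap E).IsMaximal := fun i =>
    have := pointIdeal_isMaximal i
    Ideal.comap_isMaximal_of_surjective E E.surjective
  let b : ι → Branch O := fun i => ⟨(pointIdeal i).comap E, hmax i⟩
  have hb : Function.Bijective b := by
    constructor
    · intro i j hij
      have h1 : (pointIdeal i).comap E = (pointIdeal j).comap E := congrArg (·.asIdeal) hij
      exact pointIdeal_injective (Ideal.comap_injective_of_surjective E E.surjective h1)
    · rintro ⟨M, hM⟩
      have := hM
      obtain ⟨i, hi⟩ := exists_eq_pointIdeal (M.comap E.symm)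
        (Ideal.comap_isMaximal_of_surjective E.symm E.symm.surjective)
      refine ⟨i, MaximalSpectrum.ext ?_⟩
      change (pointIdeal i).comap E = M
      rw [hi]
      ext x
      simp [Ideal.mem_comap]
  refine ⟨Equiv.ofBijective b hb, fun i k f => ?_⟩
  change _ ∈ ((pointIdeal i).comap E) ^ k ↔ _
  rw [← Ideal.map_symm, ← Ideal.map_pow, Ideal.map_symm, Ideal.mem_comap, mem_pointIdeal_pow]
  rw [show E (algebraMap O (Normalization O) f) = θ f from he f]

end Branches

/-! ## The first relative homology at an isolated lowest vertex -/

section Homology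

variable {κ : Type u}

theorem boundary_single (c : Cube κ) : boundary (Finsupp.single c 1) = cubeBoundary c := by
  rw [boundary, Finsupp.lift_apply, Finsupp.sum_single_index (by simp), one_smul]

@[simp]
theorem shift_empty (l : κ → ℕ) : shift l ∅ = l := by
  funext i
  simp [shift]

open Classical in
theorem shift_shift_singleton (l : κ → ℕ) {i j : κ} (h : i ≠ j) :
    shift (shift l {i}) {j} = shift l {i, j} := by
  funext k
  by_cases hi : k = i
  · subst hi; simp [shift, h]
  · by_cases hj : k = j
    · subst hj; simp [shift, hi]
    · simp [shift, hi, hj]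

theorem cubeBoundary_singleton (l : κ → ℕ) (i : κ) :
    cubeBoundary (l, {i}) = Finsupp.single (shift l {i}, ∅) 1 - Finsupp.single (l, ∅) 1 := by
  classical
  rw [cubeBoundary, Finset.sum_singleton]
  have h : ¬ WellOrderingRel i i := irrefl_of WellOrderingRel i
  simp [h, Finset.filter_singleton]

open Classical in
theorem cubeBoundary_pair (l : κ → ℕ) {i j : κ} (hij : i ≠ j) :
    ∃ ε : ℤ, ε * ε = 1 ∧ cubeBoundary (l, {i, j}) =
      ε • ((Finsupp.single (shift l {i}, {j}) 1 - Finsupp.single (l, {j}) 1) -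
        (Finsupp.single (shift l {j}, {i}) 1 - Finsupp.single (l, {i}) 1)) := by
  have h : ∀ k : κ, ¬ WellOrderingRel k k := irrefl_of WellOrderingRel
  have e1 : ({i, j} : Finset κ).erase i = {j} := by
    rw [Finset.erase_insert]; simpa using hij
  have e2 : ({i, j} : Finset κ).erase j = {i} := by
    rw [Finset.pair_comm, Finset.erase_insert]; simpa using hij.symm
  rcases trichotomous_of WellOrderingRel i j with hr | hr | hr
  · have hn : ¬ WellOrderingRel j i := asymm_of _ hr
    refine ⟨1, rfl, ?_⟩
    rw [cubeBoundary, Finset.sum_pair hij]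
    simp only [e1, e2, Finset.filter_insert, Finset.filter_singleton, h, hr, hn, if_true, if_false,
      card_empty, card_singleton, insert_empty_eq, pow_zero, pow_one, one_smul, neg_one_smul,
      sub_eq_add_neg]
  · exact absurd hr hij
  · have hn : ¬ WellOrderingRel i j := asymm_of _ hr
    refine ⟨-1, rfl, ?_⟩
    rw [cubeBoundary, Finset.sum_pair hij]
    simp only [e1, e2, Finset.filter_insert, Finset.filter_singleton, h, hr, hn, if_true, if_false,
      card_empty, card_singleton, pow_zero, pow_one, one_smul, neg_one_smul]
    abel

theorem mem_fullCubes_singleton {V : Set (κ → ℕ)} {l : κ → ℕ} {i : κ} :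
    (l, {i}) ∈ fullCubes V 1 ↔ l ∈ V ∧ shift l {i} ∈ V := by
  constructor
  · rintro ⟨-, h⟩
    exact ⟨by simpa using h ∅ (empty_subset _), h {i} Subset.rfl⟩
  · rintro ⟨h1, h2⟩
    refine ⟨card_singleton i, fun J hJ => ?_⟩
    rcases Finset.subset_singleton_iff.1 hJ with rfl | rfl
    · simpa using h1
    · exact h2

theorem single_mem_chains {V : Set (κ → ℕ)} {k : ℕ} {c : Cube κ} (hc : c ∈ fullCubes V k) :
    Finsupp.single c (1 : ℤ) ∈ chains V k := Finsupp.single_mem_supported ℤ 1 hc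

theorem chains_induction {V : Set (κ → ℕ)} {k : ℕ} {P : Submodule ℤ (Cube κ →₀ ℤ)}
    (h : ∀ c ∈ fullCubes V k, Finsupp.single c (1 : ℤ) ∈ P) : chains V k ≤ P := by
  rw [chains, Finsupp.supported_eq_span_single, Submodule.span_le]
  rintro _ ⟨c, hc, rfl⟩
  exact h c hc

variable {V W : Set (κ → ℕ)} {m : κ → ℕ} {R : κ → κ → Prop}

-- The cycle is the difference of the edges at `m` in the directions `i` and `j`. It is detected by
-- the functional counting edges at `m` with direction in the class of `i`: squares at `m` join
-- equivalent directions, no square has `m` as another vertex of its edges away from the base, and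
-- chains in `W` avoid `m`.
open Classical in
theorem exists_relCycle_not_relBoundary (hR : Equivalence R) (hmW : m ∉ W) (hV : V = insert m W)
    (hlow : ∀ l ∈ V, ∀ i, shift l {i} ≠ m) (hup : ∀ i, shift m {i} ∈ W)
    (hpair : ∀ i j, i ≠ j → (shift m {i, j} ∈ W ↔ R i j)) {i j : κ} (hij : ¬ R i j) :
    ∃ c ∈ relCycles V W 1, c ∉ relBoundaries V W 1 := by
  have hWV : W ⊆ V := hV ▸ Set.subset_insert m W
  have hmV : m ∈ V := hV ▸ Set.mem_insert m W
  refine ⟨Finsupp.single (m, {i}) 1 - Finsupp.single (m, {j}) 1, ⟨?_, ?_⟩, ?_⟩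
  · exact Submodule.sub_mem _
      (single_mem_chains (mem_fullCubes_singleton.2 ⟨hmV, hWV (hup i)⟩))
      (single_mem_chains (mem_fullCubes_singleton.2 ⟨hmV, hWV (hup j)⟩))
  · change boundary _ ∈ chains W 0
    have h0 : ∀ k, ((shift m {k}, ∅) : Cube κ) ∈ fullCubes W 0 := by
      intro k
      refine ⟨card_empty, fun J hJ => ?_⟩
      rw [Finset.subset_empty.1 hJ, shift_empty]
      exact hup k
    rw [map_sub, boundary_single, boundary_single, cubeBoundary_singleton, cubeBoundary_singleton,
      sub_sub_sub_cancel_right]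
    exact Submodule.sub_mem _ (single_mem_chains (h0 i)) (single_mem_chains (h0 j))
  · intro hmem
    let χ : Cube κ → ℤ := fun c => if c.1 = m ∧ ∃ k, c.2 = {k} ∧ R i k then 1 else 0
    let Φ : (Cube κ →₀ ℤ) →ₗ[ℤ] ℤ := Finsupp.lift ℤ ℤ (Cube κ) χ
    have hΦ : ∀ c, Φ (Finsupp.single c 1) = χ c := by
      intro c
      simp only [Φ]
      rw [Finsupp.lift_apply, Finsupp.sum_single_index (by simp), one_smul]
    have hχ : ∀ k, χ (m, {k}) = if R i k then 1 else 0 := by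
      intro k
      simp only [χ, Finset.singleton_inj, true_and]
      congr 1
      simp
    have hχ0 : ∀ l I, l ≠ m → χ (l, I) = 0 := fun l I hl => if_neg fun h => hl h.1
    have hle : relBoundaries V W 1 ≤ LinearMap.ker Φ := by
      refine sup_le ?_ (chains_induction ?_)
      · rw [Submodule.map_le_iff_le_comap]
        refine chains_induction ?_
        rintro ⟨l, I⟩ ⟨hI, hJ⟩
        change Φ (boundary _) = 0
        obtain ⟨a, b, hab, rfl⟩ := Finset.card_eq_two.1 hI
        obtain ⟨ε, -, hε⟩ := cubeBoundary_pair l hab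
        have hl : l ∈ V := by simpa using hJ ∅ (empty_subset _)
        rw [boundary_single, hε, map_smul, map_sub, map_sub, map_sub, hΦ, hΦ, hΦ, hΦ,
          hχ0 _ _ (hlow l hl a), hχ0 _ _ (hlow l hl b)]
        by_cases hlm : l = m
        · subst hlm
          have h1 : shift l {a, b} ∈ W := by
            have h2 := hJ {a, b} Subset.rfl
            rw [hV] at h2
            refine h2.resolve_left fun h3 => ?_
            have h4 := congrFun h3 a
            simp [shift] at h4
          have h2 : R a b := (hpair a b hab).1 h1
          have h3 : R i a ↔ R i b := ⟨fun h => hR.trans h h2, fun h => hR.trans h (hR.symm h2)⟩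
          simp [hχ, h3]
        · simp [hχ0 _ _ hlm]
      · rintro ⟨l, I⟩ ⟨-, hJ⟩
        have hl : l ∈ W := by simpa using hJ ∅ (empty_subset _)
        rw [LinearMap.mem_ker, hΦ, hχ0]
        rintro rfl
        exact hmW hl
    have h1 := hle hmem
    rw [LinearMap.mem_ker, map_sub, hΦ, hΦ, hχ, hχ, if_pos (hR.refl i), if_neg hij] at h1
    exact absurd h1 (by norm_num)

-- A relative cycle has no boundary at `m`, so it is unchanged by the correction `T`, which cancels
-- the boundary at `m` of each edge with a multiple of one fixed edge. A corrected edge at `m`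
-- bounds a square up to edges in `W`.
open Classical in
theorem relCycles_le_relBoundaries (hmW : m ∉ W) (hV : V = insert m W)
    (hlow : ∀ l ∈ V, ∀ i, shift l {i} ≠ m) (hup : ∀ i, shift m {i} ∈ W)
    (hpair : ∀ i j, i ≠ j → shift m {i, j} ∈ W) :
    relCycles V W 1 ≤ relBoundaries V W 1 := by
  have hWV : W ⊆ V := hV ▸ Set.subset_insert m W
  have hmV : m ∈ V := hV ▸ Set.mem_insert m W
  rintro c ⟨hc, hc'⟩
  rcases isEmpty_or_nonempty κ with hκ | ⟨⟨i₀⟩⟩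
  · have h1 : chains V 1 ≤ (⊥ : Submodule ℤ (Cube κ →₀ ℤ)) := by
      refine chains_induction ?_
      rintro ⟨l, I⟩ ⟨hI, -⟩
      obtain ⟨a, -⟩ := Finset.card_eq_one.1 hI
      exact hκ.elim a
    exact (h1.trans bot_le) hc
  · let T : (Cube κ →₀ ℤ) →ₗ[ℤ] (Cube κ →₀ ℤ) := LinearMap.id +
      ((Finsupp.lapply (m, ∅)).comp boundary).smulRight (Finsupp.single (m, {i₀}) 1)
    have hT : ∀ c, T c = c + (boundary c (m, ∅)) • Finsupp.single (m, {i₀}) 1 := fun _ => rfl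
    have h1 : chains V 1 ≤ (relBoundaries V W 1).comap T := by
      refine chains_induction ?_
      rintro ⟨l, I⟩ hq
      obtain ⟨i, rfl⟩ := Finset.card_eq_one.1 hq.1
      obtain ⟨hl, hli⟩ := mem_fullCubes_singleton.1 hq
      rw [Submodule.mem_comap, hT, boundary_single, cubeBoundary_singleton, Finsupp.sub_apply,
        Finsupp.single_eq_of_ne (by
          intro h
          exact hlow l hl i (Prod.ext_iff.1 h).1.symm), zero_sub]
      by_cases hlm : l = m
      · subst hlm
        rw [Finsupp.single_eq_same, neg_one_smul, ← sub_eq_add_neg]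
        by_cases hi : i = i₀
        · subst hi
          rw [sub_self]
          exact Submodule.zero_mem _
        · obtain ⟨ε, hε, hb⟩ := cubeBoundary_pair l hi
          have hcube : ∀ a b, a ≠ b → (shift l {a}, {b}) ∈ fullCubes W 1 := fun a b hab =>
            mem_fullCubes_singleton.2 ⟨hup a, by
              rw [shift_shift_singleton l hab]; exact hpair a b hab⟩
          have hsq : ((l, {i, i₀}) : Cube κ) ∈ fullCubes V 2 := by
            refine ⟨Finset.card_pair hi, fun J hJ => ?_⟩
            rw [← Finset.mem_powerset, Finset.powerset_insert, Finset.mem_union,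
              Finset.mem_image] at hJ
            simp only [Finset.mem_powerset, Finset.subset_singleton_iff, or_and_right, exists_or,
              exists_eq_left] at hJ
            rcases hJ with (rfl | rfl) | rfl | rfl
            · simpa using hmV
            · exact hWV (hup _)
            · exact hWV (hup _)
            · exact hWV (hpair _ _ hi)
          have h2 : boundary (Finsupp.single (l, {i, i₀}) 1) ∈ relBoundaries V W 1 :=
            Submodule.mem_sup_left (Submodule.mem_map_of_mem (single_mem_chains hsq))
          have h3 : ∀ a b, a ≠ b →
              Finsupp.single (shift l {a}, {b}) (1 : ℤ) ∈ relBoundaries V W 1 := fun a b hab =>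
            Submodule.mem_sup_right (single_mem_chains (hcube a b hab))
          have h4 := Submodule.smul_mem _ ε h2
          rw [boundary_single, hb, smul_smul, hε, one_smul] at h4
          have h5 := Submodule.add_mem _ (Submodule.sub_mem _ h4 (h3 i i₀ hi))
            (h3 i₀ i (Ne.symm hi))
          convert h5 using 1
          abel
      · rw [Finsupp.single_eq_of_ne (by
          intro h
          exact hlm (Prod.ext_iff.1 h).1.symm), neg_zero, zero_smul, add_zero]
        refine Submodule.mem_sup_right (single_mem_chains (mem_fullCubes_singleton.2 ?_))
        rw [hV] at hl hli
        exact ⟨hl.resolve_left hlm, hli.resolve_left (hlow l (hV ▸ hl) i)⟩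
    have h2 := h1 hc
    have h3 : boundary c (m, ∅) = 0 := by
      have h4 : boundary c ∈ chains W 0 := hc'
      rw [chains, Finsupp.mem_supported'] at h4
      refine h4 _ fun h5 => hmW ?_
      simpa using h5.2 ∅ (empty_subset _)
    rwa [Submodule.mem_comap, hT, h3, zero_smul, add_zero] at h2

-- The relative group is the reduced `H_0` of the link of `m`: the directions are the vertices, and
-- the relation `R` gives the edges. As `R` is an equivalence, being connected means that any two
-- directions are related.
open Classical in
theorem relHomology_one_nontrivial_iff (hR : Equivalence R) (hmW : m ∉ W) (hV : V = insert m W)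
    (hlow : ∀ l ∈ V, ∀ i, shift l {i} ≠ m) (hup : ∀ i, shift m {i} ∈ W)
    (hpair : ∀ i j, i ≠ j → (shift m {i, j} ∈ W ↔ R i j)) :
    Nontrivial (RelHomology V W 1) ↔ ∃ i j, ¬ R i j := by
  rw [Submodule.Quotient.nontrivial_iff, Ne, Submodule.comap_subtype_eq_top]
  constructor
  · intro h
    by_contra! h'
    exact h (relCycles_le_relBoundaries hmW hV hlow hup fun i j hij =>
      (hpair i j hij).2 (h' i j))
  · rintro ⟨i, j, hij⟩ hle
    obtain ⟨c, hc, hc'⟩ := exists_relCycle_not_relBoundary hR hmW hV hlow hup hpair hij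
    exact hc' (hle hc)

theorem size_eq_sum [Fintype κ] (l : κ → ℕ) : size l = ∑ i, l i :=
  finsum_eq_sum_of_fintype l

theorem size_shift [Finite κ] (l : κ → ℕ) (I : Finset κ) :
    size (shift l I) = size l + I.card := by
  classical
  have := Fintype.ofFinite κ
  have h1 : ∀ i, shift l I i = l i + if i ∈ I then 1 else 0 := by
    intro i
    rw [shift]
    split_ifs <;> rfl
  rw [size_eq_sum, size_eq_sum, Finset.sum_congr rfl fun i _ => h1 i, Finset.sum_add_distrib,
    Finset.sum_ite_mem, Finset.univ_inter, Finset.card_eq_sum_ones]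

end Homology

/-! ## Weights in terms of a parametrization -/

section CoeffLinear

/-- The coefficient of `t ^ n`, as a linear functional on `ℂ{t}`. -/
def ctCoeff (n : ℕ) : Ct →ₗ[ℂ] ℂ :=
  (MvPowerSeries.coeff (R := ℂ) (Finsupp.single () n)).comp (ConvergentPowerSeries Unit).val.toLinearMap

theorem ct_pow_dvd_iff_ctCoeff {f : Ct} {n : ℕ} : ct ^ n ∣ f ↔ ∀ j < n, ctCoeff j f = 0 :=
  ct_pow_dvd_iff

theorem ct_pow_succ_dvd_iff {f : Ct} {n : ℕ} (h : ct ^ n ∣ f) :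
    ct ^ (n + 1) ∣ f ↔ ctCoeff n f = 0 := by
  rw [ct_pow_dvd_iff_ctCoeff] at h ⊢
  exact ⟨fun h' => h' n n.lt_succ_self, fun h' j hj => (Nat.lt_succ_iff_lt_or_eq.1 hj).elim
    (h j) fun e => e ▸ h'⟩

theorem ctCoeff_ct_pow_mul (n : ℕ) (u : Ct) : ctCoeff n (ct ^ n * u) = constCoeff u :=
  cf_ct_pow_mul_self n u

end CoeffLinear

section Codim

variable {K M : Type*} [Field K] [AddCommGroup M] [Module K M]

theorem _root_.Submodule.eq_of_le_of_finrank_quotient_le {p q : Submodule K M} (hpq : p ≤ q)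
    [Module.Finite K (M ⧸ p)] (h : Module.finrank K (M ⧸ p) ≤ Module.finrank K (M ⧸ q)) :
    p = q := by
  have hs : Function.Surjective (Submodule.factor hpq) := Submodule.factor_surjective hpq
  have : Module.Finite K (M ⧸ q) := Module.Finite.of_surjective _ hs
  have hi := (LinearMap.injective_iff_surjective_of_finrank_eq_finrank
    (le_antisymm h (LinearMap.finrank_le_finrank_of_surjective hs))).2 hs
  refine le_antisymm hpq fun x hx => ?_
  rw [← Submodule.Quotient.mk_eq_zero]
  apply hi
  rw [map_zero]
  exact (Submodule.Quotient.mk_eq_zero q).2 hx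

end Codim

variable {O : Type u} [CommRing O] [Algebra ℂ O]

/-- A parametrization of a germ indexed by its branches, compatible with orders of vanishing. -/
structure IsBranchModel (θ : O →ₐ[ℂ] (Branch O → Ct)) : Prop extends IsModel θ where
  finite : Finite (Branch O)
  mem_pow_iff : ∀ i k f,
    algebraMap O (Normalization O) f ∈ i.asIdeal ^ k ↔ ct ^ k ∣ θ f i

theorem IsModel.exists_branchModel {ι : Type v} [Finite ι] {θ : O →ₐ[ℂ] (ι → Ct)}
    (h : IsModel θ) : ∃ (b : ι ≃ Branch O) (θ' : O →ₐ[ℂ] (Branch O → Ct)), IsBranchModel θ' ∧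
      ∀ f i, θ' f (b i) = θ f i := by
  obtain ⟨b, hb⟩ := h.exists_branch_equiv
  let θ' : O →ₐ[ℂ] (Branch O → Ct) :=
    AlgHom.pi fun i => (Pi.evalAlgHom ℂ (fun _ : ι => Ct) (b.symm i)).comp θ
  have hθ' : ∀ f i, θ' f i = θ f (b.symm i) := fun _ _ => rfl
  refine ⟨b, θ', ⟨⟨fun x y hxy => h.injective (funext fun i => ?_), ?_⟩, Finite.of_equiv _ b,
    fun i k f => ?_⟩, fun f i => ?_⟩
  · have h1 := congrFun hxy (b i)
    rwa [hθ', hθ', Equiv.symm_apply_apply] at h1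
  · obtain ⟨N, hN⟩ := h.conductor
    refine ⟨N, fun g => ?_⟩
    obtain ⟨f, hf⟩ := hN fun i => g (b i)
    refine ⟨f, funext fun i => ?_⟩
    rw [hθ', hf]
    change ct ^ N * g (b (b.symm i)) = _
    rw [Equiv.apply_symm_apply]
  · rw [hθ', ← hb, Equiv.apply_symm_apply]
  · rw [hθ', Equiv.symm_apply_apply]

/-! ### The lattice filtration in terms of orders along the branches. -/

namespace IsBranchModel

variable {θ : O →ₐ[ℂ] (Branch O → Ct)}

theorem mem_latticeFiltration (h : IsBranchModel θ) (l : Branch O → ℕ) (f : O) :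
    f ∈ latticeFiltration O l ↔ ∀ i, ct ^ l i ∣ θ f i := by
  rw [latticeFiltration, Ideal.mem_comap, normalizationFiltration, Submodule.mem_iInf]
  exact forall_congr' fun i => h.mem_pow_iff i (l i) f

theorem finite_quotient (h : IsBranchModel θ) (l : Branch O → ℕ) :
    Module.Finite ℂ (O ⧸ (latticeFiltration O l).restrictScalars ℂ) := by
  have := h.finite
  have := Fintype.ofFinite (Branch O)
  let L : O →ₗ[ℂ] (∀ i : Branch O, Fin (l i) → ℂ) := LinearMap.pi fun i => LinearMap.pi fun k =>
    (ctCoeff k).comp ((LinearMap.proj i).comp θ.toLinearMap)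
  have hL : ∀ f i k, L f i k = ctCoeff k (θ f i) := fun _ _ _ => rfl
  have hker : LinearMap.ker L = (latticeFiltration O l).restrictScalars ℂ := by
    ext f
    rw [LinearMap.mem_ker, Submodule.restrictScalars_mem, h.mem_latticeFiltration]
    simp_rw [ct_pow_dvd_iff_ctCoeff]
    constructor
    · intro h0 i j hj
      rw [← hL f i ⟨j, hj⟩, h0]
      rfl
    · intro h0
      funext i k
      exact h0 i k k.2
  rw [← hker]
  exact Module.Finite.equiv L.quotKerEquivRange.symm

theorem hilbert_eq_finrank (l : Branch O → ℕ) :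
    hilbert O l = Module.finrank ℂ (O ⧸ (latticeFiltration O l).restrictScalars ℂ) :=
  (Submodule.Quotient.restrictScalarsEquiv ℂ (latticeFiltration O l)).finrank_eq.symm

theorem hilbert_eq_of_surjective (h : IsBranchModel θ) (l : Branch O → ℕ) {V : Type*}
    [AddCommGroup V] [Module ℂ V] (L : O →ₗ[ℂ] V) (hL : Function.Surjective L)
    (hker : ∀ f, L f = 0 ↔ ∀ i, ct ^ l i ∣ θ f i) : hilbert O l = Module.finrank ℂ V := by
  have hker' : (latticeFiltration O l).restrictScalars ℂ = LinearMap.ker L := by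
    ext f
    rw [LinearMap.mem_ker, Submodule.restrictScalars_mem, h.mem_latticeFiltration, hker]
  rw [hilbert_eq_finrank, hker']
  exact (L.quotKerEquivOfSurjective hL).finrank_eq

theorem latticeFiltration_eq_of_le (h : IsBranchModel θ) {l l' : Branch O → ℕ}
    (hl : latticeFiltration O l' ≤ latticeFiltration O l) (hh : hilbert O l' ≤ hilbert O l) :
    latticeFiltration O l' = latticeFiltration O l := by
  have := h.finite_quotient l'
  rw [hilbert_eq_finrank, hilbert_eq_finrank] at hh
  have := Submodule.eq_of_le_of_finrank_quotient_le (K := ℂ)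
    (p := (latticeFiltration O l').restrictScalars ℂ)
    (q := (latticeFiltration O l).restrictScalars ℂ) hl hh
  exact Submodule.restrictScalars_injective ℂ O O this

theorem card_le_hilbert (h : IsBranchModel θ) (l : Branch O → ℕ) {ι : Type*} [Fintype ι]
    (v : ι → O) (hv : ∀ c : ι → ℂ, (∀ i, ct ^ l i ∣ ∑ j, c j • θ (v j) i) → c = 0) :
    Fintype.card ι ≤ hilbert O l := by
  have := h.finite_quotient l
  rw [hilbert_eq_finrank]
  have hli : LinearIndependent ℂ fun j =>
      ((latticeFiltration O l).restrictScalars ℂ).mkQ (v j) := by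
    rw [Fintype.linearIndependent_iff]
    intro c hc j
    have h1 : ((latticeFiltration O l).restrictScalars ℂ).mkQ (∑ j, c j • v j) = 0 := by
      rw [map_sum, ← hc]
      exact Finset.sum_congr rfl fun j _ => map_smul _ _ _
    rw [Submodule.mkQ_apply, Submodule.Quotient.mk_eq_zero, Submodule.restrictScalars_mem,
      h.mem_latticeFiltration] at h1
    refine congrFun (hv c fun i => ?_) j
    have h2 := h1 i
    rwa [map_sum, Finset.sum_apply, Finset.sum_congr rfl fun j _ => congrFun (map_smul θ (c j) (v j)) i]
      at h2
  exact hli.fintype_card_le_finrank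

variable [IsLocalRing O]

/-- Locality makes one branch enough. If `c ≠ 0` is the constant term on branch `i`, then `f c⁻¹ -
(f - c) c⁻¹ = 1`, so `f` or `f - c` is a unit, and the latter vanishes at the origin of the branch.
-/
theorem isUnit_iff (_ : IsBranchModel θ) (i : Branch O) (f : O) :
    IsUnit f ↔ constCoeff (θ f i) ≠ 0 := by
  constructor
  · intro hf
    exact ((hf.map θ).map (Pi.evalRingHom (fun _ : Branch O => Ct) i)).map constCoeff |>.ne_zero
  · intro hf
    by_contra hu
    have h1 : IsUnit (f - algebraMap ℂ O (constCoeff (θ f i))) := by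
      have h2 : IsUnit (-(f - algebraMap ℂ O (constCoeff (θ f i)))) := by
        refine (IsLocalRing.isUnit_or_isUnit_of_add_one
          (a := f * algebraMap ℂ O (constCoeff (θ f i))⁻¹)
          (b := -(f - algebraMap ℂ O (constCoeff (θ f i))) *
            algebraMap ℂ O (constCoeff (θ f i))⁻¹) ?_).elim (fun h3 => absurd
              (isUnit_of_mul_isUnit_left h3) hu) isUnit_of_mul_isUnit_left
        have h4 : algebraMap ℂ O (constCoeff (θ f i)) * algebraMap ℂ O (constCoeff (θ f i))⁻¹ = 1 := by
          rw [← map_mul, mul_inv_cancel₀ hf, map_one]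
        linear_combination h4
      exact IsUnit.neg_iff _ |>.1 h2
    have h5 := ((h1.map θ).map (Pi.evalRingHom (fun _ : Branch O => Ct) i)).map constCoeff
    refine h5.ne_zero ?_
    rw [map_sub, AlgHom.commutes, map_sub, map_sub]
    change constCoeff (θ f i) - constCoeff (algebraMap ℂ Ct (constCoeff (θ f i))) = 0
    rw [AlgHom.commutes]
    exact sub_self _

theorem exists_pow_mem (h : IsBranchModel θ) (i : Branch O) :
    ∃ N : ℕ, ∃ f : O, ¬ IsUnit f ∧ θ f i = ct ^ N := by
  obtain ⟨N, hN⟩ := h.conductor_of_le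
  obtain ⟨f, hf⟩ := hN (N + 1) N.le_succ 1
  refine ⟨N + 1, f, ?_, ?_⟩
  · rw [h.isUnit_iff i, not_not, hf, map_mul, map_pow, constCoeff_ct, zero_pow N.succ_ne_zero,
      zero_mul]
  · rw [hf]
    exact mul_one _

/-- The supremum of an unbounded set of naturals would be `0`. The conductor provides a nonunit of
finite order on the branch, so the set is bounded and its supremum is attained. -/
theorem multiplicity_isGreatest (h : IsBranchModel θ) (i : Branch O) :
    IsGreatest {k : ℕ | ∀ f : O, ¬ IsUnit f → ct ^ k ∣ θ f i} (multiplicity O i) := by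
  have h1 : multiplicity O i = sSup {k : ℕ | ∀ f : O, ¬ IsUnit f → ct ^ k ∣ θ f i} := by
    rw [multiplicity]
    congr 1
    ext k
    exact forall_congr' fun f => imp_congr_right fun _ => h.mem_pow_iff i k f
  rw [h1]
  obtain ⟨N, f, hf, hfN⟩ := h.exists_pow_mem i
  have hbdd : BddAbove {k : ℕ | ∀ f : O, ¬ IsUnit f → ct ^ k ∣ θ f i} := by
    refine ⟨N, fun k hk => ?_⟩
    have h2 := hk f hf
    rw [hfN] at h2
    exact (pow_dvd_pow_iff ct_ne_zero prime_ct.not_isUnit).1 h2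
  exact ⟨Nat.sSup_mem ⟨0, fun f _ => by simp⟩ hbdd, fun k hk => le_csSup hbdd hk⟩

theorem multiplicity_dvd (h : IsBranchModel θ) (i : Branch O) {f : O} (hf : ¬ IsUnit f) :
    ct ^ multiplicity O i ∣ θ f i := (h.multiplicity_isGreatest i).1 f hf

theorem exists_not_dvd (h : IsBranchModel θ) (i : Branch O) :
    ∃ f, ¬ IsUnit f ∧ ¬ ct ^ (multiplicity O i + 1) ∣ θ f i := by
  by_contra! h'
  have := (h.multiplicity_isGreatest i).2 h'
  omega

theorem one_le_multiplicity (h : IsBranchModel θ) (i : Branch O) : 1 ≤ multiplicity O i := by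
  refine (h.multiplicity_isGreatest i).2 fun f hf => ?_
  rw [h.isUnit_iff i, not_not] at hf
  rw [pow_one, ct_dvd_iff, hf]

/-! ### The Hilbert function at `m` and at its neighbours. -/

theorem mem_latticeFiltration_shift (h : IsBranchModel θ) (I : Finset (Branch O))
    (hI : I.Nonempty) (f : O) :
    f ∈ latticeFiltration O (shift (multiplicity O) I) ↔
      ¬ IsUnit f ∧ ∀ i ∈ I, ct ^ (multiplicity O i + 1) ∣ θ f i := by
  classical
  rw [h.mem_latticeFiltration]
  constructor
  · intro hf
    have h1 : ∀ i ∈ I, ct ^ (multiplicity O i + 1) ∣ θ f i := by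
      intro i hi
      have := hf i
      rwa [shift, if_pos hi] at this
    refine ⟨?_, h1⟩
    obtain ⟨i, hi⟩ := hI
    rw [h.isUnit_iff i, not_not, ← ct_dvd_iff]
    exact (dvd_pow_self ct (Nat.succ_ne_zero _)).trans (h1 i hi)
  · rintro ⟨hu, hf⟩ i
    rw [shift]
    split_ifs with hi
    · exact hf i hi
    · exact h.multiplicity_dvd i hu

/-- The filtration ideal at `m` is the maximal ideal, with residue field `ℂ`. -/
theorem hilbert_multiplicity [Nonempty (Branch O)] (h : IsBranchModel θ) :
    hilbert O (multiplicity O) = 1 := by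
  obtain ⟨i⟩ := ‹Nonempty (Branch O)›
  rw [← Module.finrank_self ℂ]
  refine h.hilbert_eq_of_surjective _
    ((constCoeff.toLinearMap.comp (LinearMap.proj i)).comp θ.toLinearMap) (fun c => ?_) fun f => ?_
  · refine ⟨algebraMap ℂ O c, ?_⟩
    change constCoeff (θ (algebraMap ℂ O c) i) = c
    rw [AlgHom.commutes]
    exact constCoeff.commutes c
  · change constCoeff (θ f i) = 0 ↔ _
    constructor
    · intro h0 j
      refine h.multiplicity_dvd j ?_
      rwa [h.isUnit_iff i, not_not]
    · intro h0
      rw [← ct_dvd_iff]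
      refine (dvd_pow_self ct ?_).trans (h0 i)
      have := h.one_le_multiplicity i
      omega

/-- One condition is added to the maximal ideal, the vanishing of the leading coefficient along `i`;
it is nontrivial because the multiplicity is attained. -/
theorem hilbert_shift_singleton (h : IsBranchModel θ) (i : Branch O) :
    hilbert O (shift (multiplicity O) {i}) = 2 := by
  let L : O →ₗ[ℂ] ℂ × ℂ :=
    ((constCoeff.toLinearMap.comp (LinearMap.proj i)).comp θ.toLinearMap).prod
      (((ctCoeff (multiplicity O i)).comp (LinearMap.proj i)).comp θ.toLinearMap)
  have hL : ∀ f, L f = (constCoeff (θ f i), ctCoeff (multiplicity O i) (θ f i)) := fun _ => rfl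
  have h2 : Module.finrank ℂ (ℂ × ℂ) = 2 := by simp
  rw [← h2]
  refine h.hilbert_eq_of_surjective _ L ?_ fun f => ?_
  · obtain ⟨f, hf, hfi⟩ := h.exists_not_dvd i
    have h3 : constCoeff (θ f i) = 0 := by
      rwa [h.isUnit_iff i, not_not] at hf
    have h4 : ctCoeff (multiplicity O i) (θ f i) ≠ 0 := by
      rwa [Ne, ← ct_pow_succ_dvd_iff (h.multiplicity_dvd i hf)]
    have h5 : constCoeff (θ 1 i) = 1 := by
      rw [map_one]
      exact map_one _
    rintro ⟨a, b⟩
    refine ⟨a • 1 + ((b - a * ctCoeff (multiplicity O i) (θ 1 i)) /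
      ctCoeff (multiplicity O i) (θ f i)) • f, ?_⟩
    rw [map_add, map_smul, map_smul, hL, hL, h3, h5]
    ext
    · simp
    · simp only [Prod.smul_mk, smul_eq_mul, Prod.mk_add_mk]
      field_simp
      ring
  · rw [hL, Prod.mk_eq_zero, ← h.mem_latticeFiltration,
      h.mem_latticeFiltration_shift _ (singleton_nonempty i)]
    have h6 : ¬ IsUnit f ↔ constCoeff (θ f i) = 0 := by rw [h.isUnit_iff i, not_not]
    rw [h6]
    refine and_congr_right fun h7 => ?_
    rw [← ct_pow_succ_dvd_iff (h.multiplicity_dvd i (h6.2 h7))]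
    simp

/-- Two branches have the same tangential leading coefficients, up to a factor. -/
def SameLeading (θ : O →ₐ[ℂ] (Branch O → Ct)) (i j : Branch O) : Prop :=
  ∀ f, ¬ IsUnit f → (ct ^ (multiplicity O i + 1) ∣ θ f i ↔ ct ^ (multiplicity O j + 1) ∣ θ f j)

-- The ideal at `m + e^i + e^j` lies in those at `m + e^i` and `m + e^j`, both of codimension two.
-- Codimension at most two therefore makes all three equal, so the two leading coefficients vanish
-- together.
open Classical in
theorem hilbert_shift_pair_le_two_iff (h : IsBranchModel θ) (i j : Branch O) :
    hilbert O (shift (multiplicity O) {i, j}) ≤ 2 ↔ SameLeading θ i j := by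
  have hi : ∀ f, f ∈ latticeFiltration O (shift (multiplicity O) {i}) ↔
      ¬ IsUnit f ∧ ct ^ (multiplicity O i + 1) ∣ θ f i := fun f => by
    rw [h.mem_latticeFiltration_shift _ (singleton_nonempty i)]; simp
  have hj : ∀ f, f ∈ latticeFiltration O (shift (multiplicity O) {j}) ↔
      ¬ IsUnit f ∧ ct ^ (multiplicity O j + 1) ∣ θ f j := fun f => by
    rw [h.mem_latticeFiltration_shift _ (singleton_nonempty j)]; simp
  have hij : ∀ f, f ∈ latticeFiltration O (shift (multiplicity O) {i, j}) ↔
      ¬ IsUnit f ∧ ct ^ (multiplicity O i + 1) ∣ θ f i ∧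
        ct ^ (multiplicity O j + 1) ∣ θ f j := fun f => by
    rw [h.mem_latticeFiltration_shift _ (insert_nonempty i {j})]; simp
  constructor
  · intro hle f hf
    have e1 := h.latticeFiltration_eq_of_le (l := shift (multiplicity O) {i})
      (l' := shift (multiplicity O) {i, j}) (fun f hf => (hi f).2 (by
        obtain ⟨a, b, _⟩ := (hij f).1 hf
        exact ⟨a, b⟩)) (by rwa [h.hilbert_shift_singleton])
    have e2 := h.latticeFiltration_eq_of_le (l := shift (multiplicity O) {j})
      (l' := shift (multiplicity O) {i, j}) (fun f hf => (hj f).2 (by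
        obtain ⟨a, _, b⟩ := (hij f).1 hf
        exact ⟨a, b⟩)) (by rwa [h.hilbert_shift_singleton])
    have e3 := e1.symm.trans e2
    have h1 := (hi f).symm
    rw [e3, hj f] at h1
    simpa [hf] using h1
  · intro hs
    have e1 : latticeFiltration O (shift (multiplicity O) {i, j}) =
        latticeFiltration O (shift (multiplicity O) {i}) := by
      ext f
      rw [hij, hi]
      constructor
      · rintro ⟨a, b, _⟩
        exact ⟨a, b⟩
      · rintro ⟨a, b⟩
        exact ⟨a, b, (hs f a).1 b⟩
    rw [← h.hilbert_shift_singleton i, hilbert, hilbert, e1]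

/-- As `l ≠ 0`, its ideal lies in the maximal ideal, and codimension at most one makes them equal.
All nonunits then have order at least `l`, so `l ≤ m`, and the sizes agree. -/
theorem eq_multiplicity_of_hilbert_le_one [Nonempty (Branch O)] (h : IsBranchModel θ)
    {l : Branch O → ℕ} (hl : hilbert O l ≤ 1) (hs : size l = size (multiplicity O)) :
    l = multiplicity O := by
  have := h.finite
  have := Fintype.ofFinite (Branch O)
  rw [size_eq_sum, size_eq_sum] at hs
  have hle : latticeFiltration O l ≤ latticeFiltration O (multiplicity O) := by
    intro f hf
    rw [h.mem_latticeFiltration] at hf ⊢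
    obtain ⟨i, hi⟩ : ∃ i, l i ≠ 0 := by
      by_contra! h0
      rw [Finset.sum_eq_zero fun i _ => h0 i] at hs
      have h1 := h.one_le_multiplicity (Classical.arbitrary _)
      have h2 := (Finset.sum_eq_zero_iff.1 hs.symm) (Classical.arbitrary _) (mem_univ _)
      omega
    intro j
    refine h.multiplicity_dvd j ?_
    rw [h.isUnit_iff i, not_not, ← ct_dvd_iff]
    exact (dvd_pow_self ct hi).trans (hf i)
  have heq := h.latticeFiltration_eq_of_le hle (by rwa [h.hilbert_multiplicity])
  have hle' : ∀ i, l i ≤ multiplicity O i := by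
    intro i
    refine (h.multiplicity_isGreatest i).2 fun f hf => ?_
    have hfm : f ∈ latticeFiltration O (multiplicity O) :=
      (h.mem_latticeFiltration _ _).2 fun j => h.multiplicity_dvd j hf
    rw [← heq, h.mem_latticeFiltration] at hfm
    exact hfm i
  funext i
  exact (Finset.sum_eq_sum_iff_of_le fun i _ => hle' i).1 hs i (mem_univ i)

/-- At size `3`, weight at most `0` means `2 h ≤ 3`, that is `h ≤ 1`, so `m` is the only vertex. At
size `4` the neighbours of `m` have `h = 2`, hence weight `0`; at size `5` the condition is `h ≤ 2`.
-/
theorem nontrivial_E1_iff (h : IsBranchModel θ) (hm : size (multiplicity O) = 3) :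
    Nontrivial (E1 O 3 1 0) ↔ ∃ i j, ¬ SameLeading θ i j := by
  classical
  have := h.finite
  have := Fintype.ofFinite (Branch O)
  have : Nonempty (Branch O) := by
    by_contra h0
    rw [not_nonempty_iff] at h0
    rw [size_eq_sum, Finset.univ_eq_empty, Finset.sum_empty] at hm
    omega
  have hWmem : ∀ l, l ∈ levelVertices O 0 (3 + 1) ↔ 2 * (hilbert O l : ℤ) - size l ≤ 0 ∧
      3 + 1 ≤ size l := fun _ => Iff.rfl
  have hVmem : ∀ l, l ∈ levelVertices O 0 3 ↔ 2 * (hilbert O l : ℤ) - size l ≤ 0 ∧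
      3 ≤ size l := fun _ => Iff.rfl
  refine relHomology_one_nontrivial_iff (m := multiplicity O) (R := SameLeading θ)
    ⟨fun i f _ => Iff.rfl, fun h f hf => (h f hf).symm,
      fun h h' f hf => (h f hf).trans (h' f hf)⟩ ?_ ?_ ?_ ?_ ?_
  · rw [hWmem]
    omega
  · ext l
    rw [Set.mem_insert_iff, hVmem, hWmem]
    constructor
    · rintro ⟨h1, h2⟩
      by_cases h3 : size l = 3
      · exact Or.inl (h.eq_multiplicity_of_hilbert_le_one (by omega) (by omega))
      · exact Or.inr ⟨h1, by omega⟩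
    · rintro (rfl | ⟨h1, h2⟩)
      · rw [h.hilbert_multiplicity, hm]
        norm_num
      · exact ⟨h1, by omega⟩
  · rintro l hl i hli
    have h1 := size_shift l {i}
    rw [hli, card_singleton] at h1
    have h2 := (hVmem l).1 hl
    omega
  · intro i
    rw [hWmem, h.hilbert_shift_singleton, size_shift, card_singleton]
    omega
  · intro i j hij
    convert_to shift (multiplicity O) {i, j} ∈ levelVertices O 0 (3 + 1) ↔ _
    rw [← h.hilbert_shift_pair_le_two_iff]
    rw [hWmem, size_shift, card_pair hij]
    convert_to (_ ∧ _) ↔ hilbert O (shift (multiplicity O) {i, j}) ≤ 2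
    omega

/-- A germ has a minimal spectral `1`-cycle of weight `0` if and only if its multiplicity is three
and not all branches have the same leading coefficients. -/
theorem hasMinimalSpectralCycle_iff (h : IsBranchModel θ) :
    HasMinimalSpectralCycle O 1 0 ↔
      size (multiplicity O) = 3 ∧ ∃ i j, ¬ SameLeading θ i j := by
  constructor
  · rintro ⟨h1, j, h2, h3⟩
    -- A product of integers equal to `1` forces `|m| = 3` and `j = 1`.
    have h4 : ((size (multiplicity O) : ℤ) - 2) * j = 1 := by push_cast at h2; linarith
    have h5 : (size (multiplicity O) : ℤ) - 2 = 1 :=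
      Int.eq_one_or_neg_one_of_mul_eq_one h4 |>.resolve_right (by omega)
    have h6 : size (multiplicity O) = 3 := by omega
    have h7 : j = 1 := by
      rw [h5, one_mul] at h4
      exact_mod_cast h4
    rw [h6, h7, one_mul] at h3
    exact ⟨h6, (h.nontrivial_E1_iff h6).1 h3⟩
  · rintro ⟨h1, h2⟩
    refine ⟨h1.ge, 1, ?_, ?_⟩
    · rw [h1]
      norm_num
    · rw [h1, one_mul]
      exact (h.nontrivial_E1_iff h1).2 h2

theorem weight_multiplicity [Nonempty (Branch O)] (h : IsBranchModel θ) :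
    weight O (multiplicity O) = 2 - size (multiplicity O) := by
  rw [weight, h.hilbert_multiplicity]
  norm_num

end IsBranchModel

/-! ## Dominance in terms of parametrizations -/

section Parametrizes

variable {S : Type*} [CommRing S] [Algebra ℂ S] {ι : Type v}

/-- The homomorphism `Φ` induces a parametrization of the germ with equation `F`. -/
structure Parametrizes (Φ : S →ₐ[ℂ] (ι → Ct)) (F : S) : Prop where
  ker : ∀ f, Φ f = 0 ↔ F ∣ f
  conductor : ∃ N : ℕ, ∀ g : ι → Ct, ∃ f : S, Φ f = fun i => ct ^ N * g i

theorem Parametrizes.isModel {Φ : S →ₐ[ℂ] (ι → Ct)} {F : S} (h : Parametrizes Φ F)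
    (θ : S ⧸ Ideal.span {F} →ₐ[ℂ] (ι → Ct))
    (hθ : ∀ f, θ (Ideal.Quotient.mk (Ideal.span {F}) f) = Φ f) : IsModel θ := by
  constructor
  · rw [injective_iff_map_eq_zero]
    intro x hx
    obtain ⟨f, rfl⟩ := Ideal.Quotient.mk_surjective x
    rw [hθ, h.ker] at hx
    exact Ideal.Quotient.eq_zero_iff_mem.2 (Ideal.mem_span_singleton.2 hx)
  · obtain ⟨N, hN⟩ := h.conductor
    refine ⟨N, fun g => ?_⟩
    obtain ⟨f, hf⟩ := hN g
    exact ⟨Ideal.Quotient.mk _ f, (hθ f).trans hf⟩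

theorem Parametrizes.exists_model {Φ : S →ₐ[ℂ] (ι → Ct)} {F : S} (h : Parametrizes Φ F) :
    ∃ θ : S ⧸ Ideal.span {F} →ₐ[ℂ] (ι → Ct), IsModel θ ∧
      ∀ f, θ (Ideal.Quotient.mk (Ideal.span {F}) f) = Φ f := by
  let θ : S ⧸ Ideal.span {F} →ₐ[ℂ] (ι → Ct) := Ideal.Quotient.liftₐ _ Φ fun a ha =>
    (h.ker a).2 (Ideal.mem_span_singleton.1 ha)
  have hθ : ∀ f, θ (Ideal.Quotient.mk (Ideal.span {F}) f) = Φ f := fun _ => rfl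
  exact ⟨θ, h.isModel θ hθ, hθ⟩

/-- Multiples of `e` live on branch `i` alone, and surjectivity there supplies every multiple of the
resulting power of `t`. -/
theorem exists_single_of_surjective [DecidableEq ι] (Φ : S →ₐ[ℂ] (ι → Ct)) (i : ι)
    (hs : ∀ g, ∃ f, Φ f i = g) (e : S) (he : ∀ j, j ≠ i → Φ e j = 0) (hei : Φ e i ≠ 0) :
    ∃ N : ℕ, ∀ g : Ct, ∃ f, Φ f = Pi.single i (ct ^ N * g) := by
  obtain ⟨N, u, hu, hN⟩ := exists_eq_ct_pow_mul hei
  obtain ⟨v, hv⟩ := (isUnit_of_constCoeff hu).exists_left_inv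
  refine ⟨N, fun g => ?_⟩
  obtain ⟨f, hf⟩ := hs (v * g)
  refine ⟨e * f, funext fun j => ?_⟩
  rw [map_mul, Pi.mul_apply]
  by_cases hj : j = i
  · subst hj
    rw [Pi.single_eq_same, hN, hf]
    linear_combination (ct ^ N * g) * hv
  · rw [he j hj, zero_mul, Pi.single_eq_of_ne hj]

variable {O : Type u} [CommRing O] [Algebra ℂ O] [Finite ι]

theorem birationallyDominates_of_model {O' : Type*} [CommRing O'] [Algebra ℂ O']
    {θ : O →ₐ[ℂ] (ι → Ct)} (hθ : IsModel θ) (φ : O' →ₐ[ℂ] O) (hφ : IsModel (θ.comp φ)) :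
    BirationallyDominates O O' := by
  obtain ⟨e, he⟩ := hφ.exists_normalization_equiv
  refine ⟨φ, (e.symm : (ι → Ct) →ₐ[ℂ] Normalization O').comp θ, ?_, ?_, fun f => ?_⟩
  · exact Function.Injective.of_comp (f := θ) hφ.injective
  · exact e.symm.injective.comp hθ.injective
  · change e.symm (θ (φ f)) = _
    rw [AlgEquiv.symm_apply_eq, he]
    rfl

/-- An algebra between `O'` and its normalization contains the conductor of `O'`, so the same
product of branches parametrizes it. -/
theorem exists_model_of_birationallyDominates {O' : Type*} [CommRing O'] [Algebra ℂ O']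
    (h : BirationallyDominates O O') {θ' : O' →ₐ[ℂ] (ι → Ct)} (hθ' : IsModel θ') :
    ∃ (φ : O' →ₐ[ℂ] O) (θ : O →ₐ[ℂ] (ι → Ct)), IsModel θ ∧ ∀ f, θ (φ f) = θ' f := by
  obtain ⟨e, he⟩ := hθ'.exists_normalization_equiv
  obtain ⟨φ, ψ, -, hψ, hφψ⟩ := h
  have h1 : ∀ f, e (ψ (φ f)) = θ' f := fun f => by rw [hφψ, he]
  refine ⟨φ, (e : Normalization O' →ₐ[ℂ] (ι → Ct)).comp ψ, ⟨e.injective.comp hψ, ?_⟩, h1⟩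
  obtain ⟨N, hN⟩ := hθ'.conductor
  refine ⟨N, fun g => ?_⟩
  obtain ⟨f, hf⟩ := hN g
  exact ⟨φ f, (h1 f).trans hf⟩

theorem Parametrizes.birationallyDominates {F : S} {θ : O →ₐ[ℂ] (ι → Ct)} (hθ : IsModel θ)
    (E : S →ₐ[ℂ] O) (h : Parametrizes (θ.comp E) F) :
    BirationallyDominates O (S ⧸ Ideal.span {F}) := by
  let φ : S ⧸ Ideal.span {F} →ₐ[ℂ] O := Ideal.Quotient.liftₐ _ E fun a ha => by
    have h1 := (h.ker a).2 (Ideal.mem_span_singleton.1 ha)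
    exact (map_eq_zero_iff θ hθ.injective).1 h1
  exact birationallyDominates_of_model hθ φ (h.isModel _ fun _ => rfl)

theorem Parametrizes.exists_model_of_birationallyDominates {F : S} {Φ : S →ₐ[ℂ] (ι → Ct)}
    (h : Parametrizes Φ F) (hO : BirationallyDominates O (S ⧸ Ideal.span {F})) :
    ∃ (E : S →ₐ[ℂ] O) (θ : O →ₐ[ℂ] (ι → Ct)), IsModel θ ∧ ∀ f, θ (E f) = Φ f := by
  obtain ⟨θ', hθ', hΦ⟩ := h.exists_model
  obtain ⟨φ, θ, hθ, hφ⟩ := CurveGerm.exists_model_of_birationallyDominates hO hθ'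
  exact ⟨φ.comp (Ideal.Quotient.mkₐ ℂ _), θ, hθ, fun f => (hφ _).trans (hΦ f)⟩

theorem conductor_of_single [DecidableEq ι] (Φ : S →ₐ[ℂ] (ι → Ct))
    (h : ∀ i, ∃ N : ℕ, ∀ g : Ct, ∃ f, Φ f = Pi.single i (ct ^ N * g)) :
    ∃ N : ℕ, ∀ g : ι → Ct, ∃ f : S, Φ f = fun i => ct ^ N * g i := by
  have := Fintype.ofFinite ι
  choose n hn using h
  refine ⟨∑ i, n i, fun g => ?_⟩
  choose f hf using fun i => hn i (ct ^ (∑ i, n i - n i) * g i)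
  refine ⟨∑ i, f i, funext fun j => ?_⟩
  rw [map_sum, Finset.sum_congr rfl fun i _ => hf i, Finset.univ_sum_single]
  rw [← mul_assoc, ← pow_add, Nat.add_sub_cancel'
    (Finset.single_le_sum (f := n) (fun _ _ => Nat.zero_le _) (mem_univ j))]

end Parametrizes

/-! ## Substitutions in one variable -/

section Substitution

theorem Ct.eq_evalAt (φ : Ct →ₐ[ℂ] Ct) (h : constCoeff (φ ct) = 0) : φ = evalAt (φ ct) h :=
  Ct.hom_ext (by rw [evalAt_ct])

theorem Ct.constCoeff_map_ct (φ : Ct →ₐ[ℂ] Ct) : constCoeff (φ ct) = 0 := by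
  rw [constCoeff_map, constCoeff_ct]

theorem Ct.map_surjective (φ : Ct →ₐ[ℂ] Ct) {u : Ct} (hu : constCoeff u ≠ 0)
    (h : φ ct = ct * u) : Function.Surjective φ := by
  rw [Ct.eq_evalAt φ (Ct.constCoeff_map_ct φ)]
  exact evalAt_surjective hu h _

theorem Ct.exists_eq_add_mul_map (φ : Ct →ₐ[ℂ] Ct) {u : Ct} (hu : constCoeff u ≠ 0)
    (h : φ ct = ct ^ 2 * u) (g : Ct) : ∃ a b, g = φ a + ct * φ b := by
  obtain ⟨c, hc⟩ := exists_eq_sum_evalAt hu h (Ct.constCoeff_map_ct φ) g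
  rw [← Ct.eq_evalAt, Finset.sum_range_succ, Finset.sum_range_one, pow_zero, one_mul, pow_one]
    at hc
  exact ⟨c 0, c 1, hc⟩

theorem Ct.neg_mul' (a b : Ct) : -a * b = -(a * b) := by ring

theorem Ct.neg_sq' (a : Ct) : (-a) ^ 2 = a ^ 2 := by ring

/-- An even power of a series is not an odd power of the coordinate times a square. -/
theorem Ct.eq_zero_of_sq_eq (p : ℕ) (z : ℂ) (hz : z ≠ 0) {a b : Ct}
    (h : a ^ 2 = z • (ct ^ (2 * p + 1) * b ^ 2)) : b = 0 := by
  by_contra hb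
  obtain ⟨n, u, hu, rfl⟩ := exists_eq_ct_pow_mul hb
  have ha : a ≠ 0 := by
    rintro rfl
    rw [zero_pow two_ne_zero] at h
    exact (smul_ne_zero hz (mul_ne_zero (pow_ne_zero _ ct_ne_zero) (pow_ne_zero _ hb))) h.symm
  obtain ⟨m, v, hv, rfl⟩ := exists_eq_ct_pow_mul ha
  have h1 : ct ^ (2 * m) * v ^ 2 = ct ^ (2 * p + 1 + 2 * n) * (z • u ^ 2) := by
    rw [mul_smul_comm]
    calc _ = (ct ^ m * v) ^ 2 := by ring
      _ = _ := by rw [h]; congr 1; ring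
  have h2 := ct_pow_mul_unit_inj (by rw [map_pow]; exact pow_ne_zero _ hv)
    (by rw [map_smul, map_pow]; exact smul_ne_zero hz (pow_ne_zero _ hu)) h1
  omega

end Substitution

/-! ## Division by the equations of the simple singularities -/

section Division

theorem exists_division_quadric {s s' : Fin 2} (h : s ≠ s') {M : ℕ} (hM : M ≠ 0)
    (f : ConvergentPowerSeries (Fin 2)) :
    ∃ (a b : Ct) (q : ConvergentPowerSeries (Fin 2)), f = renameHom (axis s') a +
      coord s * renameHom (axis s') b + (coord s ^ 2 + coord s' ^ M) * q := by
  have hcf : ∀ j, cf (Finsupp.single s j) (coord s ^ 2 + coord s' ^ M) =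
      if j = 2 then 1 else 0 := by
    intro j
    change coeff _ ((X s : MvPowerSeries (Fin 2) ℂ) ^ 2 + X s' ^ M) = _
    rw [map_add, coeff_X_pow, coeff_X_pow, if_neg (c := Finsupp.single s j = Finsupp.single s' M), add_zero]
    · simp only [(Finsupp.single_injective s).eq_iff]
    · intro h1
      have := DFunLike.congr_fun h1 s'
      rw [Finsupp.single_eq_same, Finsupp.single_eq_of_ne h.symm] at this
      exact hM this.symm
  obtain ⟨c, q, hc⟩ := weierstrass_division (axis s') s
    (fun i => by rw [mem_range_axis]; omega) 2 (coord s ^ 2 + coord s' ^ M) f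
    (fun j hj => by rw [hcf, if_neg (by omega)]) (by rw [hcf, if_pos rfl]; exact one_ne_zero)
  rw [Finset.sum_range_succ, Finset.sum_range_one, pow_zero, one_mul, pow_one] at hc
  exact ⟨c 0, c 1, q, hc⟩

theorem exists_division_coord (f : ConvergentPowerSeries (Fin 2)) :
    ∃ (p : Ct) (q : ConvergentPowerSeries (Fin 2)), f = renameHom (axis 0) p + coord 1 * q := by
  have hcf : ∀ j, cf (Finsupp.single (1 : Fin 2) j) (coord 1) = if j = 1 then 1 else 0 := by
    intro j
    change coeff _ (X 1 : MvPowerSeries (Fin 2) ℂ) = _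
    rw [coeff_X]
    simp only [(Finsupp.single_injective (1 : Fin 2)).eq_iff]
  obtain ⟨c, q, hc⟩ := weierstrass_division (axis 0) 1
    (fun i => by rw [mem_range_axis]; omega) 1 (coord 1) f
    (fun j hj => by rw [hcf, if_neg (by omega)]) (by rw [hcf, if_pos rfl]; exact one_ne_zero)
  rw [Finset.sum_range_one, pow_zero, one_mul] at hc
  exact ⟨c 0, q, hc⟩

/-- The equation factors as `y (x ^ 2 + y ^ M)`: division by `y` is followed by division of the
quotient by the second factor. -/
theorem exists_division_germD {M : ℕ} (hM : M ≠ 0) (f : ConvergentPowerSeries (Fin 2)) :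
    ∃ (p a b : Ct) (q : ConvergentPowerSeries (Fin 2)), f = renameHom (axis 0) p +
      coord 1 * (renameHom (axis 1) a + coord 0 * renameHom (axis 1) b) +
        (coord 0 ^ 2 * coord 1 + coord 1 ^ (M + 1)) * q := by
  obtain ⟨p, f₁, hf₁⟩ := exists_division_coord f
  obtain ⟨a, b, q, hq⟩ := exists_division_quadric (s := 0) (s' := 1) (by decide) hM f₁
  refine ⟨p, a, b, q, ?_⟩
  rw [hf₁, hq]
  ring

end Division

/-! ## Parametrizations of the simple singularities -/

section Simple

variable {ι : Type v} (Φ : ConvergentPowerSeries (Fin 2) →ₐ[ℂ] (ι → Ct))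

/-- The substitution of a coordinate along one branch. -/
def along (s : Fin 2) (i : ι) : Ct →ₐ[ℂ] Ct :=
  (Pi.evalAlgHom ℂ (fun _ : ι => Ct) i).comp (Φ.comp (renameHom (axis s)))

theorem along_apply (s : Fin 2) (i : ι) (f : Ct) :
    along Φ s i f = Φ (renameHom (axis s) f) i := rfl

theorem along_ct (s : Fin 2) (i : ι) : along Φ s i ct = Φ (coord s) i := by
  rw [along_apply, renameHom_axis_ct]

theorem along_injective (s : Fin 2) (i : ι) (h : Φ (coord s) i ≠ 0) :
    Function.Injective (along Φ s i) :=
  Ct.map_injective _ (by rwa [along_ct])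

theorem along_surjective (s : Fin 2) (i : ι) {u : Ct} (hu : constCoeff u ≠ 0)
    (h : Φ (coord s) i = ct * u) : Function.Surjective (along Φ s i) :=
  Ct.map_surjective _ hu (by rwa [along_ct])

variable {Φ}

theorem ne_zero_of_eq_ct_mul {f u : Ct} (hu : constCoeff u ≠ 0) {n : ℕ} (h : f = ct ^ n * u) :
    f ≠ 0 := by
  rw [h]
  refine mul_ne_zero (pow_ne_zero _ ct_ne_zero) ?_
  rintro rfl
  exact hu (map_zero _)

theorem I_smul_pow_sq (k : ℕ) (y : Ct) : (Complex.I • y ^ k) ^ 2 = -y ^ (2 * k) := by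
  rw [smul_pow, Complex.I_sq, neg_one_smul, ← pow_mul, mul_comm]

theorem eq_zero_of_I_smul {k : ℕ} {a b : Ct} (h1 : a + Complex.I • (ct ^ k * b) = 0)
    (h2 : a - Complex.I • (ct ^ k * b) = 0) : a = 0 ∧ b = 0 := by
  have h3 : (2 : ℂ) • a = 0 := by
    rw [two_smul]
    linear_combination h1 + h2
  have h4 : a = 0 := (smul_eq_zero.1 h3).resolve_left two_ne_zero
  refine ⟨h4, ?_⟩
  rw [h4, zero_add] at h1
  exact (mul_eq_zero.1 ((smul_eq_zero.1 h1).resolve_left Complex.I_ne_zero)).resolve_left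
    (pow_ne_zero _ ct_ne_zero)

/-- A parametrization of `D_{2 k + 2}` by three smooth branches. -/
theorem parametrizes_germD_even {k : ℕ} (hk : k ≠ 0) {i₀ i₁ i₂ : ι} (h01 : i₀ ≠ i₁) (h02 : i₀ ≠ i₂)
    (h12 : i₁ ≠ i₂) (hι : ∀ i, i = i₀ ∨ i = i₁ ∨ i = i₂) {u₀ u₁ u₂ : Ct}
    (hu₀ : constCoeff u₀ ≠ 0) (hu₁ : constCoeff u₁ ≠ 0) (hu₂ : constCoeff u₂ ≠ 0)
    (hx₀ : Φ (coord 0) i₀ = ct * u₀) (hy₀ : Φ (coord 1) i₀ = 0)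
    (hy₁ : Φ (coord 1) i₁ = ct * u₁) (hx₁ : Φ (coord 0) i₁ = Complex.I • Φ (coord 1) i₁ ^ k)
    (hy₂ : Φ (coord 1) i₂ = ct * u₂) (hx₂ : Φ (coord 0) i₂ = -(Complex.I • Φ (coord 1) i₂ ^ k)) :
    Parametrizes Φ (coord 0 ^ 2 * coord 1 + coord 1 ^ (2 * k + 1)) := by
  classical
  have hx₀' : Φ (coord 0) i₀ ≠ 0 := ne_zero_of_eq_ct_mul hu₀ (n := 1) (by rw [hx₀, pow_one])
  have hy₁' : Φ (coord 1) i₁ ≠ 0 := ne_zero_of_eq_ct_mul hu₁ (n := 1) (by rw [hy₁, pow_one])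
  have hy₂' : Φ (coord 1) i₂ ≠ 0 := ne_zero_of_eq_ct_mul hu₂ (n := 1) (by rw [hy₂, pow_one])
  have hF : Φ (coord 0 ^ 2 * coord 1 + coord 1 ^ (2 * k + 1)) = 0 := by
    funext i
    rw [map_add, map_mul, map_pow, map_pow, Pi.add_apply, Pi.mul_apply, Pi.pow_apply,
      Pi.pow_apply, Pi.zero_apply]
    rcases hι i with rfl | rfl | rfl
    · rw [hy₀, mul_zero, zero_pow (Nat.succ_ne_zero _), add_zero]
    · rw [hx₁, I_smul_pow_sq]
      ring
    · rw [hx₂, Ct.neg_sq', I_smul_pow_sq]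
      ring
  have hfin : Finite ι := Set.finite_univ_iff.1 (((Set.finite_singleton i₂).insert i₁).insert i₀ |>.subset fun i _ => hι i)
  refine ⟨fun f => ⟨fun hf => ?_, ?_⟩, conductor_of_single Φ fun i => ?_⟩
  -- Only the remainder `p(x) + y (a(y) + x b(y))` matters. The branch `y = 0` gives `p = 0`, and
  -- the two branches `x = ± i y ^ k` give `a ± i y ^ k b = 0`, hence `a = b = 0`.
  · obtain ⟨p, a, b, q, rfl⟩ := exists_division_germD (M := 2 * k) (by omega) f
    rw [map_add, map_mul, hF, zero_mul, add_zero] at hf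
    have hfi : ∀ i, along Φ 0 i p + Φ (coord 1) i *
        (along Φ 1 i a + Φ (coord 0) i * along Φ 1 i b) = 0 := by
      intro i
      have := congrFun hf i
      simp only [map_add, map_mul, Pi.add_apply, Pi.mul_apply] at this
      exact this
    have hp : p = 0 := by
      have h1 := hfi i₀
      rw [hy₀, zero_mul, add_zero] at h1
      exact (map_eq_zero_iff _ (along_injective Φ 0 i₀ hx₀')).1 h1
    have h1 : a + Complex.I • (ct ^ k * b) = 0 := by
      have h1 := hfi i₁
      rw [hp, map_zero, zero_add, hx₁] at h1
      have h2 := (mul_eq_zero.1 h1).resolve_left hy₁'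
      rw [← along_ct, ← map_pow, smul_mul_assoc, ← map_mul, ← map_smul, ← map_add] at h2
      exact (map_eq_zero_iff _ (along_injective Φ 1 i₁ hy₁')).1 h2
    have h2 : a - Complex.I • (ct ^ k * b) = 0 := by
      have h1 := hfi i₂
      rw [hp, map_zero, zero_add, hx₂] at h1
      have h2 := (mul_eq_zero.1 h1).resolve_left hy₂'
      rw [← along_ct, ← map_pow, Ct.neg_mul', smul_mul_assoc, ← map_mul, ← map_smul, ← sub_eq_add_neg,
        ← map_sub] at h2
      exact (map_eq_zero_iff _ (along_injective Φ 1 i₂ hy₂')).1 h2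
    obtain ⟨ha, hb⟩ := eq_zero_of_I_smul h1 h2
    simp only [hp, ha, hb, map_zero, mul_zero, add_zero, zero_add]
    exact dvd_mul_right _ _
  · rintro ⟨q, rfl⟩
    rw [map_mul, hF, zero_mul]
  -- For each branch, the product of the equations of the other two is supported on it alone.
  · rcases hι i with rfl | rfl | rfl
    · refine exists_single_of_surjective Φ i
        (fun g => (along_surjective Φ 0 i hu₀ hx₀ g).imp' _ fun c hc => hc)
        (coord 0 ^ 2 + coord 1 ^ (2 * k)) (fun j hj => ?_) ?_
      · rw [map_add, map_pow, map_pow, Pi.add_apply, Pi.pow_apply, Pi.pow_apply]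
        rcases (hι j).resolve_left hj with rfl | rfl
        · rw [hx₁, I_smul_pow_sq, neg_add_cancel]
        · rw [hx₂, Ct.neg_sq', I_smul_pow_sq, neg_add_cancel]
      · rw [map_add, map_pow, map_pow, Pi.add_apply, Pi.pow_apply, Pi.pow_apply, hy₀,
          zero_pow (by omega), add_zero]
        exact pow_ne_zero _ hx₀'
    · refine exists_single_of_surjective Φ i
        (fun g => (along_surjective Φ 1 i hu₁ hy₁ g).imp' _ fun c hc => hc)
        (coord 1 * (coord 0 + Complex.I • coord 1 ^ k)) (fun j hj => ?_) ?_
      · rw [map_mul, map_add, map_smul, map_pow, Pi.mul_apply, Pi.add_apply, Pi.smul_apply,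
          Pi.pow_apply]
        rcases hι j with rfl | rfl | rfl
        · rw [hy₀, zero_mul]
        · exact absurd rfl hj
        · rw [hx₂, neg_add_cancel, mul_zero]
      · rw [map_mul, map_add, map_smul, map_pow, Pi.mul_apply, Pi.add_apply, Pi.smul_apply,
          Pi.pow_apply, hx₁, ← two_smul ℂ]
        exact mul_ne_zero hy₁' (smul_ne_zero two_ne_zero (smul_ne_zero Complex.I_ne_zero
          (pow_ne_zero _ hy₁')))
    · refine exists_single_of_surjective Φ i
        (fun g => (along_surjective Φ 1 i hu₂ hy₂ g).imp' _ fun c hc => hc)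
        (coord 1 * (coord 0 - Complex.I • coord 1 ^ k)) (fun j hj => ?_) ?_
      · rw [map_mul, map_sub, map_smul, map_pow, Pi.mul_apply, Pi.sub_apply, Pi.smul_apply,
          Pi.pow_apply]
        rcases hι j with rfl | rfl | rfl
        · rw [hy₀, zero_mul]
        · rw [hx₁, sub_self, mul_zero]
        · exact absurd rfl hj
      · rw [map_mul, map_sub, map_smul, map_pow, Pi.mul_apply, Pi.sub_apply, Pi.smul_apply,
          Pi.pow_apply, hx₂, ← neg_add', ← two_smul ℂ]
        exact mul_ne_zero hy₂' (neg_ne_zero.2 (smul_ne_zero two_ne_zero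
          (smul_ne_zero Complex.I_ne_zero (pow_ne_zero _ hy₂'))))

/-- A parametrization of `D_{2 p + 3}` by a smooth and a cuspidal branch. -/
theorem parametrizes_germD_odd {p : ℕ} {i₀ i₁ : ι} (h01 : i₀ ≠ i₁)
    (hι : ∀ i, i = i₀ ∨ i = i₁) {u₀ u₁ : Ct}
    (hu₀ : constCoeff u₀ ≠ 0) (hu₁ : constCoeff u₁ ≠ 0)
    (hx₀ : Φ (coord 0) i₀ = ct * u₀) (hy₀ : Φ (coord 1) i₀ = 0)
    (hy₁ : Φ (coord 1) i₁ = ct ^ 2 * u₁)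
    (hx₁ : Φ (coord 0) i₁ ^ 2 = -Φ (coord 1) i₁ ^ (2 * p + 1)) :
    Parametrizes Φ (coord 0 ^ 2 * coord 1 + coord 1 ^ (2 * p + 2)) := by
  classical
  have hx₀' : Φ (coord 0) i₀ ≠ 0 := ne_zero_of_eq_ct_mul hu₀ (n := 1) (by rw [hx₀, pow_one])
  have hy₁' : Φ (coord 1) i₁ ≠ 0 := ne_zero_of_eq_ct_mul hu₁ hy₁
  have hF : Φ (coord 0 ^ 2 * coord 1 + coord 1 ^ (2 * p + 2)) = 0 := by
    funext i
    rw [map_add, map_mul, map_pow, map_pow, Pi.add_apply, Pi.mul_apply, Pi.pow_apply,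
      Pi.pow_apply, Pi.zero_apply]
    rcases hι i with rfl | rfl
    · rw [hy₀, mul_zero, zero_pow (Nat.succ_ne_zero _), add_zero]
    · rw [hx₁]
      ring
  have hinj := along_injective Φ 1 i₁ hy₁'
  have hfin : Finite ι := Set.finite_univ_iff.1 ((Set.finite_singleton i₁).insert i₀ |>.subset fun i _ => hι i)
  refine ⟨fun f => ⟨fun hf => ?_, ?_⟩, conductor_of_single Φ fun i => ?_⟩
  · obtain ⟨g, a, b, q, rfl⟩ := exists_division_germD (M := 2 * p + 1) (by omega) f
    rw [map_add, map_mul, hF, zero_mul, add_zero] at hf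
    have hfi : ∀ i, along Φ 0 i g + Φ (coord 1) i *
        (along Φ 1 i a + Φ (coord 0) i * along Φ 1 i b) = 0 := by
      intro i
      have := congrFun hf i
      simp only [map_add, map_mul, Pi.add_apply, Pi.mul_apply] at this
      exact this
    have hg : g = 0 := by
      have h1 := hfi i₀
      rw [hy₀, zero_mul, add_zero] at h1
      exact (map_eq_zero_iff _ (along_injective Φ 0 i₀ hx₀')).1 h1
    have h1 : along Φ 1 i₁ a + Φ (coord 0) i₁ * along Φ 1 i₁ b = 0 := by
      have h1 := hfi i₁
      rw [hg, map_zero, zero_add] at h1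
      exact (mul_eq_zero.1 h1).resolve_left hy₁'
    -- Squaring removes `x` and leaves an identity in `y` whose sides have orders of different
    -- parity unless `b = 0`.
    have h2 : a ^ 2 = (-1 : ℂ) • (ct ^ (2 * p + 1) * b ^ 2) := by
      apply hinj
      rw [neg_one_smul, map_neg, map_mul, map_pow, map_pow, map_pow, along_ct]
      have h3 : along Φ 1 i₁ a = -(Φ (coord 0) i₁ * along Φ 1 i₁ b) := eq_neg_of_add_eq_zero_left h1
      rw [h3, Ct.neg_sq', mul_pow, hx₁]
      ring
    have hb := Ct.eq_zero_of_sq_eq p (-1) (by norm_num) h2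
    have ha : a = 0 := by
      rw [hb, zero_pow two_ne_zero, mul_zero, smul_zero] at h2
      exact eq_zero_of_pow_eq_zero h2
    simp only [hg, ha, hb, map_zero, mul_zero, add_zero, zero_add]
    exact dvd_mul_right _ _
  · rintro ⟨q, rfl⟩
    rw [map_mul, hF, zero_mul]
  · rcases hι i with rfl | rfl
    · refine exists_single_of_surjective Φ i
        (fun g => (along_surjective Φ 0 i hu₀ hx₀ g).imp' _ fun c hc => hc)
        (coord 0 ^ 2 + coord 1 ^ (2 * p + 1)) (fun j hj => ?_) ?_
      · obtain rfl := (hι j).resolve_left hj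
        rw [map_add, map_pow, map_pow, Pi.add_apply, Pi.pow_apply, Pi.pow_apply, hx₁,
          neg_add_cancel]
      · rw [map_add, map_pow, map_pow, Pi.add_apply, Pi.pow_apply, Pi.pow_apply, hy₀,
          zero_pow (by omega), add_zero]
        exact pow_ne_zero _ hx₀'
    · have hy : along Φ 1 i ct = ct ^ 2 * u₁ := by rw [along_ct, hy₁]
      obtain ⟨d₀, d₁, hd⟩ := Ct.exists_eq_add_mul_map _ hu₁ hy (Φ (coord 0) i)
      -- Were `x` a series in `y` on the cuspidal branch, its square would have even order in `y`.
      have hd₁ : d₁ ≠ 0 := by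
        rintro rfl
        rw [map_zero, mul_zero, add_zero] at hd
        have h1 : d₀ ^ 2 = (-1 : ℂ) • (ct ^ (2 * p + 1) * 1 ^ 2) := by
          apply hinj
          rw [map_pow, ← hd, hx₁, neg_one_smul, map_neg, one_pow, mul_one, map_pow, along_ct]
        exact one_ne_zero (Ct.eq_zero_of_sq_eq p (-1) (by norm_num) h1)
      obtain ⟨s, w, hw, rfl⟩ := exists_eq_ct_pow_mul hd₁
      obtain ⟨w', hw'⟩ := (isUnit_of_constCoeff hw).exists_left_inv
      obtain ⟨v, hv⟩ := (isUnit_of_constCoeff hu₁).exists_left_inv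
      -- On the cusp `x - d₀(y)` is `t y ^ s` times a unit series in `y`, so elements `y ^ (s + 1)
      -- (a(y) + t b(y))` are available; the extra factor `y` kills the smooth branch. As `y` has
      -- order two, this gives the exponent `2 (s + 1)`.
      refine ⟨2 * (s + 1), fun g => ?_⟩
      obtain ⟨a, b, hg⟩ := Ct.exists_eq_add_mul_map _ hu₁ hy (v ^ (s + 1) * g)
      refine ⟨coord 1 * (coord 1 ^ s * renameHom (axis 1) a +
        renameHom (axis 1) (w' * b) * (coord 0 - renameHom (axis 1) d₀)), funext fun j => ?_⟩
      simp only [map_add, map_mul, map_sub, map_pow, Pi.mul_apply, Pi.add_apply, Pi.pow_apply,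
        Pi.sub_apply, ← along_apply]
      by_cases hj : j = i
      · subst hj
        have h1 : along Φ 1 j w' * along Φ 1 j w = 1 := by rw [← map_mul, hw', map_one]
        rw [map_mul, map_pow, along_ct] at hd
        rw [Pi.single_eq_same, hd]
        have h2 : ct ^ (2 * (s + 1)) * g = Φ (coord 1) j ^ (s + 1) * (v ^ (s + 1) * g) := by
          rw [hy₁, mul_pow, ← pow_mul]
          have h3 : v ^ (s + 1) * u₁ ^ (s + 1) = 1 := by rw [← mul_pow, hv, one_pow]
          linear_combination (-(ct ^ (2 * (s + 1)) * g)) * h3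
        rw [h2, hg]
        linear_combination (Φ (coord 1) j ^ (s + 1) * ct * along Φ 1 j b) * h1
      · obtain rfl := (hι j).resolve_right hj
        rw [hy₀, zero_mul, Pi.single_eq_of_ne hj]

/-- A parametrization of `A_{2 k - 1}` by two smooth branches. -/
theorem ker_germA_odd {k : ℕ} (hk : k ≠ 0) {i₁ i₂ : ι} (hι : ∀ i, i = i₁ ∨ i = i₂)
    (hx₁ : Φ (coord 0) i₁ ≠ 0) (hy₁ : Φ (coord 1) i₁ = Complex.I • Φ (coord 0) i₁ ^ k)
    (hx₂ : Φ (coord 0) i₂ ≠ 0) (hy₂ : Φ (coord 1) i₂ = -(Complex.I • Φ (coord 0) i₂ ^ k)) (f) :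
    Φ f = 0 ↔ coord 0 ^ (2 * k) + coord 1 ^ 2 ∣ f := by
  have hF : Φ (coord 0 ^ (2 * k) + coord 1 ^ 2) = 0 := by
    funext i
    rw [map_add, map_pow, map_pow, Pi.add_apply, Pi.pow_apply, Pi.pow_apply, Pi.zero_apply]
    rcases hι i with rfl | rfl
    · rw [hy₁, I_smul_pow_sq, add_neg_cancel]
    · rw [hy₂, Ct.neg_sq', I_smul_pow_sq, add_neg_cancel]
  constructor
  · intro hf
    obtain ⟨a, b, q, rfl⟩ := exists_division_quadric (s := 1) (s' := 0) (by decide)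
      (M := 2 * k) (by omega) f
    rw [add_comm (coord 1 ^ 2), map_add, map_mul, hF, zero_mul, add_zero] at hf
    have hfi : ∀ i, along Φ 0 i a + Φ (coord 1) i * along Φ 0 i b = 0 := by
      intro i
      have := congrFun hf i
      simp only [map_add, map_mul, Pi.add_apply, Pi.mul_apply] at this
      exact this
    have h1 : a + Complex.I • (ct ^ k * b) = 0 := by
      have h2 := hfi i₁
      rw [hy₁, ← along_ct, ← map_pow, smul_mul_assoc, ← map_mul, ← map_smul, ← map_add] at h2
      exact (map_eq_zero_iff _ (along_injective Φ 0 i₁ hx₁)).1 h2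
    have h2 : a - Complex.I • (ct ^ k * b) = 0 := by
      have h2 := hfi i₂
      rw [hy₂, ← along_ct, ← map_pow, Ct.neg_mul', smul_mul_assoc, ← map_mul, ← map_smul,
        ← sub_eq_add_neg, ← map_sub] at h2
      exact (map_eq_zero_iff _ (along_injective Φ 0 i₂ hx₂)).1 h2
    obtain ⟨ha, hb⟩ := eq_zero_of_I_smul h1 h2
    rw [ha, hb, map_zero, mul_zero, zero_add, zero_add, add_comm (coord 1 ^ 2)]
    exact dvd_mul_right _ _
  · rintro ⟨q, rfl⟩
    rw [map_mul, hF, zero_mul]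

end Simple

/-! ## Germs of multiplicity three with independent leading coefficients -/

section Series

/-- Hensel's lemma through Weierstrass preparation: `(X + c) ^ 2 - u` has a simple root at the
origin, so its Weierstrass polynomial is linear. -/
theorem exists_sq_eq {u : Ct} (hu : constCoeff u ≠ 0) : ∃ r, constCoeff r ≠ 0 ∧ r ^ 2 = u := by
  obtain ⟨c, hc⟩ := IsAlgClosed.exists_pow_nat_eq (constCoeff u) two_pos
  have hc0 : c ≠ 0 := by
    rintro rfl
    exact hu (by rw [← hc, zero_pow two_ne_zero])
  let C : Ct := algebraMap ℂ Ct c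
  have hC : constCoeff C = c := constCoeff.commutes c
  let G : Polynomial Ct := (Polynomial.X + Polynomial.C C) ^ 2 - Polynomial.C u
  have hG : G = Polynomial.X ^ 2 + Polynomial.C (2 * C) * Polynomial.X +
      Polynomial.C (C ^ 2 - u) := by
    simp only [G, map_sub, map_pow, map_mul, map_ofNat]
    ring
  have hG0 : G.coeff 0 = C ^ 2 - u := by
    rw [hG, Polynomial.coeff_add, Polynomial.coeff_C_zero]
    simp
  have hG1 : G.coeff 1 = 2 * C := by
    rw [hG, Polynomial.coeff_add, Polynomial.coeff_C_succ]
    simp [Polynomial.coeff_X_pow]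
  obtain ⟨W, hW, hWd, hWc, hroot⟩ := exists_weierstrass_polynomial G 1
    (fun j hj => by
      obtain rfl : j = 0 := by omega
      rw [hG0, map_sub, map_pow, hC, hc, sub_self])
    (by
      rw [hG1, map_mul, hC, map_ofNat]
      exact mul_ne_zero two_ne_zero hc0)
  have hy : constCoeff (-W.coeff 0) = 0 := by rw [map_neg, hWc 0 one_pos, neg_zero]
  have h1 := hroot ct (-W.coeff 0) constCoeff_ct hy (by
    have h0 := hW.eq_X_add_C hWd
    generalize W.coeff 0 = w at h0
    rw [h0, Polynomial.eval₂_add, Polynomial.eval₂_X, Polynomial.eval₂_C]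
    change -w + evalAt ct constCoeff_ct w = 0
    rw [evalAt_ct_self, neg_add_cancel])
  refine ⟨-W.coeff 0 + C, ?_, ?_⟩
  · rw [map_add, hy, zero_add, hC]
    exact hc0
  · simp only [G, Polynomial.eval₂_sub, Polynomial.eval₂_pow, Polynomial.eval₂_add,
      Polynomial.eval₂_X, Polynomial.eval₂_C] at h1
    change (_ + evalAt ct constCoeff_ct C) ^ 2 - evalAt ct constCoeff_ct u = 0 at h1
    rw [evalAt_ct_self, evalAt_ct_self] at h1
    exact sub_eq_zero.1 h1

/-- A substitution of zero. -/
theorem Ct.map_eq_algebraMap {S : Type*} [CommRing S] [Algebra ℂ S] (φ : Ct →ₐ[ℂ] S)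
    (h : φ ct = 0) (f : Ct) : φ f = algebraMap ℂ S (constCoeff f) := by
  have h1 : ct ∣ f - algebraMap ℂ Ct (constCoeff f) := by
    rw [ct_dvd_iff, map_sub, AlgHom.commutes]
    exact sub_self _
  obtain ⟨q, hq⟩ := h1
  have h2 := congrArg φ hq
  rw [map_sub, map_mul, h, zero_mul, AlgHom.commutes] at h2
  exact sub_eq_zero.1 h2

/-- If `s` is a parameter whose square is the image of the coordinate, then every series is the sum
of an even and an odd part with respect to `s`. -/
theorem Ct.exists_eq_add_mul_of_sq (φ : Ct →ₐ[ℂ] Ct) {r : Ct} (hr : constCoeff r ≠ 0)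
    (hs : (ct * r) ^ 2 = φ ct) (z : Ct) : ∃ a b, z = φ a + (ct * r) * φ b := by
  let ψ : Ct →ₐ[ℂ] Ct := evalAt (ct * r) (by rw [map_mul, constCoeff_ct, zero_mul])
  have hψ : ψ ct = ct * r := evalAt_ct _ _
  let ρ : Ct →ₐ[ℂ] Ct :=
    evalAt (ct ^ 2) (by rw [map_pow, constCoeff_ct, zero_pow two_ne_zero])
  have hρ : ρ ct = ct ^ 2 := evalAt_ct _ _
  obtain ⟨c, rfl⟩ := Ct.map_surjective ψ hr hψ z
  obtain ⟨a, b, rfl⟩ := Ct.exists_eq_add_mul_map ρ (u := 1)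
    (by rw [map_one]; exact one_ne_zero) (by rw [hρ, mul_one]) c
  have h1 : ∀ p, ψ (ρ p) = φ p := fun p => DFunLike.congr_fun (Ct.hom_ext
    (φ := ψ.comp ρ) (ψ := φ) (by rw [AlgHom.comp_apply, hρ, map_pow, hψ, hs])) p
  exact ⟨a, b, by rw [map_add, map_mul, hψ, h1, h1]⟩

theorem eq_ct_pow_mul_of_dvd {n : ℕ} {f : Ct} (h : ct ^ n ∣ f) (h' : ¬ ct ^ (n + 1) ∣ f) :
    ∃ u, constCoeff u ≠ 0 ∧ f = ct ^ n * u := by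
  obtain ⟨u, rfl⟩ := h
  refine ⟨u, fun h0 => h' ?_, rfl⟩
  rw [pow_succ]
  exact mul_dvd_mul_left _ (ct_dvd_iff.2 h0)

end Series

/-! ### Leading coefficients of nonunits along the branches. -/

namespace IsBranchModel

variable {O : Type u} [CommRing O] [Algebra ℂ O] [IsLocalRing O]
  {θ : O →ₐ[ℂ] (Branch O → Ct)}

theorem not_isUnit_add (h : IsBranchModel θ) (i : Branch O) {f g : O} (hf : ¬ IsUnit f)
    (hg : ¬ IsUnit g) : ¬ IsUnit (f + g) := by
  rw [h.isUnit_iff i, not_not] at hf hg ⊢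
  rw [map_add, Pi.add_apply, map_add, hf, hg, add_zero]

theorem not_isUnit_smul (h : IsBranchModel θ) (i : Branch O) (c : ℂ) {f : O} (hf : ¬ IsUnit f) :
    ¬ IsUnit (c • f) := by
  rw [h.isUnit_iff i, not_not] at hf ⊢
  rw [map_smul, Pi.smul_apply, map_smul, hf, smul_zero]

/-- The leading coefficient of a nonunit along a branch. -/
def leading (θ : O →ₐ[ℂ] (Branch O → Ct)) (i : Branch O) : O →ₗ[ℂ] ℂ :=
  ((ctCoeff (multiplicity O i)).comp (LinearMap.proj i)).comp θ.toLinearMap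

theorem dvd_iff_leading (h : IsBranchModel θ) (i : Branch O) {f : O} (hf : ¬ IsUnit f) :
    ct ^ (multiplicity O i + 1) ∣ θ f i ↔ leading θ i f = 0 :=
  ct_pow_succ_dvd_iff (h.multiplicity_dvd i hf)

theorem exists_leading_ne_zero (h : IsBranchModel θ) (i : Branch O) :
    ∃ f, ¬ IsUnit f ∧ leading θ i f ≠ 0 := by
  obtain ⟨f, hf, hfi⟩ := h.exists_not_dvd i
  exact ⟨f, hf, fun h0 => hfi ((h.dvd_iff_leading i hf).2 h0)⟩

theorem sameLeading_iff (h : IsBranchModel θ) (i j : Branch O) :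
    SameLeading θ i j ↔ ∀ f, ¬ IsUnit f → (leading θ i f = 0 ↔ leading θ j f = 0) :=
  forall_congr' fun f => imp_congr_right fun hf => by
    rw [h.dvd_iff_leading i hf, h.dvd_iff_leading j hf]

/-- Two nonzero functionals with different kernels: a function in the kernel of the first but not of
the second is obtained, if necessary, by subtracting a multiple. -/
theorem exists_leading_eq_zero (h : IsBranchModel θ) {i j : Branch O}
    (hij : ¬ SameLeading θ i j) :
    ∃ g, ¬ IsUnit g ∧ leading θ i g = 0 ∧ leading θ j g ≠ 0 := by
  rw [h.sameLeading_iff] at hij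
  push Not at hij
  obtain ⟨f, hf, ⟨h1, h2⟩ | ⟨h1, h2⟩⟩ := hij
  · exact ⟨f, hf, h1, h2⟩
  · obtain ⟨g, hg, hgj⟩ := h.exists_leading_ne_zero j
    refine ⟨g + (-(leading θ i g / leading θ i f)) • f,
      h.not_isUnit_add i hg (h.not_isUnit_smul i _ hf), ?_, ?_⟩
    · rw [map_add, map_smul, smul_eq_mul]
      field_simp
      ring
    · rwa [map_add, map_smul, h2, smul_zero, add_zero]

/-- A vector space is not the union of two proper subspaces, applied in the kernel of the leading
coefficient along `i`. -/
theorem exists_leading_eq_zero₂ (h : IsBranchModel θ) {i j k : Branch O}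
    (hij : ¬ SameLeading θ i j) (hik : ¬ SameLeading θ i k) :
    ∃ g, ¬ IsUnit g ∧ leading θ i g = 0 ∧ leading θ j g ≠ 0 ∧ leading θ k g ≠ 0 := by
  obtain ⟨g₁, hg₁, h1, h2⟩ := h.exists_leading_eq_zero hij
  obtain ⟨g₂, hg₂, h3, h4⟩ := h.exists_leading_eq_zero hik
  by_cases h5 : leading θ k g₁ = 0
  · by_cases h6 : leading θ j g₂ = 0
    · refine ⟨g₁ + g₂, h.not_isUnit_add i hg₁ hg₂, ?_, ?_, ?_⟩
      · rw [map_add, h1, h3, add_zero]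
      · rwa [map_add, h6, add_zero]
      · rwa [map_add, h5, zero_add]
    · exact ⟨g₂, hg₂, h3, h6, h4⟩
  · exact ⟨g₁, hg₁, h1, h2, h5⟩

/-- A germ is a ring over which convergent power series can be evaluated. -/
theorem _root_.CurveGerm.IsReducedCurveGerm.exists_eval {O : Type u} [CommRing O] [Algebra ℂ O]
    (hO : IsReducedCurveGerm O) {τ : Type*} [Finite τ] (a : τ → O) (ha : ∀ j, ¬ IsUnit (a j)) :
    ∃ E : ConvergentPowerSeries τ →ₐ[ℂ] O, ∀ j, E (coord j) = a j := by
  obtain ⟨N, π, hπ⟩ := hO.exists_presentation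
  exact exists_evalHom π hπ a ha

/-- If `g` vanishes to second order along a smooth branch where `f` is a parameter, then `g` can be
modified by a power series of order two in `f` so as to vanish along this branch. -/
theorem exists_vanishing (h : IsBranchModel θ) (hO : IsReducedCurveGerm O) {i₀ : Branch O}
    {f g : O} (hf : ¬ IsUnit f) (hg : ¬ IsUnit g) {u : Ct} (hu : constCoeff u ≠ 0)
    (hfu : θ f i₀ = ct * u) (hgi : ct ^ 2 ∣ θ g i₀) :
    ∃ y, ¬ IsUnit y ∧ θ y i₀ = 0 ∧ ∀ j, leading θ j y = leading θ j g := by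
  obtain ⟨E, hE⟩ := hO.exists_eval (fun _ : Unit => f) fun _ => hf
  have hEct : E ct = f := hE ()
  let φ : Branch O → Ct →ₐ[ℂ] Ct := fun i =>
    (Pi.evalAlgHom ℂ (fun _ : Branch O => Ct) i).comp (θ.comp E)
  have hφ : ∀ i p, φ i p = θ (E p) i := fun _ _ => rfl
  have hφct : φ i₀ ct = ct * u := by rw [hφ, hEct, hfu]
  obtain ⟨P, hP⟩ := Ct.map_surjective (φ i₀) hu hφct (θ g i₀)
  obtain ⟨q, rfl⟩ : ct ^ 2 ∣ P := by
    have h1 : ct ∣ P := by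
      rw [ct_dvd_iff, ← constCoeff_map (φ i₀), hP, ← ct_dvd_iff]
      exact (dvd_pow_self ct two_ne_zero).trans hgi
    obtain ⟨P₁, rfl⟩ := h1
    rw [sq]
    refine mul_dvd_mul_left _ ?_
    rw [ct_dvd_iff, ← constCoeff_map (φ i₀), ← ct_dvd_iff]
    rw [← hP, map_mul, hφct, sq, mul_assoc] at hgi
    have h2 := (mul_dvd_mul_iff_left ct_ne_zero).1 hgi
    refine (prime_ct.dvd_mul.1 h2).resolve_left fun h3 => hu (ct_dvd_iff.1 h3)
  have hEP : E (ct ^ 2 * q) = f ^ 2 * E q := by rw [map_mul, map_pow, hEct]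
  have hu2 : ¬ IsUnit (f ^ 2 * E q) := fun h3 =>
    hf ((isUnit_pow_iff two_ne_zero).1 (isUnit_of_mul_isUnit_left h3))
  refine ⟨g + (-1 : ℂ) • (f ^ 2 * E q), h.not_isUnit_add i₀ hg (h.not_isUnit_smul i₀ _ hu2), ?_,
    fun j => ?_⟩
  · rw [map_add, map_smul, Pi.add_apply, Pi.smul_apply, ← hEP, ← hφ, hP, neg_one_smul,
      add_neg_cancel]
  · have h4 : leading θ j (f ^ 2 * E q) = 0 := by
      rw [← h.dvd_iff_leading j hu2, map_mul, map_pow, Pi.mul_apply, Pi.pow_apply]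
      refine Dvd.dvd.mul_right ?_ _
      have h5 := pow_dvd_pow_of_dvd (h.multiplicity_dvd j hf) 2
      rw [← pow_mul] at h5
      refine (pow_dvd_pow ct ?_).trans h5
      have := h.one_le_multiplicity j
      omega
    rw [map_add, map_smul, h4, smul_zero, add_zero]

/-- A germ with two branches, of multiplicities one and two, with independent leading coefficients,
dominates some `D_n` with `n` odd. -/
theorem exists_dominates_germD_of_two (h : IsBranchModel θ) (hO : IsReducedCurveGerm O)
    {i₀ j : Branch O} (hne : i₀ ≠ j) (hι : ∀ i, i = i₀ ∨ i = j)
    (hm₀ : multiplicity O i₀ = 1) (hmj : multiplicity O j = 2) (hs : ¬ SameLeading θ i₀ j) :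
    ∃ n, 4 ≤ n ∧ BirationallyDominates O (GermD n) := by
  classical
  have := h.finite
  obtain ⟨f, hf, hf0⟩ := h.exists_leading_ne_zero i₀
  obtain ⟨g, hg, hg0, hgj⟩ := h.exists_leading_eq_zero hs
  obtain ⟨u₀, hu₀, hfu⟩ := eq_ct_pow_mul_of_dvd (h.multiplicity_dvd i₀ hf)
    fun h' => hf0 ((h.dvd_iff_leading i₀ hf).1 h')
  rw [hm₀, pow_one] at hfu
  rw [← h.dvd_iff_leading i₀ hg, hm₀] at hg0
  obtain ⟨y, hy, hy0, hyl⟩ := h.exists_vanishing hO hf hg hu₀ hfu hg0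
  obtain ⟨u, hu, hyu⟩ := eq_ct_pow_mul_of_dvd (h.multiplicity_dvd j hy)
    fun h' => hgj (by rw [← hyl, ← h.dvd_iff_leading j hy]; exact h')
  rw [hmj] at hyu
  -- The parameter `s = t r` satisfies `s ^ 2 = y` on branch `j`.
  obtain ⟨r, hr, hru⟩ := exists_sq_eq hu
  obtain ⟨E, hE⟩ := hO.exists_eval (fun _ : Unit => y) fun _ => hy
  have hEct : E ct = y := hE ()
  let φ : Branch O → Ct →ₐ[ℂ] Ct := fun i =>
    (Pi.evalAlgHom ℂ (fun _ : Branch O => Ct) i).comp (θ.comp E)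
  have hφ : ∀ i p, φ i p = θ (E p) i := fun _ _ => rfl
  have hφ0 : ∀ p, θ (E p) i₀ = algebraMap ℂ Ct (constCoeff p) := fun p =>
    Ct.map_eq_algebraMap (φ i₀) (by rw [hφ, hEct, hy0]) p
  have hφct : φ j ct = ct ^ 2 * u := by rw [hφ, hEct, hyu]
  have hs2 : (ct * r) ^ 2 = φ j ct := by rw [hφct, mul_pow, hru]
  -- The odd part of `x` in `s` must be nonzero. If that of `f` vanishes, a conductor element equal
  -- to `s ^ (2 N + 1) = s y ^ N` on `j` and to `0` on `i₀` is added.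
  obtain ⟨x, a, b, hx, hx0, hxj, hb⟩ : ∃ x a b, ¬ IsUnit x ∧ θ x i₀ = ct * u₀ ∧
      θ x j = φ j a + (ct * r) * φ j b ∧ b ≠ 0 := by
    obtain ⟨a, b, hab⟩ := Ct.exists_eq_add_mul_of_sq (φ j) hr hs2 (θ f j)
    by_cases hb : b = 0
    · obtain ⟨N, hN⟩ := h.conductor_of_le
      obtain ⟨z, hz⟩ := hN (2 * N + 1) (by omega) (Pi.single j (r ^ (2 * N + 1)))
      replace hz : ∀ i, θ z i = ct ^ (2 * N + 1) *
        (Pi.single j (r ^ (2 * N + 1)) : Branch O → Ct) i := congrFun hz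
      have hz0 : θ z i₀ = 0 := by rw [hz, Pi.single_eq_of_ne hne, mul_zero]
      refine ⟨f + z, a, ct ^ N, ?_, ?_, ?_, pow_ne_zero _ ct_ne_zero⟩
      · refine h.not_isUnit_add i₀ hf ?_
        rw [h.isUnit_iff i₀, not_not, hz0, map_zero]
      · rw [map_add, Pi.add_apply, hz0, add_zero, hfu]
      · rw [map_add, Pi.add_apply, hab, hb, map_zero, mul_zero, add_zero, hz, Pi.single_eq_same,
          map_pow, ← hs2]
        ring
    · exact ⟨f, a, b, hf, hfu, hab, hb⟩
  obtain ⟨p, w, hw, rfl⟩ := exists_eq_ct_pow_mul hb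
  obtain ⟨w', hw'⟩ := (isUnit_of_constCoeff hw).exists_left_inv
  have hw'0 : constCoeff w' ≠ 0 := by
    intro h0
    have := congrArg constCoeff hw'
    rw [map_mul, h0, zero_mul, map_one] at this
    exact zero_ne_one this
  have ha0 : constCoeff a = 0 := by
    rw [h.isUnit_iff j, not_not, hxj, map_add, constCoeff_map, map_mul, map_mul, constCoeff_ct,
      zero_mul, zero_mul, add_zero] at hx
    exact hx
  -- Removing the even part and the unit factor leaves `x' = i s y ^ p` on `j`, whence `x' ^ 2 = -y
  -- ^ (2 p + 1)`.
  let x' : O := Complex.I • (E w' * (x - E a))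
  have hx'0 : θ x' i₀ = ct * (u₀ * (Complex.I • algebraMap ℂ Ct (constCoeff w'))) := by
    simp only [x']
    rw [map_smul, map_mul, map_sub, Pi.smul_apply, Pi.mul_apply, Pi.sub_apply, hφ0, hφ0, ha0,
      map_zero, sub_zero, hx0, mul_smul_comm, mul_smul_comm]
    congr 1
    ring
  have hx'j : θ x' j = Complex.I • ((ct * r) * φ j ct ^ p) := by
    simp only [x']
    rw [map_smul, map_mul, map_sub, Pi.smul_apply, Pi.mul_apply, Pi.sub_apply, ← hφ, ← hφ, hxj,
      add_sub_cancel_left, map_mul, map_pow]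
    congr 1
    have h1 : φ j w' * φ j w = 1 := by rw [← map_mul, hw', map_one]
    linear_combination (ct * r * φ j ct ^ p) * h1
  have hx'u : ¬ IsUnit x' := by
    rw [h.isUnit_iff i₀, not_not, hx'0, map_mul, constCoeff_ct, zero_mul]
  -- For `p = 0` the function `x'` would have order one on a branch of multiplicity two.
  have hp : p ≠ 0 := by
    rintro rfl
    have h1 := h.multiplicity_dvd j hx'u
    rw [hmj, hx'j, pow_zero, mul_one, ← mul_smul_comm] at h1
    have h2 := not_ct_pow_succ_dvd (n := 1) (u := Complex.I • r)
      (by rw [map_smul]; exact smul_ne_zero Complex.I_ne_zero hr)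
    rw [pow_one] at h2
    exact h2 h1
  obtain ⟨E₂, hE₂⟩ := hO.exists_eval (![x', y] : Fin 2 → O) fun k => by
    fin_cases k
    exacts [hx'u, hy]
  have hEx : E₂ (coord 0) = x' := hE₂ 0
  have hEy : E₂ (coord 1) = y := hE₂ 1
  refine ⟨2 * p + 3, by omega, ?_⟩
  have hpar : Parametrizes (θ.comp E₂) (coord 0 ^ 2 * coord 1 + coord 1 ^ (2 * p + 2)) := by
    refine parametrizes_germD_odd hne hι
      (u₀ := u₀ * (Complex.I • algebraMap ℂ Ct (constCoeff w'))) (u₁ := u) ?_ hu ?_ ?_ ?_ ?_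
    · rw [map_mul, map_smul, AlgHom.commutes]
      exact mul_ne_zero hu₀ (smul_ne_zero Complex.I_ne_zero hw'0)
    · rw [AlgHom.comp_apply, hEx, hx'0]
    · rw [AlgHom.comp_apply, hEy, hy0]
    · rw [AlgHom.comp_apply, hEy, hyu]
    · rw [AlgHom.comp_apply, AlgHom.comp_apply, hEx, hEy, hx'j, smul_pow, Complex.I_sq,
        neg_one_smul, mul_pow, hs2, hφ, hEct]
      ring
  exact hpar.birationallyDominates h.toIsModel E₂

/-- A germ with three smooth branches, one of which has leading coefficients independent from those
of the two others, dominates some `D_n` with `n` even. -/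
theorem exists_dominates_germD_of_three (h : IsBranchModel θ) (hO : IsReducedCurveGerm O)
    {i₀ j k : Branch O} (h0j : i₀ ≠ j) (h0k : i₀ ≠ k) (hjk : j ≠ k)
    (hι : ∀ i, i = i₀ ∨ i = j ∨ i = k) (hm : ∀ i, multiplicity O i = 1)
    (hsj : ¬ SameLeading θ i₀ j) (hsk : ¬ SameLeading θ i₀ k) :
    ∃ n, 4 ≤ n ∧ BirationallyDominates O (GermD n) := by
  classical
  have := h.finite
  obtain ⟨f, hf, hf0⟩ := h.exists_leading_ne_zero i₀
  obtain ⟨g, hg, hg0, hgj, hgk⟩ := h.exists_leading_eq_zero₂ hsj hsk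
  obtain ⟨u₀, hu₀, hfu⟩ := eq_ct_pow_mul_of_dvd (h.multiplicity_dvd i₀ hf)
    fun h' => hf0 ((h.dvd_iff_leading i₀ hf).1 h')
  rw [hm, pow_one] at hfu
  rw [← h.dvd_iff_leading i₀ hg, hm] at hg0
  obtain ⟨y, hy, hy0, hyl⟩ := h.exists_vanishing hO hf hg hu₀ hfu hg0
  obtain ⟨u₁, hu₁, hyj⟩ := eq_ct_pow_mul_of_dvd (h.multiplicity_dvd j hy)
    fun h' => hgj (by rw [← hyl, ← h.dvd_iff_leading j hy]; exact h')
  obtain ⟨u₂, hu₂, hyk⟩ := eq_ct_pow_mul_of_dvd (h.multiplicity_dvd k hy)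
    fun h' => hgk (by rw [← hyl, ← h.dvd_iff_leading k hy]; exact h')
  rw [hm, pow_one] at hyj hyk
  obtain ⟨E, hE⟩ := hO.exists_eval (fun _ : Unit => y) fun _ => hy
  have hEct : E ct = y := hE ()
  let φ : Branch O → Ct →ₐ[ℂ] Ct := fun i =>
    (Pi.evalAlgHom ℂ (fun _ : Branch O => Ct) i).comp (θ.comp E)
  have hφ : ∀ i p, φ i p = θ (E p) i := fun _ _ => rfl
  have hφ0 : ∀ p, θ (E p) i₀ = algebraMap ℂ Ct (constCoeff p) := fun p =>
    Ct.map_eq_algebraMap (φ i₀) (by rw [hφ, hEct, hy0]) p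
  have hφj : φ j ct = ct * u₁ := by rw [hφ, hEct, hyj]
  have hφk : φ k ct = ct * u₂ := by rw [hφ, hEct, hyk]
  -- On the two other branches `y` is a parameter and `x` equals `a(y)`, respectively `b(y)`. If `a
  -- = b`, a conductor element equal to `y ^ N` on `j` and to `0` elsewhere separates them.
  obtain ⟨x, a, b, hx, hx0, hxj, hxk, hab⟩ : ∃ x a b, ¬ IsUnit x ∧ θ x i₀ = ct * u₀ ∧
      θ x j = φ j a ∧ θ x k = φ k b ∧ a - b ≠ 0 := by
    obtain ⟨a, ha⟩ := Ct.map_surjective (φ j) hu₁ hφj (θ f j)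
    obtain ⟨b, hb⟩ := Ct.map_surjective (φ k) hu₂ hφk (θ f k)
    by_cases hab : a - b = 0
    · obtain ⟨N, hN⟩ := h.conductor
      obtain ⟨z, hz⟩ := hN (Pi.single j (u₁ ^ N))
      replace hz : ∀ i, θ z i = ct ^ N * (Pi.single j (u₁ ^ N) : Branch O → Ct) i := congrFun hz
      have hz0 : θ z i₀ = 0 := by rw [hz, Pi.single_eq_of_ne h0j, mul_zero]
      have hzk : θ z k = 0 := by rw [hz, Pi.single_eq_of_ne hjk.symm, mul_zero]
      refine ⟨f + z, a + ct ^ N, b, ?_, ?_, ?_, ?_, ?_⟩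
      · refine h.not_isUnit_add i₀ hf ?_
        rw [h.isUnit_iff i₀, not_not, hz0, map_zero]
      · rw [map_add, Pi.add_apply, hz0, add_zero, hfu]
      · rw [map_add, Pi.add_apply, map_add, ha, map_pow, hφj, hz, Pi.single_eq_same, mul_pow]
      · rw [map_add, Pi.add_apply, hzk, add_zero, hb]
      · rw [add_sub_right_comm, hab, zero_add]
        exact pow_ne_zero _ ct_ne_zero
    · exact ⟨f, a, b, hf, hfu, ha.symm, hb.symm, hab⟩
  have ha0 : constCoeff a = 0 := by
    rwa [h.isUnit_iff j, not_not, hxj, constCoeff_map] at hx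
  have hb0 : constCoeff b = 0 := by
    rwa [h.isUnit_iff k, not_not, hxk, constCoeff_map] at hx
  obtain ⟨K, w, hw, hK⟩ := exists_eq_ct_pow_mul hab
  have hK0 : K ≠ 0 := by
    rintro rfl
    rw [pow_zero, one_mul] at hK
    rw [← hK, map_sub, ha0, hb0, sub_zero] at hw
    exact hw rfl
  obtain ⟨w', hw'⟩ := (isUnit_of_constCoeff hw).exists_left_inv
  have hw'0 : constCoeff w' ≠ 0 := by
    intro h0
    have := congrArg constCoeff hw'
    rw [map_mul, h0, zero_mul, map_one] at this
    exact zero_ne_one this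
  -- Centring at the mean of `a` and `b` makes the values opposite: `2 x - (a + b)(y)` is `±(a -
  -- b)(y)`, and `w'` normalizes `a - b` to `y ^ K`.
  let x' : O := Complex.I • (E w' * ((2 : ℂ) • x - E (a + b)))
  have hval : ∀ i, θ x' i = Complex.I • (θ (E w') i * ((2 : ℂ) • θ x i - θ (E (a + b)) i)) := by
    intro i
    simp only [x']
    rw [map_smul, map_mul, map_sub, map_smul]
    rfl
  have hx'0 : θ x' i₀ =
      ct * (u₀ * (Complex.I • (2 : ℂ) • algebraMap ℂ Ct (constCoeff w'))) := by
    rw [hval, hφ0, hφ0, map_add, ha0, hb0, add_zero, map_zero, sub_zero, hx0, mul_smul_comm,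
      mul_smul_comm, mul_smul_comm, mul_smul_comm, mul_smul_comm]
    congr 2
    ring
  have hx'j : θ x' j = Complex.I • φ j ct ^ K := by
    rw [hval, ← hφ, ← hφ, hxj]
    congr 1
    rw [two_smul, ← map_add, ← map_sub, ← map_mul, ← map_pow]
    congr 1
    linear_combination w' * hK + ct ^ K * hw'
  have hx'k : θ x' k = -(Complex.I • φ k ct ^ K) := by
    rw [hval, ← hφ, ← hφ, hxk, ← smul_neg]
    congr 1
    rw [two_smul, ← map_add, ← map_sub, ← map_mul, ← map_pow, ← map_neg]
    congr 1
    linear_combination -w' * hK - ct ^ K * hw'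
  have hx'u : ¬ IsUnit x' := by
    rw [h.isUnit_iff i₀, not_not, hx'0, map_mul, constCoeff_ct, zero_mul]
  obtain ⟨E₂, hE₂⟩ := hO.exists_eval (![x', y] : Fin 2 → O) fun k => by
    fin_cases k
    exacts [hx'u, hy]
  have hEx : E₂ (coord 0) = x' := hE₂ 0
  have hEy : E₂ (coord 1) = y := hE₂ 1
  refine ⟨2 * K + 2, by omega, ?_⟩
  have hpar : Parametrizes (θ.comp E₂) (coord 0 ^ 2 * coord 1 + coord 1 ^ (2 * K + 1)) := by
    refine parametrizes_germD_even hK0 h0j h0k hjk hι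
      (u₀ := u₀ * (Complex.I • (2 : ℂ) • algebraMap ℂ Ct (constCoeff w')))
      (u₁ := u₁) (u₂ := u₂) ?_ hu₁ hu₂ ?_ ?_ ?_ ?_ ?_ ?_
    · rw [map_mul, map_smul, map_smul, AlgHom.commutes]
      exact mul_ne_zero hu₀ (smul_ne_zero Complex.I_ne_zero (smul_ne_zero two_ne_zero hw'0))
    · rw [AlgHom.comp_apply, hEx, hx'0]
    · rw [AlgHom.comp_apply, hEy, hy0]
    · rw [AlgHom.comp_apply, hEy, hyj]
    · rw [AlgHom.comp_apply, AlgHom.comp_apply, hEx, hEy, hx'j, hφ, hEct]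
    · rw [AlgHom.comp_apply, hEy, hyk]
    · rw [AlgHom.comp_apply, AlgHom.comp_apply, hEx, hEy, hx'k, hφ, hEct]
  exact hpar.birationallyDominates h.toIsModel E₂

/-- A germ of multiplicity three whose branches do not all have the same leading coefficients
dominates some `D_n`. -/
theorem exists_dominates_germD (h : IsBranchModel θ) (hO : IsReducedCurveGerm O)
    (hm : size (multiplicity O) = 3) {i j : Branch O} (hij : ¬ SameLeading θ i j) :
    ∃ n, 4 ≤ n ∧ BirationallyDominates O (GermD n) := by
  classical
  have := h.finite
  have := Fintype.ofFinite (Branch O)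
  have hsymm : ∀ {i j}, SameLeading θ i j → SameLeading θ j i := fun h f hf => (h f hf).symm
  have htrans : ∀ {i j k}, SameLeading θ i j → SameLeading θ j k → SameLeading θ i k :=
    fun h h' f hf => (h f hf).trans (h' f hf)
  have hne : i ≠ j := by
    rintro rfl
    exact hij fun f _ => Iff.rfl
  rw [size_eq_sum] at hm
  have hone := h.one_le_multiplicity
  by_cases hk : ∃ k, k ≠ i ∧ k ≠ j
  · obtain ⟨k, hki, hkj⟩ := hk
    have hsum : ∀ s : Finset (Branch O), ∑ a ∈ s, multiplicity O a ≤ 3 := fun s =>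
      (Finset.sum_le_sum_of_subset (subset_univ s)).trans hm.le
    have h3 : multiplicity O i + (multiplicity O j + multiplicity O k) ≤ 3 := by
      have := hsum {i, j, k}
      rwa [Finset.sum_insert (by simp [hne, hki.symm]), Finset.sum_pair hkj.symm] at this
    have hall : ∀ l, l = i ∨ l = j ∨ l = k := by
      intro l
      by_contra! hl
      have := hsum {l, i, j, k}
      rw [Finset.sum_insert (by simp [hl]), Finset.sum_insert (by simp [hne, hki.symm]),
        Finset.sum_pair hkj.symm] at this
      have h1 := hone i
      have h2 := hone j
      have h3 := hone k
      have h4 := hone l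
      omega
    have hm1 : ∀ l, multiplicity O l = 1 := by
      intro l
      have h1 := hone i
      have h2 := hone j
      have h4 := hone k
      rcases hall l with rfl | rfl | rfl <;> omega
    -- Among three branches with at least two classes, some branch is inequivalent to both others:
    -- `j` if `i` and `k` are equivalent, and `i` otherwise.
    by_cases hik : SameLeading θ i k
    · exact h.exists_dominates_germD_of_three hO hne.symm hkj.symm hki.symm
        (fun l => by rcases hall l with h | h | h <;> simp [h]) hm1
        (fun h' => hij (hsymm h')) fun h' => hij (htrans hik (hsymm h'))
    · exact h.exists_dominates_germD_of_three hO hne hki.symm hkj.symm hall hm1 hij hik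
  · push Not at hk
    have hall : ∀ l, l = i ∨ l = j := fun l => by
      by_cases hl : l = i
      · exact Or.inl hl
      · exact Or.inr (hk l hl)
    have huniv : (univ : Finset (Branch O)) = {i, j} := by
      ext l
      simpa using hall l
    rw [huniv, Finset.sum_pair hne] at hm
    have h1 := hone i
    have h2 := hone j
    by_cases hmi : multiplicity O i = 1
    · exact h.exists_dominates_germD_of_two hO hne hall hmi (by omega) hij
    · exact h.exists_dominates_germD_of_two hO hne.symm (fun l => (hall l).symm) (by omega)
        (by omega) fun h' => hij (hsymm h')

end IsBranchModel

/-! ## Lower bounds for the Hilbert function -/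

section Independence

/-- Powers of a nonunit are linearly independent modulo a higher power of the coordinate. -/
theorem eq_zero_of_dvd_sum {ι : Type*} [Fintype ι] {e L : ℕ} (he : e ≠ 0) {z u : Ct}
    (hu : constCoeff u ≠ 0) (hz : z = ct ^ e * u) (p : ι → ℕ) (hp : Function.Injective p)
    (hL : ∀ j, e * p j < L) (c : ι → ℂ) (h : ct ^ L ∣ ∑ j, c j • z ^ p j) : c = 0 := by
  rw [ct_pow_dvd_iff_ctCoeff] at h
  have hzp : ∀ n, z ^ n = ct ^ (e * n) * u ^ n := fun n => by rw [hz, mul_pow, pow_mul]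
  -- The powers have distinct orders below `L`, so the coefficients vanish successively by
  -- increasing exponent.
  have key : ∀ n j, p j = n → c j = 0 := by
    intro n
    induction n using Nat.strong_induction_on with
    | _ n ih =>
      intro j hj
      have h1 := h (e * p j) (hL j)
      rw [map_sum, Finset.sum_eq_single j, map_smul, hzp, ctCoeff_ct_pow_mul, map_pow,
        smul_eq_mul] at h1
      · exact (mul_eq_zero.1 h1).resolve_right (pow_ne_zero _ hu)
      · intro i _ hij
        rcases lt_trichotomy (p i) (p j) with h2 | h2 | h2
        · rw [ih (p i) (hj ▸ h2) i rfl, zero_smul, map_zero]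
        · exact absurd (hp h2) hij
        · rw [map_smul, hzp, ct_pow_dvd_iff_ctCoeff.1 (dvd_mul_right (ct ^ (e * p i)) _) _
            (Nat.mul_lt_mul_of_pos_left h2 (Nat.pos_of_ne_zero he)), smul_zero]
      · simp
  exact funext fun j => key _ j rfl

end Independence

namespace IsBranchModel

variable {O : Type u} [CommRing O] [Algebra ℂ O] {θ : O →ₐ[ℂ] (Branch O → Ct)}

theorem le_hilbert (h : IsBranchModel θ) (l : Branch O → ℕ) {i : Branch O} {e : ℕ} (he : e ≠ 0)
    {z : O} {u : Ct} (hu : constCoeff u ≠ 0) (hz : θ z i = ct ^ e * u) (N : ℕ)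
    (hN : ∀ j < N, e * j < l i) : N ≤ hilbert O l := by
  have h1 := h.card_le_hilbert l (fun j : Fin N => z ^ (j : ℕ)) fun c hc => by
    have h2 := hc i
    simp only [map_pow, Pi.pow_apply] at h2
    exact eq_zero_of_dvd_sum he hu hz _ Fin.val_injective (fun j => hN j j.2) c h2
  rwa [Fintype.card_fin] at h1

/-- The powers `x ^ a` with `a < l i` are independent on branch `i`, where `y` vanishes; the powers
`y ^ b` with `1 ≤ b ≤ N` are then independent on branch `j`. The exponent `0` is omitted for `y`
because `1` is already a power of `x`. -/
theorem add_le_hilbert (h : IsBranchModel θ) (l : Branch O → ℕ) {i j : Branch O} {e : ℕ}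
    (he : e ≠ 0) {x y : O} {u v : Ct} (hu : constCoeff u ≠ 0) (hv : constCoeff v ≠ 0)
    (hx : θ x i = ct * u) (hyi : θ y i = 0) (hyj : θ y j = ct ^ e * v) (N : ℕ)
    (hN : e * N < l j) : l i + N ≤ hilbert O l := by
  have h1 := h.card_le_hilbert l
    (Sum.elim (fun a : Fin (l i) => x ^ (a : ℕ)) fun a : Fin N => y ^ ((a : ℕ) + 1)) fun c hc => by
      have h2 := hc i
      simp only [Fintype.sum_sum_type, Sum.elim_inl, Sum.elim_inr, map_pow, Pi.pow_apply, hyi,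
        ne_eq, Nat.succ_ne_zero, not_false_eq_true, zero_pow, smul_zero, sum_const_zero,
        add_zero] at h2
      have h3 := eq_zero_of_dvd_sum one_ne_zero hu (by rw [hx, pow_one]) _ Fin.val_injective
        (fun a => by rw [one_mul]; exact a.2) _ h2
      have h4 := hc j
      simp only [Fintype.sum_sum_type, Sum.elim_inl, Sum.elim_inr, map_pow, Pi.pow_apply] at h4
      rw [Finset.sum_eq_zero fun a _ => by rw [show c (Sum.inl a) = 0 from congrFun h3 a, zero_smul],
        zero_add] at h4
      have h5 := eq_zero_of_dvd_sum he hv hyj (fun a : Fin N => (a : ℕ) + 1)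
        (fun a b hab => Fin.ext (Nat.succ_injective hab))
        (fun a => (Nat.mul_le_mul_left e a.2).trans_lt hN) _ h4
      funext a
      rcases a with a | a
      · exact congrFun h3 a
      · exact congrFun h5 a
  rwa [Fintype.card_sum, Fintype.card_fin, Fintype.card_fin] at h1

/-! ## Germs with two smooth branches -/

/-- A quotient of an analytic algebra by a principal ideal. -/
theorem _root_.CurveGerm.nonempty_algEquiv_quotient {S : Type*} [CommRing S] [Algebra ℂ S] {F : S}
    (E : S →ₐ[ℂ] O) (hE : Function.Surjective E) (hker : ∀ f, E f = 0 ↔ F ∣ f) :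
    Nonempty (O ≃ₐ[ℂ] S ⧸ Ideal.span {F}) := by
  let φ : S ⧸ Ideal.span {F} →ₐ[ℂ] O := Ideal.Quotient.liftₐ _ E fun a ha =>
    (hker a).2 (Ideal.mem_span_singleton.1 ha)
  refine ⟨(AlgEquiv.ofBijective φ ⟨?_, fun g => ?_⟩).symm⟩
  · rw [injective_iff_map_eq_zero]
    intro x hx
    obtain ⟨f, rfl⟩ := Ideal.Quotient.mk_surjective x
    exact Ideal.Quotient.eq_zero_iff_mem.2 (Ideal.mem_span_singleton.2 ((hker f).1 hx))
  · obtain ⟨f, rfl⟩ := hE g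
    exact ⟨Ideal.Quotient.mk _ f, rfl⟩

/-- A germ with two branches of multiplicity one and with a function having nonzero leading
coefficients along both is some `A_n` with `n` odd. -/
theorem exists_equiv_germA [IsLocalRing O] (h : IsBranchModel θ) (hO : IsReducedCurveGerm O)
    {i₁ i₂ : Branch O} (hne : i₁ ≠ i₂) (hι : ∀ i, i = i₁ ∨ i = i₂)
    (hm₁ : multiplicity O i₁ = 1) (hm₂ : multiplicity O i₂ = 1) :
    ∃ n : ℕ, Nonempty (O ≃ₐ[ℂ] GermA n) := by
  classical
  obtain ⟨u, hu, hu1, hu2⟩ : ∃ u, ¬ IsUnit u ∧ leading θ i₁ u ≠ 0 ∧ leading θ i₂ u ≠ 0 := by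
    obtain ⟨f, hf, hf1⟩ := h.exists_leading_ne_zero i₁
    obtain ⟨g, hg, hg2⟩ := h.exists_leading_ne_zero i₂
    by_cases hf2 : leading θ i₂ f = 0
    · by_cases hg1 : leading θ i₁ g = 0
      · refine ⟨f + g, h.not_isUnit_add i₁ hf hg, ?_, ?_⟩
        · rwa [map_add, hg1, add_zero]
        · rwa [map_add, hf2, zero_add]
      · exact ⟨g, hg, hg1, hg2⟩
    · exact ⟨f, hf, hf1, hf2⟩
  obtain ⟨v₁, hv₁, hu1⟩ := eq_ct_pow_mul_of_dvd (h.multiplicity_dvd i₁ hu)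
    fun h' => hu1 ((h.dvd_iff_leading i₁ hu).1 h')
  obtain ⟨v₂, hv₂, hu2⟩ := eq_ct_pow_mul_of_dvd (h.multiplicity_dvd i₂ hu)
    fun h' => hu2 ((h.dvd_iff_leading i₂ hu).1 h')
  rw [hm₁, pow_one] at hu1
  rw [hm₂, pow_one] at hu2
  obtain ⟨E, hE⟩ := hO.exists_eval (fun _ : Unit => u) fun _ => hu
  have hEct : E ct = u := hE ()
  let φ : Branch O → Ct →ₐ[ℂ] Ct := fun i =>
    (Pi.evalAlgHom ℂ (fun _ : Branch O => Ct) i).comp (θ.comp E)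
  have hφ : ∀ i p, φ i p = θ (E p) i := fun _ _ => rfl
  have hs1 : Function.Surjective (φ i₁) := Ct.map_surjective _ hv₁ (by rw [hφ, hEct, hu1])
  have hs2 : Function.Surjective (φ i₂) := Ct.map_surjective _ hv₂ (by rw [hφ, hEct, hu2])
  -- The least order `k` on `i₂` of functions vanishing on `i₁` is the contact order of the two
  -- branches.
  have hex : ∃ k : ℕ, ∃ (f : O) (g : Ct), constCoeff g ≠ 0 ∧ θ f i₁ = 0 ∧
      θ f i₂ = ct ^ k * g := by
    obtain ⟨N, hN⟩ := h.conductor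
    obtain ⟨f, hf⟩ := hN (Pi.single i₂ 1)
    replace hf : ∀ i, θ f i = ct ^ N * (Pi.single i₂ 1 : Branch O → Ct) i := congrFun hf
    refine ⟨N, f, 1, by rw [map_one]; exact one_ne_zero, ?_, ?_⟩
    · rw [hf, Pi.single_eq_of_ne hne, mul_zero]
    · rw [hf, Pi.single_eq_same]
  obtain ⟨f₀, g₀, hg₀, hf₀1, hf₀2⟩ := Nat.find_spec hex
  have hmin := fun n (f : O) (g : Ct) (hg : constCoeff g ≠ 0) (h1 : θ f i₁ = 0)
    (h2 : θ f i₂ = ct ^ n * g) => Nat.find_min' hex (m := n) ⟨f, g, hg, h1, h2⟩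
  generalize Nat.find hex = k at hf₀2 hmin
  obtain ⟨w, hw1, hw2⟩ : ∃ w, θ w i₁ = 0 ∧ θ w i₂ = θ u i₂ ^ k := by
    obtain ⟨g', hg'⟩ := (isUnit_of_constCoeff hg₀).exists_left_inv
    obtain ⟨q, hq⟩ := hs2 (g' * v₂ ^ k)
    refine ⟨f₀ * E q, ?_, ?_⟩
    · rw [map_mul, Pi.mul_apply, hf₀1, zero_mul]
    · rw [map_mul, Pi.mul_apply, hf₀2, ← hφ, hq, hu2, mul_pow]
      linear_combination (ct ^ k * v₂ ^ k) * hg'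
  have hk : k ≠ 0 := by
    rintro rfl
    have h1 : IsUnit w := by
      rw [h.isUnit_iff i₂, hw2, pow_zero, map_one]
      exact one_ne_zero
    rw [h.isUnit_iff i₁, hw1, map_zero] at h1
    exact h1 rfl
  -- A function is matched on `i₁` by a series in `u`; the rest vanishes there, so minimality of `k`
  -- makes it a multiple of `w` on `i₂`.
  have hgen : ∀ f, ∃ p q, f = E p + w * E q := by
    intro f
    obtain ⟨p, hp⟩ := hs1 (θ f i₁)
    have h1 : θ (f - E p) i₁ = 0 := by
      rw [map_sub, Pi.sub_apply, ← hφ, hp, sub_self]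
    obtain ⟨q, hq⟩ : ∃ q, θ (f - E p) i₂ = θ u i₂ ^ k * φ i₂ q := by
      by_cases h2 : θ (f - E p) i₂ = 0
      · exact ⟨0, by rw [h2, map_zero, mul_zero]⟩
      · obtain ⟨n, g, hg, hng⟩ := exists_eq_ct_pow_mul h2
        have hkn := hmin n _ g hg h1 hng
        obtain ⟨v', hv'⟩ := (isUnit_of_constCoeff hv₂).exists_left_inv
        obtain ⟨q, hq⟩ := hs2 (v' ^ k * (ct ^ (n - k) * g))
        refine ⟨q, ?_⟩
        rw [hng, hq, hu2, ← Nat.add_sub_cancel' hkn, Nat.add_sub_cancel_left, pow_add, mul_pow]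
        have h3 : v' ^ k * v₂ ^ k = 1 := by rw [← mul_pow, hv', one_pow]
        linear_combination (-(ct ^ k * ct ^ (n - k) * g)) * h3
    refine ⟨p, q, h.injective (funext fun i => ?_)⟩
    rcases hι i with rfl | rfl
    · rw [map_add, map_mul, Pi.add_apply, Pi.mul_apply, hw1, zero_mul, add_zero, ← hφ, hp]
    · rw [map_add, map_mul, Pi.add_apply, Pi.mul_apply, hw2, ← hφ i q, ← hq, map_sub,
        Pi.sub_apply, add_sub_cancel]
  -- The values of `u ^ k - 2 w` on the two branches are `± u ^ k`; the factor `i` gives the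
  -- equation `u ^ (2 k) + Y ^ 2 = 0`. Conversely `w = (u ^ k + i Y) / 2`, so `u` and `Y` generate.
  let Y : O := Complex.I • (u ^ k - (2 : ℂ) • w)
  have hYval : ∀ i, θ Y i = Complex.I • (θ u i ^ k - (2 : ℂ) • θ w i) := by
    intro i
    simp only [Y]
    rw [map_smul, map_sub, map_pow, map_smul]
    rfl
  have hY1 : θ Y i₁ = Complex.I • θ u i₁ ^ k := by
    rw [hYval, hw1, smul_zero, sub_zero]
  have hY2 : θ Y i₂ = -(Complex.I • θ u i₂ ^ k) := by
    rw [hYval, hw2, ← smul_neg, two_smul]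
    congr 1
    ring
  have hYu : ¬ IsUnit Y := by
    rw [h.isUnit_iff i₁, not_not, hY1, map_smul, map_pow, hu1, map_mul, constCoeff_ct, zero_mul,
      zero_pow hk, smul_zero]
  obtain ⟨E₂, hE₂⟩ := hO.exists_eval (![u, Y] : Fin 2 → O) fun k => by
    fin_cases k
    exacts [hu, hYu]
  have hEx : E₂ (coord 0) = u := hE₂ 0
  have hEy : E₂ (coord 1) = Y := hE₂ 1
  obtain ⟨k, rfl⟩ := Nat.exists_eq_succ_of_ne_zero hk
  refine ⟨2 * k + 1, nonempty_algEquiv_quotient E₂ (fun f => ?_) fun f => ?_⟩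
  · obtain ⟨p, q, rfl⟩ := hgen f
    have hEE : ∀ p, E₂ (renameHom (axis 0) p) = E p := by
      intro p
      apply h.injective
      funext i
      exact DFunLike.congr_fun (Ct.hom_ext (φ := along (θ.comp E₂) 0 i) (ψ := φ i) (by
        rw [along_ct, AlgHom.comp_apply, hEx, hφ, hEct])) p
    refine ⟨renameHom (axis 0) p + (2 : ℂ)⁻¹ • (coord 0 ^ (k + 1) + Complex.I • coord 1) *
      renameHom (axis 0) q, ?_⟩
    rw [map_add, map_mul, map_smul, map_add, map_smul, map_pow, hEE, hEE, hEx, hEy]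
    congr 2
    simp only [Y]
    rw [smul_smul, Complex.I_mul_I, neg_one_smul, neg_sub, add_sub_cancel, smul_smul,
      inv_mul_cancel₀ two_ne_zero, one_smul]
  · have h0 := ker_germA_odd (Φ := θ.comp E₂) (k := k + 1) (Nat.succ_ne_zero k) hι
      (by
        rw [AlgHom.comp_apply, hEx]
        exact ne_zero_of_eq_ct_mul hv₁ (n := 1) (by rw [hu1, pow_one]))
      (by rw [AlgHom.comp_apply, AlgHom.comp_apply, hEx, hEy, hY1])
      (by
        rw [AlgHom.comp_apply, hEx]
        exact ne_zero_of_eq_ct_mul hv₂ (n := 1) (by rw [hu2, pow_one]))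
      (by rw [AlgHom.comp_apply, AlgHom.comp_apply, hEx, hEy, hY2]) f
    rw [AlgHom.comp_apply, map_eq_zero_iff θ h.injective] at h0
    exact h0

/-! ## Germs dominating `D_n` -/

theorem isLeast_weight_and_cycle [IsLocalRing O] (h : IsBranchModel θ)
    (hm : size (multiplicity O) = 3) (hw : ∀ l, -1 ≤ weight O l) {i j : Branch O}
    (hij : ¬ SameLeading θ i j) :
    IsLeast (Set.range (weight O)) (-1) ∧ HasMinimalSpectralCycle O 1 0 := by
  have : Nonempty (Branch O) := ⟨i⟩
  refine ⟨⟨⟨multiplicity O, ?_⟩, ?_⟩, h.hasMinimalSpectralCycle_iff.2 ⟨hm, i, j, hij⟩⟩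
  · rw [h.weight_multiplicity, hm]
    norm_num
  · rintro _ ⟨l, rfl⟩
    exact hw l

theorem multiplicity_eq_one_of_eq [IsLocalRing O] (h : IsBranchModel θ) {i : Branch O} {f : O}
    {u : Ct} (hu : constCoeff u ≠ 0) (hf : θ f i = ct * u) : multiplicity O i = 1 := by
  have hfu : ¬ IsUnit f := by
    rw [h.isUnit_iff i, not_not, hf, map_mul, constCoeff_ct, zero_mul]
  have h1 := h.multiplicity_dvd i hfu
  have h2 := h.one_le_multiplicity i
  by_contra h3
  have h4 := (pow_dvd_pow ct (show 1 + 1 ≤ multiplicity O i by omega)).trans h1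
  refine not_ct_pow_succ_dvd (n := 1) hu ?_
  rwa [pow_one, ← hf]

/-- A vanishing function with a nonzero leading coefficient separates leading coefficients. -/
theorem not_sameLeading [IsLocalRing O] (h : IsBranchModel θ) {i j : Branch O} {y : O}
    (hyi : θ y i = 0) {u : Ct} (hu : constCoeff u ≠ 0)
    (hyj : θ y j = ct ^ multiplicity O j * u) : ¬ SameLeading θ i j := by
  intro hs
  have hyu : ¬ IsUnit y := by
    rw [h.isUnit_iff i, not_not, hyi, map_zero]
  have h1 := (hs y hyu).1 (by rw [hyi]; exact dvd_zero _)
  rw [hyj] at h1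
  exact not_ct_pow_succ_dvd hu h1

/-- If `l_1 ≥ 1`, the sum of `h ≥ l_0 + l_1 - 1` and `h ≥ l_2` is the required bound `2 h ≥ |l| -
1`; if `l_1 = 0`, the bounds `h ≥ l_0` and `h ≥ l_2` suffice. -/
theorem spectral_of_three [IsLocalRing O] (h : IsBranchModel θ) (b : Fin 3 ≃ Branch O) {x y : O}
    (hx : θ x (b 0) = ct) (hy₀ : θ y (b 0) = 0) (hy₁ : θ y (b 1) = ct) (hy₂ : θ y (b 2) = ct) :
    IsLeast (Set.range (weight O)) (-1) ∧ HasMinimalSpectralCycle O 1 0 := by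
  have := h.finite
  have := Fintype.ofFinite (Branch O)
  have h1 : constCoeff (1 : Ct) ≠ 0 := by rw [map_one]; exact one_ne_zero
  have hm0 := h.multiplicity_eq_one_of_eq h1 (hx.trans (mul_one ct).symm)
  have hm1 := h.multiplicity_eq_one_of_eq h1 (hy₁.trans (mul_one ct).symm)
  have hm2 := h.multiplicity_eq_one_of_eq h1 (hy₂.trans (mul_one ct).symm)
  have hsize : ∀ l : Branch O → ℕ, size l = l (b 0) + l (b 1) + l (b 2) := fun l => by
    rw [size_eq_sum, ← b.sum_comp, Fin.sum_univ_three]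
  refine h.isLeast_weight_and_cycle ?_ (fun l => ?_) (i := b 0) (j := b 1)
    (h.not_sameLeading hy₀ h1 (by rw [hm1, hy₁, pow_one, mul_one]))
  · rw [hsize, hm0, hm1, hm2]
  · rw [weight, hsize]
    have key : ∀ j : Fin 3, θ y (b j) = ct → l (b j) ≤ hilbert O l ∧
        (l (b j) ≠ 0 → l (b 0) + (l (b j) - 1) ≤ hilbert O l) := fun j hj =>
      ⟨h.le_hilbert l one_ne_zero h1 (by rw [hj, pow_one, mul_one]) _ fun k hk => by rwa [one_mul],
        fun h0 => h.add_le_hilbert l one_ne_zero h1 h1 (hx.trans (mul_one ct).symm) hy₀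
          (by rw [hj, pow_one, mul_one]) _ (by omega)⟩
    have h2 := h.le_hilbert l one_ne_zero h1 (show θ x (b 0) = ct ^ 1 * 1 by
      rw [hx, pow_one, mul_one]) (l (b 0)) fun k hk => by rwa [one_mul]
    obtain ⟨h3, h4⟩ := key 1 hy₁
    obtain ⟨h5, h6⟩ := key 2 hy₂
    push_cast
    omega

/-- With `c = ⌈l_1 / 2⌉ ≥ 1`, the powers give `h ≥ l_0 + c - 1` and `h ≥ c`, so `2 h ≥ l_0 + 2 c - 1
≥ |l| - 1`; if `l_1 = 0`, already `h ≥ l_0` suffices. -/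
theorem spectral_of_two [IsLocalRing O] (h : IsBranchModel θ) (b : Fin 2 ≃ Branch O) {x y : O}
    (hx : θ x (b 0) = ct) (hy₀ : θ y (b 0) = 0) (hy₁ : θ y (b 1) = ct ^ 2)
    (hm : multiplicity O (b 1) ≠ 1) :
    IsLeast (Set.range (weight O)) (-1) ∧ HasMinimalSpectralCycle O 1 0 := by
  have := h.finite
  have := Fintype.ofFinite (Branch O)
  have h1 : constCoeff (1 : Ct) ≠ 0 := by rw [map_one]; exact one_ne_zero
  have hm0 := h.multiplicity_eq_one_of_eq h1 (hx.trans (mul_one ct).symm)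
  have hm1 : multiplicity O (b 1) = 2 := by
    have h2 := h.one_le_multiplicity (b 1)
    have h3 := h.multiplicity_dvd (b 1) (f := y) (by
      rw [h.isUnit_iff (b 0), not_not, hy₀, map_zero])
    rw [hy₁] at h3
    have h4 := (pow_dvd_pow_iff ct_ne_zero prime_ct.not_isUnit).1 h3
    omega
  have hsize : ∀ l : Branch O → ℕ, size l = l (b 0) + l (b 1) := fun l => by
    rw [size_eq_sum, ← b.sum_comp, Fin.sum_univ_two]
  refine h.isLeast_weight_and_cycle ?_ (fun l => ?_) (i := b 0) (j := b 1)
    (h.not_sameLeading hy₀ h1 (by rw [hm1, hy₁, mul_one]))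
  · rw [hsize, hm0, hm1]
  · rw [weight, hsize]
    have h2 := h.le_hilbert l one_ne_zero h1 (show θ x (b 0) = ct ^ 1 * 1 by
      rw [hx, pow_one, mul_one]) (l (b 0)) fun k hk => by rwa [one_mul]
    have h3 := h.le_hilbert l two_ne_zero h1 (show θ y (b 1) = ct ^ 2 * 1 by
      rw [hy₁, mul_one]) ((l (b 1) + 1) / 2) fun k hk => by omega
    have h4 : l (b 1) ≠ 0 → l (b 0) + ((l (b 1) + 1) / 2 - 1) ≤ hilbert O l := fun h0 =>
      h.add_le_hilbert l two_ne_zero h1 h1 (hx.trans (mul_one ct).symm) hy₀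
        (by rw [hy₁, mul_one]) _ (by omega)
    push_cast
    omega

end IsBranchModel

/-! ### From dominance of `D_n` to the weight bound and the cycle. -/

section Forward

variable {O : Type u} [CommRing O] [Algebra ℂ O]

theorem constCoeff_smul_ct_pow (c : ℂ) {k : ℕ} (hk : k ≠ 0) : constCoeff (c • ct ^ k) = 0 := by
  rw [map_smul, map_pow, constCoeff_ct, zero_pow hk, smul_zero]

/-- The branches of `D_{2 k + 2}` are the line `y = 0` and the two smooth curves `x = ± i y ^ k`. -/
theorem spectral_of_dominates_even [IsLocalRing O] {k : ℕ} (hk : k ≠ 0)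
    (h : BirationallyDominates O (GermD (2 * k + 2))) :
    IsLeast (Set.range (weight O)) (-1) ∧ HasMinimalSpectralCycle O 1 0 := by
  have h1 : constCoeff (1 : Ct) ≠ 0 := by rw [map_one]; exact one_ne_zero
  have h0 : constCoeff (0 : Ct) = 0 := map_zero _
  have hc := constCoeff_ct
  have hk1 := constCoeff_smul_ct_pow Complex.I hk
  have hk2 : constCoeff (-(Complex.I • ct ^ k)) = 0 := by rw [map_neg, hk1, neg_zero]
  let Φ : ConvergentPowerSeries (Fin 2) →ₐ[ℂ] (Fin 3 → Ct) := AlgHom.pi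
    ![evalAt₂ ct 0 hc h0, evalAt₂ (Complex.I • ct ^ k) ct hk1 hc,
      evalAt₂ (-(Complex.I • ct ^ k)) ct hk2 hc]
  have hx0 : Φ (coord 0) 0 = ct := evalAt₂_zero _ _ hc h0
  have hx1 : Φ (coord 0) 1 = Complex.I • ct ^ k := evalAt₂_zero _ _ hk1 hc
  have hx2 : Φ (coord 0) 2 = -(Complex.I • ct ^ k) := evalAt₂_zero _ _ hk2 hc
  have hy0 : Φ (coord 1) 0 = 0 := evalAt₂_one _ _ hc h0
  have hy1 : Φ (coord 1) 1 = ct := evalAt₂_one _ _ hk1 hc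
  have hy2 : Φ (coord 1) 2 = ct := evalAt₂_one _ _ hk2 hc
  have hΦ : Parametrizes Φ (coord 0 ^ 2 * coord 1 + coord 1 ^ (2 * k + 1)) :=
    parametrizes_germD_even hk (i₀ := 0) (i₁ := 1) (i₂ := 2) (by decide) (by decide) (by decide)
      (by decide) h1 h1 h1 (by rw [hx0, mul_one]) hy0 (by rw [hy1, mul_one]) (by rw [hx1, hy1])
      (by rw [hy2, mul_one]) (by rw [hx2, hy2])
  obtain ⟨E, θ, hθ, hE⟩ := hΦ.exists_model_of_birationallyDominates h
  obtain ⟨b, θ', hθ', hb⟩ := hθ.exists_branchModel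
  exact hθ'.spectral_of_three b (x := E (coord 0)) (y := E (coord 1))
    (by rw [hb, hE, hx0]) (by rw [hb, hE, hy0]) (by rw [hb, hE, hy1]) (by rw [hb, hE, hy2])

/-- The branches of `D_{2 p + 3}` are the line `y = 0` and the curve `(i t ^ (2 p + 1), t ^ 2)`. In
the dominating germ the second branch could acquire multiplicity one, but then the germ would be
some `A_n`. -/
theorem spectral_of_dominates_odd [IsLocalRing O] (hO : IsReducedCurveGerm O)
    (hA : ¬ ∃ n : ℕ, Nonempty (O ≃ₐ[ℂ] GermA n)) {p : ℕ}
    (h : BirationallyDominates O (GermD (2 * p + 3))) :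
    IsLeast (Set.range (weight O)) (-1) ∧ HasMinimalSpectralCycle O 1 0 := by
  have h1 : constCoeff (1 : Ct) ≠ 0 := by rw [map_one]; exact one_ne_zero
  have h0 : constCoeff (0 : Ct) = 0 := map_zero _
  have hc := constCoeff_ct
  have hk1 := constCoeff_smul_ct_pow Complex.I (Nat.succ_ne_zero (2 * p))
  have hk2 : constCoeff (ct ^ 2) = 0 := by rw [map_pow, constCoeff_ct, zero_pow two_ne_zero]
  let Φ : ConvergentPowerSeries (Fin 2) →ₐ[ℂ] (Fin 2 → Ct) := AlgHom.pi
    ![evalAt₂ ct 0 hc h0, evalAt₂ (Complex.I • ct ^ (2 * p + 1)) (ct ^ 2) hk1 hk2]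
  have hx0 : Φ (coord 0) 0 = ct := evalAt₂_zero _ _ hc h0
  have hx1 : Φ (coord 0) 1 = Complex.I • ct ^ (2 * p + 1) := evalAt₂_zero _ _ hk1 hk2
  have hy0 : Φ (coord 1) 0 = 0 := evalAt₂_one _ _ hc h0
  have hy1 : Φ (coord 1) 1 = ct ^ 2 := evalAt₂_one _ _ hk1 hk2
  have hΦ : Parametrizes Φ (coord 0 ^ 2 * coord 1 + coord 1 ^ (2 * p + 2)) :=
    parametrizes_germD_odd (i₀ := 0) (i₁ := 1) (by decide) (by decide) h1 h1
      (by rw [hx0, mul_one]) hy0 (by rw [hy1, mul_one])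
      (by rw [hx1, hy1, I_smul_pow_sq, ← pow_mul])
  obtain ⟨E, θ, hθ, hE⟩ := hΦ.exists_model_of_birationallyDominates h
  obtain ⟨b, θ', hθ', hb⟩ := hθ.exists_branchModel
  have hx : θ' (E (coord 0)) (b 0) = ct := by rw [hb, hE, hx0]
  refine hθ'.spectral_of_two b (x := E (coord 0)) (y := E (coord 1)) hx
    (by rw [hb, hE, hy0]) (by rw [hb, hE, hy1]) fun hm => hA ?_
  refine hθ'.exists_equiv_germA hO (i₁ := b 0) (i₂ := b 1) (b.injective.ne (by decide))
    (fun i => ?_) (hθ'.multiplicity_eq_one_of_eq h1 (hx.trans (mul_one ct).symm)) hm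
  obtain ⟨j, rfl⟩ := b.surjective i
  simp only [b.injective.eq_iff]
  revert j
  decide

end Forward

end CurveGerm

end

theorem mainTheorem6 {O : Type*} [CommRing O] [Algebra ℂ O]
    (hO : CurveGerm.IsReducedCurveGerm O)
    (hA : ¬ ∃ n : ℕ, Nonempty (O ≃ₐ[ℂ] CurveGerm.GermA n)) :
    (∃ n : ℕ, 4 ≤ n ∧ CurveGerm.BirationallyDominates O (CurveGerm.GermD n)) ↔
      (IsLeast (Set.range (CurveGerm.weight O)) (-1) ∧
        CurveGerm.HasMinimalSpectralCycle O 1 0) := by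
  obtain ⟨hloc, ι, hι, θ₀, hθ₀⟩ := hO.exists_model
  constructor
  · rintro ⟨n, hn, h⟩
    rcases Nat.even_or_odd' n with ⟨k, rfl | rfl⟩
    · obtain ⟨k, rfl⟩ : ∃ k', k = k' + 1 := ⟨k - 1, by omega⟩
      exact CurveGerm.spectral_of_dominates_even (k := k) (by omega) h
    · obtain ⟨p, rfl⟩ : ∃ p, k = p + 1 := ⟨k - 1, by omega⟩
      exact CurveGerm.spectral_of_dominates_odd hO hA (p := p) h
  · rintro ⟨-, h⟩
    obtain ⟨-, θ, hθ, -⟩ := hθ₀.exists_branchModel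
    obtain ⟨hm, i, j, hij⟩ := hθ.hasMinimalSpectralCycle_iff.1 h
    exact hθ.exists_dominates_germD hO hm hij
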